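/- Let $k$ be a commutative ring and let $H$ be a Hopf algebra over $k$ with bijective antipode $S$. Write $\rho(m)=m_{[0]}\otimes m_{[1]}$ for right $H$-coactions, $M^{{\rm co}H}=\{m\in M\mid \rho(m)=m\otimes 1\}$ for the coinvariants, and $\otimes=\otimes_k$. Let $A$ and $B$ be right $H$-comodule algebras that are right faithfully flat $H$-Galois extensions of $A^{{\rm co}H}$ and $B^{{\rm co}H}$; that is, the map $A\otimes_{A^{{\rm co}H}}A\to A\otimes H$, $a\otimes b\mapsto a_{[0]}b\otimes a_{[1]}$, is bijective and $A$ is faithfully flat as a right $A^{{\rm co}H}$-module, and similarly for $B$. *Notation.* Let ${}_A\mathcal M_B^H$ be the category of $(A,B)$-bimodules $M$ with a right $H$-coaction satisfying $\rho(amb)=a_{[0]}m_{[0]}b_{[0]}\otimes a_{[1]}m_{[1]}b_{[1]}$, with bilinear and colinear maps as morphisms. For $M\in{}_A\mathcal M_B^H$ and $N\in{}_B\mathcal M_C^H$, the coaction on $M\otimes_BN$ is $\rho(m\otimes n)=m_{[0]}\otimes n_{[0]}\otimes m_{[1]}n_{[1]}$. Let $A\square_HB^{\rm op}$ be the subalgebra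 of $A\otimes B^{\rm op}$ of those $\sum_i a_i\otimes b_i$ with $\sum_i a_{i[0]}\otimes a_{i[1]}\otimes b_i=\sum_i a_i\otimes S^{-1}(b_{i[1]})\otimes b_{i[0]}$. It contains $A^{{\rm co}H}\otimes 1$ and $1\otimes (B^{{\rm co}H})^{\rm op}$, so every left $A\square_HB^{\rm op}$-module $M_1$ is an $(A^{{\rm co}H},B^{{\rm co}H})$-bimodule by restriction of scalars. If $M\in{}_A\mathcal M_B^H$, then $M^{{\rm co}H}$ is a left $A\square_HB^{\rm op}$-module via $(\sum_i a_i\otimes b_i)m=\sum_i a_imb_i$; in particular, $A^{{\rm co}H}$ is a left $A\square_HA^{\rm op}$-module. For a left $A\square_HB^{\rm op}$-module $M_1$, put $$F(M_1)=(A\otimes B^{\rm op})\otimes_{A\square_HB^{\rm op}}M_1\in{}_A\mathcal M_B^H,$$ with bimodule structure $a'((a\otimes b)\otimes m)b'=(a'a\otimes bb')\otimes m$ (where $bb'$ is the product in $B$) and coaction $(a\otimes b)\otimes m\mapsto (a_{[0]}\otimes b_{[0]})\otimes m\otimes a_{[1]}b_{[1]}$. If $M_1$ is a left $A\square_HB^{\rm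 op}$-module and $N_1$ is a left $B\square_HA^{\rm op}$-module, then $$M_1\otimes_{B^{{\rm co}H}}N_1\to (F(M_1)\otimes_BF(N_1))^{{\rm co}H},\quad m\otimes n\mapsto (1\otimes m)\otimes(1\otimes n),$$ is bijective, and $M_1\otimes_{B^{{\rm co}H}}N_1$ is regarded as a left $A\square_HA^{\rm op}$-module by transport of structure along this map. *$H$-Morita contexts.* ${\rm Morita}^H(A,B)$ is the category of Morita contexts $(A,B,M,N,\alpha,\beta)$ such that $M\in{}_A\mathcal M_B^H$, $N\in{}_B\mathcal M_A^H$, $\alpha:M\otimes_BN\to A$ is a morphism in ${}_A\mathcal M_A^H$ and $\beta:N\otimes_AM\to B$ is a morphism in ${}_B\mathcal M_B^H$. Morphisms are pairs $(\mu,\nu)$ of morphisms $\mu:M\to M'$ in ${}_A\mathcal M_B^H$ and $\nu:N\to N'$ in ${}_B\mathcal M_A^H$ with $\alpha'\circ(\mu\otimes\nu)=\alpha$ and $\beta'\circ(\nu\otimes\mu)=\beta$. *$\square_H$-Morita contexts.* ${\rm Morita}^{\square_H}(A^{{\rm co}H},B^{{\rm co}H})$ is the category of Morita contexts $(A^{{\rm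 co}H},B^{{\rm co}H},M_1,N_1,\alpha_1,\beta_1)$ such that $M_1$ is a left $A\square_HB^{\rm op}$-module and $N_1$ is a left $B\square_HA^{\rm op}$-module (with the restricted bimodule structures), $\alpha_1:M_1\otimes_{B^{{\rm co}H}}N_1\to A^{{\rm co}H}$ is left $A\square_HA^{\rm op}$-linear and $\beta_1:N_1\otimes_{A^{{\rm co}H}}M_1\to B^{{\rm co}H}$ is left $B\square_HB^{\rm op}$-linear. Morphisms are pairs $(\mu_1,\nu_1)$ of an $A\square_HB^{\rm op}$-linear map and a $B\square_HA^{\rm op}$-linear map that are compatible with the connecting maps. In either case a context is strict if both connecting maps are bijective. **Theorem.** The functor $${\rm Morita}^H(A,B)\to{\rm Morita}^{\square_H}(A^{{\rm co}H},B^{{\rm co}H}),\quad (A,B,M,N,\alpha,\beta)\mapsto(A^{{\rm co}H},B^{{\rm co}H},M^{{\rm co}H},N^{{\rm co}H},\alpha_1,\beta_1),$$ where $\alpha_1(m\otimes n)=\alpha(m\otimes n)$ and $\beta_1(n\otimes m)=\beta(n\otimes m)$, is an equivalence of categories. A quasi-inverse is the functor that sends $(A^{{\rm co}H},B^{{\rm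 co}H},M_1,N_1,\alpha_1,\beta_1)$ to $(A,B,F(M_1),F(N_1),\alpha,\beta)$ and $(\mu_1,\nu_1)$ to $(F(\mu_1),F(\nu_1))$, where $\alpha$ and $\beta$ are the (unique) bilinear maps with $\alpha((1\otimes m)\otimes(1\otimes n))=\alpha_1(m\otimes n)$ and $\beta((1\otimes n)\otimes(1\otimes m))=\beta_1(n\otimes m)$. Both functors send strict contexts to strict contexts. -/

import Mathlib

open TensorProduct MulOpposite CategoryTheory

universe u v

set_option linter.unusedSectionVars false

namespace HopfMorita

/-! ## Right comodules and coinvariants -/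

section Comodules

variable (k : Type*) [CommRing k] (H : Type*) [Ring H] [HopfAlgebra k H]

/-- A right `H`-comodule structure `ρ(m) = m₍₀₎ ⊗ m₍₁₎` on a `k`-module. -/
class RightComodule (M : Type*) [AddCommGroup M] [Module k M] where
  coact : M →ₗ[k] M ⊗[k] H
  coassoc : ∀ m, TensorProduct.assoc k M H H (coact.rTensor H (coact m)) =
    (Coalgebra.comul (R := k) (A := H)).lTensor M (coact m)
  counit : ∀ m, TensorProduct.rid k M
    ((Coalgebra.counit (R := k) (A := H)).lTensor M (coact m)) = m

/-- The coaction `ρ : M → M ⊗ H`. -/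
abbrev coact (M : Type*) [AddCommGroup M] [Module k M] [RightComodule k H M] :
    M →ₗ[k] M ⊗[k] H :=
  RightComodule.coact

/-- The coinvariants `M^{co H} = {m | ρ(m) = m ⊗ 1}`. -/
def coinv (M : Type*) [AddCommGroup M] [Module k M] [RightComodule k H M] : Submodule k M where
  carrier := {m | coact k H M m = m ⊗ₜ[k] (1 : H)}
  add_mem' := by
    intro a b ha hb
    simp only [Set.mem_ofPred_eq] at *
    rw [map_add, ha, hb, TensorProduct.add_tmul]
  zero_mem' := by simp
  smul_mem' := by
    intro c x hx
    simp only [Set.mem_ofPred_eq] at *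
    rw [map_smul, hx, TensorProduct.smul_tmul']

/-- A right `H`-comodule algebra: the coaction is an algebra map. -/
class ComoduleAlgebra (A : Type*) [Ring A] [Algebra k A] extends RightComodule k H A where
  coact_one : coact 1 = 1
  coact_mul : ∀ a b, coact (a * b) = coact a * coact b

/-- The Hopf algebra `H` has a bijective antipode. -/
class HasBijectiveAntipode : Prop where
  bijective : Function.Bijective (HopfAlgebra.antipode k : H →ₗ[k] H)

/-- The inverse `S⁻¹` of the antipode. -/
noncomputable def antipodeInv [HasBijectiveAntipode k H] : H →ₗ[k] H :=
  (LinearEquiv.ofBijective (HopfAlgebra.antipode k : H →ₗ[k] H)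
    HasBijectiveAntipode.bijective).symm.toLinearMap

end Comodules

/-! ## Products on `- ⊗ H` -/

section Star

variable {k : Type*} [CommRing k] (H : Type*) [Ring H] [Algebra k H]
variable {P Q R P' Q' R' S : Type*}
  [AddCommGroup P] [Module k P] [AddCommGroup Q] [Module k Q] [AddCommGroup R] [Module k R]
  [AddCommGroup P'] [Module k P'] [AddCommGroup Q'] [Module k Q']
  [AddCommGroup R'] [Module k R'] [AddCommGroup S] [Module k S]

/-- For a bilinear `t : P × Q → R`, the bilinear map `(P ⊗ H) × (Q ⊗ H) → R ⊗ H`,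
`(p ⊗ g, q ⊗ h) ↦ t p q ⊗ g h`. -/
noncomputable def diagMul (t : P →ₗ[k] Q →ₗ[k] R) : P ⊗[k] H →ₗ[k] Q ⊗[k] H →ₗ[k] R ⊗[k] H :=
  TensorProduct.map₂ t (LinearMap.mul k H)

variable {H}

@[simp] theorem diagMul_tmul (t : P →ₗ[k] Q →ₗ[k] R) (p : P) (g : H) (q : Q) (h : H) :
    diagMul H t (p ⊗ₜ g) (q ⊗ₜ h) = t p q ⊗ₜ (g * h) := by
  simp [diagMul]

theorem diagMul_assoc (t : P' →ₗ[k] R →ₗ[k] S) (s : P →ₗ[k] Q →ₗ[k] P')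
    (t' : P →ₗ[k] Q' →ₗ[k] S) (s' : Q →ₗ[k] R →ₗ[k] Q')
    (h : ∀ p q r, t (s p q) r = t' p (s' q r)) (x : P ⊗[k] H) (y : Q ⊗[k] H) (z : R ⊗[k] H) :
    diagMul H t (diagMul H s x y) z = diagMul H t' x (diagMul H s' y z) := by
  induction x with
  | zero => simp
  | add x₁ x₂ h₁ h₂ => simp only [map_add, LinearMap.add_apply, h₁, h₂]
  | tmul p g =>
    induction y with
    | zero => simp
    | add x₁ x₂ h₁ h₂ => simp only [map_add, LinearMap.add_apply, h₁, h₂]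
    | tmul q g' =>
      induction z with
      | zero => simp
      | add x₁ x₂ h₁ h₂ => simp only [map_add, h₁, h₂]
      | tmul r g'' => simp [h, mul_assoc]

theorem diagMul_mul_eq {A : Type*} [Ring A] [Algebra k A] (x y : A ⊗[k] H) :
    diagMul H (LinearMap.mul k A) x y = x * y := by
  induction x with
  | zero => simp
  | add x₁ x₂ h₁ h₂ => simp only [map_add, LinearMap.add_apply, h₁, h₂, add_mul]
  | tmul p g =>
    induction y with
    | zero => simp
    | add x₁ x₂ h₁ h₂ => simp only [map_add, h₁, h₂, mul_add]
    | tmul q g' => simp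

theorem rTensor_diagMul (f : R →ₗ[k] R') (f₁ : P →ₗ[k] P') (f₂ : Q →ₗ[k] Q')
    (t : P →ₗ[k] Q →ₗ[k] R) (t' : P' →ₗ[k] Q' →ₗ[k] R')
    (h : ∀ p q, f (t p q) = t' (f₁ p) (f₂ q)) (x : P ⊗[k] H) (y : Q ⊗[k] H) :
    f.rTensor H (diagMul H t x y) = diagMul H t' (f₁.rTensor H x) (f₂.rTensor H y) := by
  induction x with
  | zero => simp
  | add x₁ x₂ h₁ h₂ => simp only [map_add, LinearMap.add_apply, h₁, h₂]
  | tmul p g =>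
    induction y with
    | zero => simp
    | add x₁ x₂ h₁ h₂ => simp only [map_add, h₁, h₂]
    | tmul q g' => simp [h]

/-- Freezing a coinvariant first argument. -/
theorem diagMul_tmul_one_left (t : P →ₗ[k] Q →ₗ[k] R) (p : P) (y : Q ⊗[k] H) :
    diagMul H t (p ⊗ₜ 1) y = (t p).rTensor H y := by
  induction y with
  | zero => simp
  | add x₁ x₂ h₁ h₂ => simp only [map_add, h₁, h₂]
  | tmul q g' => simp

end Star

section StarComodule

variable {k : Type*} [CommRing k] {H : Type*} [Ring H] [HopfAlgebra k H]
variable {P Q R : Type*}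
  [AddCommGroup P] [Module k P] [AddCommGroup Q] [Module k Q] [AddCommGroup R] [Module k R]

theorem comul_diagMul (t : P →ₗ[k] Q →ₗ[k] R) (x : P ⊗[k] H) (y : Q ⊗[k] H) :
    (Coalgebra.comul (R := k) (A := H)).lTensor R (diagMul H t x y) =
      diagMul (H ⊗[k] H) t ((Coalgebra.comul (R := k) (A := H)).lTensor P x)
        ((Coalgebra.comul (R := k) (A := H)).lTensor Q y) := by
  induction x with
  | zero => simp
  | add x₁ x₂ h₁ h₂ => simp only [map_add, LinearMap.add_apply, h₁, h₂]
  | tmul p g =>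
    induction y with
    | zero => simp
    | add x₁ x₂ h₁ h₂ => simp only [map_add, h₁, h₂]
    | tmul q g' => simp

theorem counit_diagMul (t : P →ₗ[k] Q →ₗ[k] R) (x : P ⊗[k] H) (y : Q ⊗[k] H) :
    TensorProduct.rid k R ((Coalgebra.counit (R := k) (A := H)).lTensor R (diagMul H t x y)) =
      t (TensorProduct.rid k P ((Coalgebra.counit (R := k) (A := H)).lTensor P x))
        (TensorProduct.rid k Q ((Coalgebra.counit (R := k) (A := H)).lTensor Q y)) := by
  induction x with
  | zero => simp
  | add x₁ x₂ h₁ h₂ => simp only [map_add, LinearMap.add_apply, h₁, h₂]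
  | tmul p g =>
    induction y with
    | zero => simp
    | add x₁ x₂ h₁ h₂ => simp only [map_add, h₁, h₂]
    | tmul q g' =>
      simp only [diagMul_tmul, LinearMap.lTensor_tmul, Bialgebra.counit_mul,
        TensorProduct.rid_tmul, map_smul, LinearMap.smul_apply, mul_smul]
      first | rfl | exact smul_comm _ _ _

theorem assoc_diagMul (t : P →ₗ[k] Q →ₗ[k] R) (x : P ⊗[k] H) (y : Q ⊗[k] H) (g h : H) :
    TensorProduct.assoc k R H H (diagMul H t x y ⊗ₜ (g * h)) =
      diagMul (H ⊗[k] H) t (TensorProduct.assoc k P H H (x ⊗ₜ g))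
        (TensorProduct.assoc k Q H H (y ⊗ₜ h)) := by
  induction x with
  | zero => simp
  | add x₁ x₂ h₁ h₂ => simp only [map_add, LinearMap.add_apply, TensorProduct.add_tmul, h₁, h₂]
  | tmul p g =>
    induction y with
    | zero => simp
    | add x₁ x₂ h₁ h₂ => simp only [map_add, TensorProduct.add_tmul, h₁, h₂]
    | tmul q g' => simp

theorem coassoc_diagMul (t : P →ₗ[k] Q →ₗ[k] R) (φP : P →ₗ[k] P ⊗[k] H) (φQ : Q →ₗ[k] Q ⊗[k] H)
    (φR : R →ₗ[k] R ⊗[k] H) (hφ : ∀ p q, φR (t p q) = diagMul H t (φP p) (φQ q))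
    (x : P ⊗[k] H) (y : Q ⊗[k] H) :
    TensorProduct.assoc k R H H (φR.rTensor H (diagMul H t x y)) =
      diagMul (H ⊗[k] H) t (TensorProduct.assoc k P H H (φP.rTensor H x))
        (TensorProduct.assoc k Q H H (φQ.rTensor H y)) := by
  induction x with
  | zero => simp
  | add x₁ x₂ h₁ h₂ => simp only [map_add, LinearMap.add_apply, h₁, h₂]
  | tmul p g =>
    induction y with
    | zero => simp
    | add x₁ x₂ h₁ h₂ => simp only [map_add, h₁, h₂]
    | tmul q g' => simp only [diagMul_tmul, LinearMap.rTensor_tmul, hφ, assoc_diagMul]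

end StarComodule

/-! ## The tensor product over a noncommutative `k`-algebra -/

section Balanced

variable (k : Type*) [CommRing k] (R : Type*) [Ring R]

/-- The relations `m r ⊗ n - m ⊗ r n`. -/
def balancedRel (M N : Type*) [AddCommGroup M] [Module k M] [Module Rᵐᵒᵖ M]
    [AddCommGroup N] [Module k N] [Module R N] : Submodule k (M ⊗[k] N) :=
  Submodule.span k {x | ∃ (m : M) (r : R) (n : N), x = (op r • m) ⊗ₜ n - m ⊗ₜ (r • n)}

/-- `M ⊗_R N` for a right `R`-module `M` and a left `R`-module `N` over a `k`-algebra `R`: the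
quotient of `M ⊗_k N` by the relations `m r ⊗ n = m ⊗ r n`. -/
def BalTensor (M N : Type*) [AddCommGroup M] [Module k M] [Module Rᵐᵒᵖ M]
    [AddCommGroup N] [Module k N] [Module R N] :=
  (M ⊗[k] N) ⧸ balancedRel k R M N

namespace BalTensor

section Basic

variable (M N : Type*) [AddCommGroup M] [Module k M] [Module Rᵐᵒᵖ M]
    [AddCommGroup N] [Module k N] [Module R N]

noncomputable instance : AddCommGroup (BalTensor k R M N) :=
  inferInstanceAs (AddCommGroup ((M ⊗[k] N) ⧸ balancedRel k R M N))

noncomputable instance instModuleBase : Module k (BalTensor k R M N) :=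
  inferInstanceAs (Module k ((M ⊗[k] N) ⧸ balancedRel k R M N))

/-- The projection `M ⊗_k N → M ⊗_R N`. -/
noncomputable def proj : M ⊗[k] N →ₗ[k] BalTensor k R M N := (balancedRel k R M N).mkQ

/-- The universal bilinear map `(m, n) ↦ m ⊗_R n`. -/
noncomputable def mk : M →ₗ[k] N →ₗ[k] BalTensor k R M N :=
  (TensorProduct.mk k M N).compr₂ (proj k R M N)

variable {M N}

/-- The element `m ⊗_R n`. -/
noncomputable def tmul (m : M) (n : N) : BalTensor k R M N := mk k R M N m n

variable {k R}

theorem tmul_balanced (r : R) (m : M) (n : N) :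
    tmul k R (op r • m) n = tmul k R m (r • n) := by
  have : (op r • m) ⊗ₜ n - m ⊗ₜ[k] (r • n) ∈ balancedRel k R M N :=
    Submodule.subset_span ⟨m, r, n, rfl⟩
  exact (Submodule.Quotient.eq _).2 this

theorem tmul_add_left (m m' : M) (n : N) :
    tmul k R (m + m') n = tmul k R m n + tmul k R m' n := by simp [tmul]

theorem tmul_add_right (m : M) (n n' : N) :
    tmul k R m (n + n') = tmul k R m n + tmul k R m n' := by simp [tmul]

@[elab_as_elim]
theorem induction {p : BalTensor k R M N → Prop} (x : BalTensor k R M N) (h0 : p 0)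
    (ht : ∀ m n, p (tmul k R m n)) (ha : ∀ x y, p x → p y → p (x + y)) : p x := by
  obtain ⟨y, rfl⟩ := Submodule.mkQ_surjective (balancedRel k R M N) x
  induction y with
  | zero => rw [map_zero]; exact h0
  | tmul m n => exact ht m n
  | add y₁ y₂ h₁ h₂ => rw [map_add]; exact ha _ _ h₁ h₂

variable {P : Type*} [AddCommGroup P] [Module k P]

/-- The linear map induced by a balanced bilinear map. -/
noncomputable def lift (f : M →ₗ[k] N →ₗ[k] P)
    (hf : ∀ (r : R) m n, f (op r • m) n = f m (r • n)) : BalTensor k R M N →ₗ[k] P :=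
  (balancedRel k R M N).liftQ (TensorProduct.lift f) (by
    rw [balancedRel, Submodule.span_le]
    rintro _ ⟨m, r, n, rfl⟩
    simp [hf])

@[simp] theorem lift_tmul (f : M →ₗ[k] N →ₗ[k] P) (hf) (m : M) (n : N) :
    lift (R := R) f hf (tmul k R m n) = f m n := by
  change (balancedRel k R M N).liftQ _ _ ((balancedRel k R M N).mkQ (m ⊗ₜ n)) = _
  simp

theorem hom_ext {f g : BalTensor k R M N →ₗ[k] P}
    (h : ∀ m n, f (tmul k R m n) = g (tmul k R m n)) : f = g := by
  ext x
  induction x using BalTensor.induction with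
  | h0 => simp
  | ht m n => exact h m n
  | ha x y hx hy => simp [hx, hy]

variable {M' N' : Type*} [AddCommGroup M'] [Module k M'] [Module Rᵐᵒᵖ M']
    [AddCommGroup N'] [Module k N'] [Module R N']

/-- The map `f ⊗_R g`. -/
noncomputable def map (f : M →ₗ[k] M') (hf : ∀ (r : R) m, f (op r • m) = op r • f m)
    (g : N →ₗ[k] N') (hg : ∀ (r : R) n, g (r • n) = r • g n) :
    BalTensor k R M N →ₗ[k] BalTensor k R M' N' :=
  lift ((mk k R M' N').compl₁₂ f g) (fun r m n => by
    simp only [LinearMap.compl₁₂_apply, hf, hg]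
    exact tmul_balanced r (f m) (g n))

@[simp] theorem map_tmul (f : M →ₗ[k] M') (hf) (g : N →ₗ[k] N') (hg) (m : M) (n : N) :
    map (R := R) f hf g hg (tmul k R m n) = tmul k R (f m) (g n) := by
  simp only [map, lift_tmul, LinearMap.compl₁₂_apply]
  rfl

end Basic

section Actions

variable {k R}
variable {L : Type*} [Ring L] [Algebra k L] {L' : Type*} [Ring L'] [Algebra k L']
variable (M N : Type*) [AddCommGroup M] [Module k M] [Module Rᵐᵒᵖ M]
    [AddCommGroup N] [Module k N] [Module R N]

section Left

variable [Module L M] [IsScalarTower k L M] [SMulCommClass L Rᵐᵒᵖ M]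

/-- The map `m ⊗ n ↦ a m ⊗ n`. -/
noncomputable def leftMap (a : L) : BalTensor k R M N →ₗ[k] BalTensor k R M N :=
  map (Algebra.lsmul k k M a) (by intro r m; simp only [Algebra.lsmul_coe]; exact smul_comm _ _ _)
    LinearMap.id (by intro r n; rfl)

theorem leftMap_tmul (a : L) (m : M) (n : N) :
    leftMap M N a (tmul k R m n) = tmul k R (a • m) n := by
  simp [leftMap]

/-- `M ⊗_R N` is a left `L`-module through `M`. -/
noncomputable instance (priority := 900) instModuleLeft : Module L (BalTensor k R M N) where
  smul a x := leftMap M N a x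
  one_smul x := by
    change leftMap M N (1 : L) x = x
    induction x using BalTensor.induction with
    | h0 => rw [map_zero]
    | ht m n => rw [leftMap_tmul, one_smul]
    | ha x y hx hy => rw [map_add, hx, hy]
  mul_smul a b x := by
    change leftMap M N (a * b) x = leftMap M N a (leftMap M N b x)
    induction x using BalTensor.induction with
    | h0 => simp only [map_zero]
    | ht m n => simp only [leftMap_tmul, mul_smul]
    | ha x y hx hy => simp only [map_add, hx, hy]
  smul_zero a := LinearMap.map_zero _
  smul_add a := LinearMap.map_add _
  add_smul a b x := by
    change leftMap M N (a + b) x = leftMap M N a x + leftMap M N b x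
    induction x using BalTensor.induction with
    | h0 => simp only [map_zero, add_zero]
    | ht m n => simp only [leftMap_tmul, add_smul, tmul_add_left]
    | ha x y hx hy => simp only [map_add, hx, hy]; abel
  zero_smul x := by
    change leftMap M N (0 : L) x = 0
    induction x using BalTensor.induction with
    | h0 => simp only [map_zero]
    | ht m n => simp only [leftMap_tmul, zero_smul]; simp [tmul]
    | ha x y hx hy => simp only [map_add, hx, hy, add_zero]

variable {M N}

theorem smul_tmul_left (a : L) (m : M) (n : N) :
    a • tmul k R m n = tmul k R (a • m) n := leftMap_tmul M N a m n

variable (M N)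

instance (priority := 900) instTowerLeft : IsScalarTower k L (BalTensor k R M N) where
  smul_assoc c a x := by
    induction x using BalTensor.induction with
    | h0 => simp only [smul_zero]
    | ht m n => simp only [smul_tmul_left, smul_assoc]; simp [tmul]
    | ha x y hx hy => simp only [smul_add, hx, hy]

end Left

section Right

variable [Module L'ᵐᵒᵖ N] [IsScalarTower k L'ᵐᵒᵖ N] [SMulCommClass R L'ᵐᵒᵖ N]

/-- The map `m ⊗ n ↦ m ⊗ a n`. -/
noncomputable def rightMap (a : L'ᵐᵒᵖ) : BalTensor k R M N →ₗ[k] BalTensor k R M N :=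
  map LinearMap.id (by intro r m; rfl) (Algebra.lsmul k k N a)
    (by intro r n; simp only [Algebra.lsmul_coe]; exact (smul_comm _ _ _).symm)

theorem rightMap_tmul (a : L'ᵐᵒᵖ) (m : M) (n : N) :
    rightMap M N a (tmul k R m n) = tmul k R m (a • n) := by
  simp [rightMap]

/-- `M ⊗_R N` is a right `L'`-module through `N`. -/
noncomputable instance instModuleRight : Module L'ᵐᵒᵖ (BalTensor k R M N) where
  smul a x := rightMap M N a x
  one_smul x := by
    change rightMap M N (1 : L'ᵐᵒᵖ) x = x
    induction x using BalTensor.induction with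
    | h0 => rw [map_zero]
    | ht m n => rw [rightMap_tmul, one_smul]
    | ha x y hx hy => rw [map_add, hx, hy]
  mul_smul a b x := by
    change rightMap M N (a * b) x = rightMap M N a (rightMap M N b x)
    induction x using BalTensor.induction with
    | h0 => simp only [map_zero]
    | ht m n => simp only [rightMap_tmul, mul_smul]
    | ha x y hx hy => simp only [map_add, hx, hy]
  smul_zero a := LinearMap.map_zero _
  smul_add a := LinearMap.map_add _
  add_smul a b x := by
    change rightMap M N (a + b) x = rightMap M N a x + rightMap M N b x
    induction x using BalTensor.induction with
    | h0 => simp only [map_zero, add_zero]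
    | ht m n => simp only [rightMap_tmul, add_smul, tmul_add_right]
    | ha x y hx hy => simp only [map_add, hx, hy]; abel
  zero_smul x := by
    change rightMap M N (0 : L'ᵐᵒᵖ) x = 0
    induction x using BalTensor.induction with
    | h0 => simp only [map_zero]
    | ht m n => simp only [rightMap_tmul, zero_smul]; simp [tmul]
    | ha x y hx hy => simp only [map_add, hx, hy, add_zero]

variable {M N}

theorem smul_tmul_right (a : L'ᵐᵒᵖ) (m : M) (n : N) :
    a • tmul k R m n = tmul k R m (a • n) := rightMap_tmul M N a m n

variable (M N)

instance instTowerRight : IsScalarTower k L'ᵐᵒᵖ (BalTensor k R M N) where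
  smul_assoc c a x := by
    induction x using BalTensor.induction with
    | h0 => simp only [smul_zero]
    | ht m n => simp only [smul_tmul_right, smul_assoc]; simp [tmul]
    | ha x y hx hy => simp only [smul_add, hx, hy]

variable [Module L M] [IsScalarTower k L M] [SMulCommClass L Rᵐᵒᵖ M]

instance instSMulComm : SMulCommClass L L'ᵐᵒᵖ (BalTensor k R M N) where
  smul_comm a c x := by
    induction x using BalTensor.induction with
    | h0 => simp only [smul_zero]
    | ht m n => simp only [smul_tmul_right, smul_tmul_left]
    | ha x y hx hy => simp only [smul_add, hx, hy]

end Right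

end Actions

end BalTensor

end Balanced

/-! ## Bimodules, relative Hopf bimodules and their tensor products -/

section Bimodules

variable (k : Type*) [CommRing k]

/-- Morphisms of `(R, S)`-bimodules. -/
structure BimodHom (R S : Type*) [Ring R] [Ring S] (X Y : Type*)
    [AddCommGroup X] [Module k X] [Module R X] [Module Sᵐᵒᵖ X]
    [AddCommGroup Y] [Module k Y] [Module R Y] [Module Sᵐᵒᵖ Y] extends X →ₗ[k] Y where
  map_left : ∀ (r : R) (x : X), toFun (r • x) = r • toFun x
  map_right : ∀ (s : Sᵐᵒᵖ) (x : X), toFun (s • x) = s • toFun x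

instance (R S : Type*) [Ring R] [Ring S] (X Y : Type*)
    [AddCommGroup X] [Module k X] [Module R X] [Module Sᵐᵒᵖ X]
    [AddCommGroup Y] [Module k Y] [Module R Y] [Module Sᵐᵒᵖ Y] :
    CoeFun (BimodHom k R S X Y) (fun _ => X → Y) :=
  ⟨fun f => f.toLinearMap⟩

/-- A Morita context `(R, S, M, N, α, β)` on given bimodules `M` and `N`. -/
structure MoritaContext (R S : Type*) [Ring R] [Algebra k R] [Ring S] [Algebra k S]
    (M : Type*) [AddCommGroup M] [Module k M] [Module R M] [Module Sᵐᵒᵖ M]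
    [IsScalarTower k R M] [IsScalarTower k Sᵐᵒᵖ M] [SMulCommClass R Sᵐᵒᵖ M]
    (N : Type*) [AddCommGroup N] [Module k N] [Module S N] [Module Rᵐᵒᵖ N]
    [IsScalarTower k S N] [IsScalarTower k Rᵐᵒᵖ N] [SMulCommClass S Rᵐᵒᵖ N] where
  α : BimodHom k R R (BalTensor k S M N) R
  β : BimodHom k S S (BalTensor k R N M) S
  α_smul : ∀ (m : M) (n : N) (m' : M),
    α (.tmul k S m n) • m' = op (β (.tmul k R n m')) • m
  β_smul : ∀ (n : N) (m : M) (n' : N),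
    β (.tmul k R n m) • n' = op (α (.tmul k S m n')) • n

/-- A Morita context is strict if both connecting maps are bijective. -/
def MoritaContext.IsStrict {k} [CommRing k] {R S : Type*} [Ring R] [Algebra k R] [Ring S]
    [Algebra k S]
    {M : Type*} [AddCommGroup M] [Module k M] [Module R M] [Module Sᵐᵒᵖ M]
    [IsScalarTower k R M] [IsScalarTower k Sᵐᵒᵖ M] [SMulCommClass R Sᵐᵒᵖ M]
    {N : Type*} [AddCommGroup N] [Module k N] [Module S N] [Module Rᵐᵒᵖ N]
    [IsScalarTower k S N] [IsScalarTower k Rᵐᵒᵖ N] [SMulCommClass S Rᵐᵒᵖ N]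
    (c : MoritaContext k R S M N) : Prop :=
  Function.Bijective c.α ∧ Function.Bijective c.β

/-- The left action of an algebra as a bilinear map. -/
def lact (R M : Type*) [Ring R] [Algebra k R] [AddCommGroup M] [Module k M] [Module R M]
    [IsScalarTower k R M] : R →ₗ[k] M →ₗ[k] M :=
  (Algebra.lsmul k k M).toLinearMap

/-- The right action of an algebra as a bilinear map `(m, s) ↦ m s`. -/
def ract (S M : Type*) [Ring S] [Algebra k S] [AddCommGroup M] [Module k M] [Module Sᵐᵒᵖ M]
    [IsScalarTower k Sᵐᵒᵖ M] : M →ₗ[k] S →ₗ[k] M :=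
  ((Algebra.lsmul k k M : Sᵐᵒᵖ →ₐ[k] _).toLinearMap ∘ₗ
    (MulOpposite.opLinearEquiv k : S ≃ₗ[k] Sᵐᵒᵖ).toLinearMap).flip

@[simp] theorem lact_apply (R M : Type*) [Ring R] [Algebra k R] [AddCommGroup M] [Module k M]
    [Module R M] [IsScalarTower k R M] (r : R) (m : M) : lact k R M r m = r • m := rfl

@[simp] theorem ract_apply (S M : Type*) [Ring S] [Algebra k S] [AddCommGroup M] [Module k M]
    [Module Sᵐᵒᵖ M] [IsScalarTower k Sᵐᵒᵖ M] (m : M) (s : S) : ract k S M m s = op s • m := rfl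

variable (H : Type*) [Ring H] [HopfAlgebra k H]

/-- A left relative Hopf module in `_A M^H`: `ρ(a m) = a₍₀₎ m₍₀₎ ⊗ a₍₁₎ m₍₁₎`. -/
class LeftHopfModule (A M : Type*) [Ring A] [Algebra k A] [ComoduleAlgebra k H A]
    [AddCommGroup M] [Module k M] [Module A M] [IsScalarTower k A M]
    [RightComodule k H M] : Prop where
  coact_smul : ∀ (a : A) (m : M),
    coact k H M (a • m) = diagMul H (lact k A M) (coact k H A a) (coact k H M m)

/-- A right relative Hopf module in `M_B^H`: `ρ(m b) = m₍₀₎ b₍₀₎ ⊗ m₍₁₎ b₍₁₎`. A two-sided relative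
Hopf module in `_A M_B^H` is an `(A, B)`-bimodule that is both. -/
class RightHopfModule (B M : Type*) [Ring B] [Algebra k B] [ComoduleAlgebra k H B]
    [AddCommGroup M] [Module k M] [Module Bᵐᵒᵖ M] [IsScalarTower k Bᵐᵒᵖ M]
    [RightComodule k H M] : Prop where
  coact_smul : ∀ (b : B) (m : M),
    coact k H M (op b • m) = diagMul H (ract k B M) (coact k H M m) (coact k H B b)

/-- Morphisms in `_A M_B^H`: bimodule maps that are `H`-colinear. -/
structure HopfBimodHom (A B : Type*) [Ring A] [Ring B] (X Y : Type*)
    [AddCommGroup X] [Module k X] [Module A X] [Module Bᵐᵒᵖ X] [RightComodule k H X]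
    [AddCommGroup Y] [Module k Y] [Module A Y] [Module Bᵐᵒᵖ Y] [RightComodule k H Y]
    extends BimodHom k A B X Y where
  map_coact : ∀ x : X,
    coact k H Y (toLinearMap x) = toLinearMap.rTensor H (coact k H X x)

instance (A B : Type*) [Ring A] [Ring B] (X Y : Type*)
    [AddCommGroup X] [Module k X] [Module A X] [Module Bᵐᵒᵖ X] [RightComodule k H X]
    [AddCommGroup Y] [Module k Y] [Module A Y] [Module Bᵐᵒᵖ Y] [RightComodule k H Y] :
    CoeFun (HopfBimodHom k H A B X Y) (fun _ => X → Y) :=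
  ⟨fun f => f.toLinearMap⟩

/-- The identity morphism in `_A M_B^H`. -/
def HopfBimodHom.id (A B : Type*) [Ring A] [Ring B] (X : Type*)
    [AddCommGroup X] [Module k X] [Module A X] [Module Bᵐᵒᵖ X] [RightComodule k H X] :
    HopfBimodHom k H A B X X where
  toLinearMap := LinearMap.id
  map_left _ _ := rfl
  map_right _ _ := rfl
  map_coact x := by rw [LinearMap.rTensor_id]; rfl

variable {k H} in
/-- The composition `g ∘ f` in `_A M_B^H`. -/
def HopfBimodHom.comp {A B : Type*} [Ring A] [Ring B] {X Y Z : Type*}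
    [AddCommGroup X] [Module k X] [Module A X] [Module Bᵐᵒᵖ X] [RightComodule k H X]
    [AddCommGroup Y] [Module k Y] [Module A Y] [Module Bᵐᵒᵖ Y] [RightComodule k H Y]
    [AddCommGroup Z] [Module k Z] [Module A Z] [Module Bᵐᵒᵖ Z] [RightComodule k H Z]
    (g : HopfBimodHom k H A B Y Z) (f : HopfBimodHom k H A B X Y) :
    HopfBimodHom k H A B X Z where
  toLinearMap := g.toLinearMap ∘ₗ f.toLinearMap
  map_left r x := (congrArg g (f.map_left r x)).trans (g.map_left r _)
  map_right r x := (congrArg g (f.map_right r x)).trans (g.map_right r _)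
  map_coact x := by
    rw [LinearMap.rTensor_comp, LinearMap.comp_apply, LinearMap.comp_apply, g.map_coact,
      f.map_coact]

end Bimodules

section HopfTensor

variable {k : Type*} [CommRing k] {H : Type*} [Ring H] [HopfAlgebra k H]

instance instLeftHopfSelf (A : Type*) [Ring A] [Algebra k A] [ComoduleAlgebra k H A] :
    LeftHopfModule k H A A where
  coact_smul a m := by
    have h : lact k A A = LinearMap.mul k A := by ext; simp
    rw [h, diagMul_mul_eq]
    exact ComoduleAlgebra.coact_mul a m

instance instRightHopfSelf (A : Type*) [Ring A] [Algebra k A] [ComoduleAlgebra k H A] :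
    RightHopfModule k H A A where
  coact_smul b m := by
    have h : ract k A A = LinearMap.mul k A := by ext; simp
    rw [h, diagMul_mul_eq]
    exact ComoduleAlgebra.coact_mul m b

variable {A B C : Type*} [Ring A] [Algebra k A] [ComoduleAlgebra k H A]
  [Ring B] [Algebra k B] [ComoduleAlgebra k H B]
  [Ring C] [Algebra k C] [ComoduleAlgebra k H C]
variable (M : Type*) [AddCommGroup M] [Module k M] [Module Bᵐᵒᵖ M]
    [IsScalarTower k Bᵐᵒᵖ M] [RightComodule k H M] [RightHopfModule k H B M]
  (N : Type*) [AddCommGroup N] [Module k N] [Module B N]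
    [IsScalarTower k B N] [RightComodule k H N] [LeftHopfModule k H B N]

/-- The coaction `ρ(m ⊗ n) = (m₍₀₎ ⊗ n₍₀₎) ⊗ m₍₁₎ n₍₁₎` on `M ⊗_B N`. -/
noncomputable def balCoact : BalTensor k B M N →ₗ[k] BalTensor k B M N ⊗[k] H :=
  BalTensor.lift ((diagMul H (BalTensor.mk k B M N)).compl₁₂ (coact k H M) (coact k H N)) (by
    intro b m n
    simp only [LinearMap.compl₁₂_apply, RightHopfModule.coact_smul, LeftHopfModule.coact_smul]
    apply diagMul_assoc
    intro p q r
    exact BalTensor.tmul_balanced q p r)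

theorem balCoact_tmul (m : M) (n : N) : balCoact M N (BalTensor.tmul k B m n) =
    diagMul H (BalTensor.mk k B M N) (coact k H M m) (coact k H N n) := by
  simp [balCoact]

noncomputable instance instComoduleBalTensor : RightComodule k H (BalTensor k B M N) where
  coact := balCoact M N
  coassoc x := by
    induction x using BalTensor.induction with
    | h0 => simp only [map_zero]
    | ha x y hx hy => simp only [map_add, hx, hy]
    | ht m n =>
      rw [balCoact_tmul, comul_diagMul,
        coassoc_diagMul (BalTensor.mk k B M N) (coact k H M) (coact k H N) (balCoact M N)
          (balCoact_tmul M N),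
        RightComodule.coassoc, RightComodule.coassoc]
  counit x := by
    induction x using BalTensor.induction with
    | h0 => simp only [map_zero]
    | ha x y hx hy => simp only [map_add, hx, hy]
    | ht m n =>
      rw [balCoact_tmul, counit_diagMul, RightComodule.counit, RightComodule.counit]
      rfl

theorem coact_balTensor_tmul (m : M) (n : N) :
    coact k H (BalTensor k B M N) (BalTensor.tmul k B m n) =
    diagMul H (BalTensor.mk k B M N) (coact k H M m) (coact k H N n) := balCoact_tmul M N m n

instance instLeftHopfBalTensor [Module A M] [IsScalarTower k A M] [SMulCommClass A Bᵐᵒᵖ M]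
    [LeftHopfModule k H A M] : LeftHopfModule k H A (BalTensor k B M N) where
  coact_smul a x := by
    induction x using BalTensor.induction with
    | h0 => simp only [map_zero, smul_zero]
    | ha x y hx hy => simp only [map_add, smul_add, hx, hy]
    | ht m n =>
      rw [BalTensor.smul_tmul_left, coact_balTensor_tmul, coact_balTensor_tmul,
        LeftHopfModule.coact_smul]
      apply diagMul_assoc
      intro p q r
      exact (BalTensor.smul_tmul_left p q r).symm

instance instRightHopfBalTensor [Module Cᵐᵒᵖ N] [IsScalarTower k Cᵐᵒᵖ N] [SMulCommClass B Cᵐᵒᵖ N]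
    [RightHopfModule k H C N] : RightHopfModule k H C (BalTensor k B M N) where
  coact_smul c x := by
    induction x using BalTensor.induction with
    | h0 => simp only [map_zero, smul_zero, LinearMap.zero_apply]
    | ha x y hx hy => simp only [map_add, smul_add, LinearMap.add_apply, hx, hy]
    | ht m n =>
      rw [BalTensor.smul_tmul_right, coact_balTensor_tmul, coact_balTensor_tmul,
        RightHopfModule.coact_smul]
      symm
      apply diagMul_assoc
      intro p q r
      exact BalTensor.smul_tmul_right (op r) p q

end HopfTensor

/-! ## Coinvariant subalgebra and the cotensor product `A □_H B^op` -/

section Cotensor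

variable (k : Type*) [CommRing k] (H : Type*) [Ring H] [HopfAlgebra k H]

/-- The subalgebra of coinvariants `A^{co H} = {a | ρ(a) = a ⊗ 1}`. -/
def coinvAlg (A : Type*) [Ring A] [Algebra k A] [ComoduleAlgebra k H A] : Subalgebra k A where
  carrier := {a | coact k H A a = a ⊗ₜ[k] (1 : H)}
  mul_mem' := by
    intro a b ha hb
    simp only [Set.mem_ofPred_eq] at *
    have h : coact k H A (a * b) = coact k H A a * coact k H A b :=
      ComoduleAlgebra.coact_mul a b
    rw [h, ha, hb, Algebra.TensorProduct.tmul_mul_tmul, mul_one]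
  add_mem' := (coinv k H A).add_mem'
  algebraMap_mem' := by
    intro r
    have h : coact k H A 1 = 1 := ComoduleAlgebra.coact_one
    simp only [Set.mem_ofPred_eq]
    rw [Algebra.algebraMap_eq_smul_one, map_smul, h, Algebra.TensorProduct.one_def,
      TensorProduct.smul_tmul']

/-- `A^{co H}` as a `k`-algebra. -/
def CoinvRing (A : Type*) [Ring A] [Algebra k A] [ComoduleAlgebra k H A] : Type _ := coinvAlg k H A

section CoinvRing

variable (A : Type*) [Ring A] [Algebra k A] [ComoduleAlgebra k H A]

instance : Ring (CoinvRing k H A) := inferInstanceAs (Ring (coinvAlg k H A))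

instance : Algebra k (CoinvRing k H A) := inferInstanceAs (Algebra k (coinvAlg k H A))

/-- The inclusion `A^{co H} ⊆ A`. -/
def CoinvRing.val : CoinvRing k H A →ₐ[k] A := (coinvAlg k H A).val

variable {k H A} in
theorem CoinvRing.coact_val (a : CoinvRing k H A) :
    coact k H A (CoinvRing.val k H A a) = CoinvRing.val k H A a ⊗ₜ 1 := Subtype.property a

end CoinvRing

/-- The `k`-module `M^{co H}`. -/
def CoinvMod (M : Type*) [AddCommGroup M] [Module k M] [RightComodule k H M] : Type _ :=
  coinv k H M

section CoinvMod

variable (M : Type*) [AddCommGroup M] [Module k M] [RightComodule k H M]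

instance : AddCommGroup (CoinvMod k H M) := inferInstanceAs (AddCommGroup (coinv k H M))

instance : Module k (CoinvMod k H M) := inferInstanceAs (Module k (coinv k H M))

/-- The inclusion `M^{co H} ⊆ M`. -/
def CoinvMod.val : CoinvMod k H M →ₗ[k] M := (coinv k H M).subtype

variable {k H M}

theorem CoinvMod.coact_val (m : CoinvMod k H M) :
    coact k H M (CoinvMod.val k H M m) = CoinvMod.val k H M m ⊗ₜ 1 := Subtype.property m

theorem CoinvMod.val_injective : Function.Injective (CoinvMod.val k H M) :=
  Subtype.val_injective

/-- An element of `M^{co H}` from a coinvariant element of `M`. -/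
def CoinvMod.mk (m : M) (hm : coact k H M m = m ⊗ₜ 1) : CoinvMod k H M := ⟨m, hm⟩

@[simp] theorem CoinvMod.val_mk (m : M) (hm : coact k H M m = m ⊗ₜ 1) :
    CoinvMod.val k H M (CoinvMod.mk m hm) = m := rfl

end CoinvMod

/-- The cotensor product `M □_H N = {x ∈ M ⊗ N | (ρ ⊗ N) x = (M ⊗ λ) x}` of a right coaction `ρ`
and a left coaction `λ`. -/
noncomputable def cotensor {M N : Type*} [AddCommGroup M] [Module k M] [AddCommGroup N] [Module k N]
    (ρ : M →ₗ[k] M ⊗[k] H) (l : N →ₗ[k] H ⊗[k] N) : Submodule k (M ⊗[k] N) :=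
  LinearMap.eqLocus ((TensorProduct.assoc k M H N).toLinearMap ∘ₗ ρ.rTensor N) (l.lTensor M)

variable [HasBijectiveAntipode k H]

/-- The left `H`-coaction `λ(b) = S⁻¹(b₍₁₎) ⊗ b₍₀₎` on `B^op`. -/
noncomputable def opLeftCoact (B : Type*) [Ring B] [Algebra k B] [ComoduleAlgebra k H B] :
    Bᵐᵒᵖ →ₗ[k] H ⊗[k] Bᵐᵒᵖ :=
  TensorProduct.map (antipodeInv k H) (opLinearEquiv k : B ≃ₗ[k] Bᵐᵒᵖ).toLinearMap ∘ₗ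
    (TensorProduct.comm k B H).toLinearMap ∘ₗ coact k H B ∘ₗ
      (opLinearEquiv k : B ≃ₗ[k] Bᵐᵒᵖ).symm.toLinearMap

variable {k H}

theorem antipode_antipodeInv (h : H) : HopfAlgebra.antipode k (antipodeInv k H h) = h :=
  LinearEquiv.apply_symm_apply (LinearEquiv.ofBijective (HopfAlgebra.antipode k : H →ₗ[k] H)
    HasBijectiveAntipode.bijective) h

theorem antipodeInv_mul (g h : H) :
    antipodeInv k H (g * h) = antipodeInv k H h * antipodeInv k H g := by
  apply (HasBijectiveAntipode.bijective (k := k) (H := H)).1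
  rw [HopfAlgebra.antipode_mul_antidistrib]
  simp only [antipode_antipodeInv]

theorem antipodeInv_one : antipodeInv k H 1 = 1 := by
  apply (HasBijectiveAntipode.bijective (k := k) (H := H)).1
  rw [antipode_antipodeInv, HopfAlgebra.antipode_one]

/-- `S⁻¹(h₍₂₎) h₍₁₎ = ε(h)`. -/
theorem antipodeInv_comul (h : H) :
    LinearMap.mul' k H (TensorProduct.map (antipodeInv k H) LinearMap.id
      (TensorProduct.comm k H H (Coalgebra.comul (R := k) h))) =
      algebraMap k H (Coalgebra.counit (R := k) h) := by
  apply (HasBijectiveAntipode.bijective (k := k) (H := H)).1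
  have key : ∀ x : H ⊗[k] H, HopfAlgebra.antipode k (LinearMap.mul' k H
      (TensorProduct.map (antipodeInv k H) LinearMap.id (TensorProduct.comm k H H x))) =
      LinearMap.mul' k H ((HopfAlgebra.antipode k).rTensor H x) := by
    intro x
    induction x with
    | zero => simp
    | add x y hx hy => simp only [map_add, hx, hy]
    | tmul g h =>
      simp only [TensorProduct.comm_tmul, TensorProduct.map_tmul, LinearMap.mul'_apply,
        LinearMap.rTensor_tmul, HopfAlgebra.antipode_mul_antidistrib, antipode_antipodeInv,
        LinearMap.id_apply]
  rw [key, HopfAlgebra.mul_antipode_rTensor_comul_apply, Algebra.algebraMap_eq_smul_one, map_smul,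
    HopfAlgebra.antipode_one]

variable (k H)
variable (A B : Type*) [Ring A] [Algebra k A] [ComoduleAlgebra k H A]
  [Ring B] [Algebra k B] [ComoduleAlgebra k H B]

theorem opLeftCoact_mul (b c : Bᵐᵒᵖ) :
    opLeftCoact k H B (b * c) = opLeftCoact k H B b * opLeftCoact k H B c := by
  have h : ∀ u v : B ⊗[k] H,
      TensorProduct.map (antipodeInv k H) (opLinearEquiv k : B ≃ₗ[k] Bᵐᵒᵖ).toLinearMap
        (TensorProduct.comm k B H (u * v)) =
      TensorProduct.map (antipodeInv k H) (opLinearEquiv k : B ≃ₗ[k] Bᵐᵒᵖ).toLinearMap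
        (TensorProduct.comm k B H v) *
      TensorProduct.map (antipodeInv k H) (opLinearEquiv k : B ≃ₗ[k] Bᵐᵒᵖ).toLinearMap
        (TensorProduct.comm k B H u) := by
    intro u v
    induction u with
    | zero => simp
    | add x₁ x₂ h₁ h₂ => simp only [add_mul, mul_add, map_add, h₁, h₂]
    | tmul p g =>
      induction v with
      | zero => simp
      | add x₁ x₂ h₁ h₂ => simp only [mul_add, add_mul, map_add, h₁, h₂]
      | tmul q g' => simp [antipodeInv_mul]
  have h' : coact k H B (unop c * unop b) = coact k H B (unop c) * coact k H B (unop b) :=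
    ComoduleAlgebra.coact_mul _ _
  simp only [opLeftCoact, LinearMap.comp_apply, LinearEquiv.coe_coe, coe_opLinearEquiv_symm,
    unop_mul, h', h]

theorem opLeftCoact_one : opLeftCoact k H B 1 = 1 := by
  have h : coact k H B 1 = 1 := ComoduleAlgebra.coact_one
  simp [opLeftCoact, h, Algebra.TensorProduct.one_def, antipodeInv_one]

/-- The coaction of a comodule algebra as an algebra map. -/
noncomputable def coactAlgHom : A →ₐ[k] A ⊗[k] H :=
  AlgHom.ofLinearMap (coact k H A) ComoduleAlgebra.coact_one ComoduleAlgebra.coact_mul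

/-- The left coaction on `B^op` as an algebra map. -/
noncomputable def opLeftCoactAlgHom : Bᵐᵒᵖ →ₐ[k] H ⊗[k] Bᵐᵒᵖ :=
  AlgHom.ofLinearMap (opLeftCoact k H B) (opLeftCoact_one k H B) (opLeftCoact_mul k H B)

theorem rTensor_coact_eq (x : A ⊗[k] Bᵐᵒᵖ) :
    TensorProduct.assoc k A H Bᵐᵒᵖ ((coact k H A).rTensor Bᵐᵒᵖ x) =
      Algebra.TensorProduct.assoc k k k A H Bᵐᵒᵖ
        (Algebra.TensorProduct.map (coactAlgHom k H A) (AlgHom.id k Bᵐᵒᵖ) x) := by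
  induction x with
  | zero => simp only [map_zero]
  | add x₁ x₂ h₁ h₂ => simp only [map_add, h₁, h₂]
  | tmul a b => rfl

theorem lTensor_opLeftCoact_eq (x : A ⊗[k] Bᵐᵒᵖ) :
    (opLeftCoact k H B).lTensor A x =
      Algebra.TensorProduct.map (AlgHom.id k A) (opLeftCoactAlgHom k H B) x := by
  induction x with
  | zero => simp only [map_zero]
  | add x₁ x₂ h₁ h₂ => simp only [map_add, h₁, h₂]
  | tmul a b => rfl

/-- The algebra `A □_H B^op`, a subalgebra of `A ⊗ B^op`. -/
noncomputable def cotensorAlg : Subalgebra k (A ⊗[k] Bᵐᵒᵖ) where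
  carrier := cotensor k H (coact k H A) (opLeftCoact k H B)
  mul_mem' := by
    intro x y hx hy
    simp only [cotensor, SetLike.mem_coe, LinearMap.mem_eqLocus, LinearMap.comp_apply,
      LinearEquiv.coe_coe, rTensor_coact_eq, lTensor_opLeftCoact_eq] at *
    rw [map_mul, map_mul, map_mul, hx, hy]
  add_mem' := (cotensor k H (coact k H A) (opLeftCoact k H B)).add_mem'
  algebraMap_mem' := by
    intro r
    simp only [cotensor, SetLike.mem_coe, LinearMap.mem_eqLocus, LinearMap.comp_apply,
      LinearEquiv.coe_coe, rTensor_coact_eq, lTensor_opLeftCoact_eq]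
    rw [AlgHom.commutes, AlgHom.commutes, AlgEquiv.commutes]

variable {k H A B}

theorem mem_cotensorAlg (x : A ⊗[k] Bᵐᵒᵖ) : x ∈ cotensorAlg k H A B ↔
    TensorProduct.assoc k A H Bᵐᵒᵖ ((coact k H A).rTensor Bᵐᵒᵖ x) =
      (opLeftCoact k H B).lTensor A x := Iff.rfl

variable (k H A B)

/-- `A □_H B^op` as a `k`-algebra. -/
def CotensorRing : Type _ := cotensorAlg k H A B

noncomputable instance : Ring (CotensorRing k H A B) := inferInstanceAs (Ring (cotensorAlg k H A B))

noncomputable instance : Algebra k (CotensorRing k H A B) :=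
  inferInstanceAs (Algebra k (cotensorAlg k H A B))

/-- The inclusion `A □_H B^op ⊆ A ⊗ B^op`. -/
noncomputable def CotensorRing.val : CotensorRing k H A B →ₐ[k] A ⊗[k] Bᵐᵒᵖ :=
  (cotensorAlg k H A B).val

variable {k H A B} in
theorem CotensorRing.val_mem (x : CotensorRing k H A B) :
    CotensorRing.val k H A B x ∈ cotensorAlg k H A B := Subtype.property x

/-- The algebra map `A^{co H} → A □_H B^op`, `a ↦ a ⊗ 1`. -/
noncomputable def inclLeft : CoinvRing k H A →ₐ[k] CotensorRing k H A B :=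
  ((Algebra.TensorProduct.includeLeft : A →ₐ[k] A ⊗[k] Bᵐᵒᵖ).comp
    (CoinvRing.val k H A)).codRestrict (cotensorAlg k H A B) (by
      intro a
      have ha := CoinvRing.coact_val a
      simp [mem_cotensorAlg, ha, opLeftCoact_one, Algebra.TensorProduct.one_def])

/-- The algebra map `(B^{co H})^op → A □_H B^op`, `b ↦ 1 ⊗ b`. -/
noncomputable def inclRight : (CoinvRing k H B)ᵐᵒᵖ →ₐ[k] CotensorRing k H A B :=
  ((Algebra.TensorProduct.includeRight : Bᵐᵒᵖ →ₐ[k] A ⊗[k] Bᵐᵒᵖ).comp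
    (AlgHom.op (CoinvRing.val k H B))).codRestrict (cotensorAlg k H A B) (by
      intro b
      have hb := CoinvRing.coact_val b.unop
      have h : coact k H A 1 = 1 := ComoduleAlgebra.coact_one
      simp [mem_cotensorAlg, hb, h, opLeftCoact, Algebra.TensorProduct.one_def,
        antipodeInv_one])

theorem val_inclLeft (a : CoinvRing k H A) : CotensorRing.val k H A B (inclLeft k H A B a) =
    CoinvRing.val k H A a ⊗ₜ 1 := rfl

theorem val_inclRight (b : (CoinvRing k H B)ᵐᵒᵖ) :
    CotensorRing.val k H A B (inclRight k H A B b) =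
      1 ⊗ₜ op (CoinvRing.val k H B (unop b)) := rfl

end Cotensor

/-! ## The functor `(-)^{co H}` on objects -/

section Coinvariants

variable {k : Type*} [CommRing k] {H : Type*} [Ring H] [HopfAlgebra k H]
  {A B : Type*} [Ring A] [Algebra k A] [Ring B] [Algebra k B]

section EnvAct

variable (k A B)
variable (M : Type*) [AddCommGroup M] [Module k M] [Module A M] [Module Bᵐᵒᵖ M]
    [IsScalarTower k A M] [IsScalarTower k Bᵐᵒᵖ M] [SMulCommClass A Bᵐᵒᵖ M]

/-- An `(A, B)`-bimodule as a left `A ⊗ B^op`-module: `(a ⊗ b) m = a m b`. -/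
noncomputable def envAct : A ⊗[k] Bᵐᵒᵖ →ₐ[k] Module.End k M :=
  Algebra.TensorProduct.lift (Algebra.lsmul k k M) (Algebra.lsmul k k M) (by
    intro a b
    rw [commute_iff_eq]
    ext m
    simp only [Module.End.mul_apply, Algebra.lsmul_coe]
    exact smul_comm a b m)

variable {k A B M}

@[simp] theorem envAct_tmul (a : A) (b : Bᵐᵒᵖ) (m : M) :
    envAct k A B M (a ⊗ₜ[k] b) m = a • b • m := by
  rw [envAct, Algebra.TensorProduct.lift_tmul]
  rfl

end EnvAct

variable [ComoduleAlgebra k H A] [ComoduleAlgebra k H B]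

/-- The right coaction `b ↦ b₍₀₎ ⊗ b₍₁₎` on the `k`-module `B^op`. -/
noncomputable instance instComoduleOp (N : Type*) [AddCommGroup N] [Module k N]
    [RightComodule k H N] : RightComodule k H Nᵐᵒᵖ where
  coact := (opLinearEquiv k : N ≃ₗ[k] Nᵐᵒᵖ).toLinearMap.rTensor H ∘ₗ coact k H N ∘ₗ
    (opLinearEquiv k : N ≃ₗ[k] Nᵐᵒᵖ).symm.toLinearMap
  coassoc n := by
    have h := RightComodule.coassoc (k := k) (H := H) (unop n)
    have h₁ : ∀ x : N ⊗[k] H, TensorProduct.assoc k Nᵐᵒᵖ H H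
        (((opLinearEquiv k : N ≃ₗ[k] Nᵐᵒᵖ).toLinearMap.rTensor H ∘ₗ coact k H N ∘ₗ
          (opLinearEquiv k : N ≃ₗ[k] Nᵐᵒᵖ).symm.toLinearMap).rTensor H
          ((opLinearEquiv k : N ≃ₗ[k] Nᵐᵒᵖ).toLinearMap.rTensor H x)) =
        (opLinearEquiv k : N ≃ₗ[k] Nᵐᵒᵖ).toLinearMap.rTensor (H ⊗[k] H)
          (TensorProduct.assoc k N H H ((coact k H N).rTensor H x)) := by
      intro x
      induction x with
      | zero => simp only [map_zero]
      | add x₁ x₂ h₁ h₂ => simp only [map_add, h₁, h₂]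
      | tmul p g =>
        have h₂ : ∀ y : N ⊗[k] H, TensorProduct.assoc k Nᵐᵒᵖ H H
            ((opLinearEquiv k : N ≃ₗ[k] Nᵐᵒᵖ).toLinearMap.rTensor H y ⊗ₜ g) =
            (opLinearEquiv k : N ≃ₗ[k] Nᵐᵒᵖ).toLinearMap.rTensor (H ⊗[k] H)
              (TensorProduct.assoc k N H H (y ⊗ₜ g)) := by
          intro y
          induction y with
          | zero => simp only [map_zero, TensorProduct.zero_tmul]
          | add x₁ x₂ h₁ h₂ => simp only [map_add, TensorProduct.add_tmul, h₁, h₂]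
          | tmul q g' => rfl
        exact h₂ (coact k H N p)
    have h₂ : ∀ x : N ⊗[k] H, (Coalgebra.comul (R := k) (A := H)).lTensor Nᵐᵒᵖ
          ((opLinearEquiv k : N ≃ₗ[k] Nᵐᵒᵖ).toLinearMap.rTensor H x) =
        (opLinearEquiv k : N ≃ₗ[k] Nᵐᵒᵖ).toLinearMap.rTensor (H ⊗[k] H)
          ((Coalgebra.comul (R := k) (A := H)).lTensor N x) := by
      intro x
      induction x with
      | zero => simp only [map_zero]
      | add x₁ x₂ h₁ h₂ => simp only [map_add, h₁, h₂]
      | tmul p g => simp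
    have e := h₁ (coact k H N (unop n))
    rw [h, ← h₂] at e
    exact e
  counit n := by
    have h := RightComodule.counit (k := k) (H := H) (unop n)
    have h₁ : ∀ x : N ⊗[k] H, TensorProduct.rid k Nᵐᵒᵖ
        ((Coalgebra.counit (R := k) (A := H)).lTensor Nᵐᵒᵖ
          ((opLinearEquiv k : N ≃ₗ[k] Nᵐᵒᵖ).toLinearMap.rTensor H x)) =
        op (TensorProduct.rid k N ((Coalgebra.counit (R := k) (A := H)).lTensor N x)) := by
      intro x
      induction x with
      | zero => simp
      | add x₁ x₂ h₁ h₂ => simp only [map_add, h₁, h₂]; exact (MulOpposite.op_add _ _).symm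
      | tmul p g => simp
    exact (h₁ (coact k H N (unop n))).trans (congrArg op h)

theorem coact_op (N : Type*) [AddCommGroup N] [Module k N] [RightComodule k H N] (n : Nᵐᵒᵖ) :
    coact k H Nᵐᵒᵖ n =
      (opLinearEquiv k : N ≃ₗ[k] Nᵐᵒᵖ).toLinearMap.rTensor H (coact k H N (unop n)) := rfl

variable (k H A B)

/-- The coaction `ρ(a ⊗ b) = (a₍₀₎ ⊗ b₍₀₎) ⊗ a₍₁₎ b₍₁₎` on `A ⊗ B^op`. -/
noncomputable def envCoact : A ⊗[k] Bᵐᵒᵖ →ₗ[k] (A ⊗[k] Bᵐᵒᵖ) ⊗[k] H :=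
  TensorProduct.lift ((diagMul H (TensorProduct.mk k A Bᵐᵒᵖ)).compl₁₂
    (coact k H A) (coact k H Bᵐᵒᵖ))

theorem envCoact_tmul (a : A) (b : Bᵐᵒᵖ) : envCoact k H A B (a ⊗ₜ b) =
    diagMul H (TensorProduct.mk k A Bᵐᵒᵖ) (coact k H A a) (coact k H Bᵐᵒᵖ b) := by
  simp [envCoact]

variable {k H A B}

section

variable [HasBijectiveAntipode k H]

/-- Elements of `A □_H B^op` are coinvariant in `A ⊗ B^op`. -/
theorem envCoact_cotensorAlg (x : A ⊗[k] Bᵐᵒᵖ) (hx : x ∈ cotensorAlg k H A B) :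
    envCoact k H A B x = x ⊗ₜ 1 := by
  -- the map `a ⊗ h ⊗ b ↦ (a ⊗ b₍₀₎) ⊗ h b₍₁₎`
  let θ : (A ⊗[k] H) ⊗[k] Bᵐᵒᵖ →ₗ[k] (A ⊗[k] Bᵐᵒᵖ) ⊗[k] H :=
    TensorProduct.lift ((diagMul H (TensorProduct.mk k A Bᵐᵒᵖ)).compl₂ (coact k H Bᵐᵒᵖ))
  have hθ : ∀ (u : A ⊗[k] H) (b : Bᵐᵒᵖ), θ (u ⊗ₜ b) =
      diagMul H (TensorProduct.mk k A Bᵐᵒᵖ) u (coact k H Bᵐᵒᵖ b) := by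
    intro u b
    simp [θ]
  have h₁ : ∀ y : A ⊗[k] Bᵐᵒᵖ, θ ((coact k H A).rTensor Bᵐᵒᵖ y) = envCoact k H A B y := by
    intro y
    induction y with
    | zero => simp only [map_zero]
    | add x₁ x₂ h₁ h₂ => simp only [map_add, h₁, h₂]
    | tmul a b => rw [LinearMap.rTensor_tmul, hθ, envCoact_tmul]
  let μ : H ⊗[k] H →ₗ[k] H := LinearMap.mul' k H ∘ₗ
    TensorProduct.map (antipodeInv k H) LinearMap.id ∘ₗ (TensorProduct.comm k H H).toLinearMap
  let T : B ⊗[k] (H ⊗[k] H) →ₗ[k] Bᵐᵒᵖ ⊗[k] H :=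
    TensorProduct.map (opLinearEquiv k : B ≃ₗ[k] Bᵐᵒᵖ).toLinearMap μ
  have h₂ : ∀ (a : A) (z : B ⊗[k] H),
      θ ((TensorProduct.assoc k A H Bᵐᵒᵖ).symm (a ⊗ₜ
        (TensorProduct.map (antipodeInv k H) (opLinearEquiv k : B ≃ₗ[k] Bᵐᵒᵖ).toLinearMap
          (TensorProduct.comm k B H z)))) =
      (TensorProduct.mk k A Bᵐᵒᵖ a).rTensor H
        (T (TensorProduct.assoc k B H H ((coact k H B).rTensor H z))) := by
    intro a z
    induction z with
    | zero => simp only [map_zero, TensorProduct.tmul_zero]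
    | add x₁ x₂ h₁ h₂ => simp only [map_add, TensorProduct.tmul_add, h₁, h₂]
    | tmul b h =>
      simp only [TensorProduct.comm_tmul, TensorProduct.map_tmul, LinearMap.rTensor_tmul,
        TensorProduct.assoc_symm_tmul, hθ, LinearEquiv.coe_coe, coact_op, coe_opLinearEquiv,
        unop_op]
      generalize coact k H B b = w
      induction w with
      | zero => simp only [map_zero, TensorProduct.zero_tmul]
      | add x₁ x₂ h₁ h₂ => simp only [map_add, TensorProduct.add_tmul, h₁, h₂]
      | tmul c g => simp [T, μ]
  have h₃ : ∀ w : B ⊗[k] H, T ((Coalgebra.comul (R := k) (A := H)).lTensor B w) =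
      (opLinearEquiv k (TensorProduct.rid k B
        ((Coalgebra.counit (R := k) (A := H)).lTensor B w)) : Bᵐᵒᵖ) ⊗ₜ 1 := by
    intro w
    induction w with
    | zero => simp only [map_zero, TensorProduct.zero_tmul]
    | add x₁ x₂ h₁ h₂ => simp only [map_add, TensorProduct.add_tmul, h₁, h₂]
    | tmul c g =>
      have h : μ (Coalgebra.comul (R := k) g) =
        algebraMap k H (Coalgebra.counit (R := k) g) := antipodeInv_comul g
      simp only [T, LinearMap.lTensor_tmul, TensorProduct.map_tmul, h, TensorProduct.rid_tmul,
        map_smul, Algebra.algebraMap_eq_smul_one, LinearEquiv.coe_coe, TensorProduct.tmul_smul,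
        TensorProduct.smul_tmul']
  have h₄ : ∀ y : A ⊗[k] Bᵐᵒᵖ,
      θ ((TensorProduct.assoc k A H Bᵐᵒᵖ).symm ((opLeftCoact k H B).lTensor A y)) = y ⊗ₜ 1 := by
    intro y
    induction y with
    | zero => simp only [map_zero, TensorProduct.zero_tmul]
    | add x₁ x₂ h₁ h₂ => simp only [map_add, TensorProduct.add_tmul, h₁, h₂]
    | tmul a b =>
      refine (h₂ a (coact k H B (unop b))).trans ?_
      rw [RightComodule.coassoc, h₃, RightComodule.counit]
      simp
  rw [mem_cotensorAlg] at hx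
  rw [← h₁, ← h₄ x, ← hx, LinearEquiv.symm_apply_apply]

end

section Module

variable (M : Type*) [AddCommGroup M] [Module k M] [Module A M] [Module Bᵐᵒᵖ M]
    [IsScalarTower k A M] [IsScalarTower k Bᵐᵒᵖ M] [SMulCommClass A Bᵐᵒᵖ M]
    [RightComodule k H M] [LeftHopfModule k H A M] [RightHopfModule k H B M]

variable {M}

theorem coact_envAct_coinv (m : M) (hm : coact k H M m = m ⊗ₜ 1) (y : A ⊗[k] Bᵐᵒᵖ) :
    coact k H M (envAct k A B M y m) =
      ((envAct k A B M).toLinearMap.flip m).rTensor H (envCoact k H A B y) := by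
  induction y with
  | zero => simp
  | add x₁ x₂ h₁ h₂ => simp only [map_add, LinearMap.add_apply, h₁, h₂]
  | tmul a b =>
    rw [envAct_tmul, LeftHopfModule.coact_smul, envCoact_tmul, coact_op,
      ← op_unop b, RightHopfModule.coact_smul, hm, unop_op]
    generalize coact k H A a = x
    generalize coact k H B (unop b) = z
    induction x with
    | zero => simp
    | add x₁ x₂ h₁ h₂ => simp only [map_add, LinearMap.add_apply, h₁, h₂]
    | tmul p g =>
      induction z with
      | zero => simp
      | add x₁ x₂ h₁ h₂ => simp only [map_add, h₁, h₂]
      | tmul q g' => simp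

variable [HasBijectiveAntipode k H]

theorem coact_envAct_cotensor (x : CotensorRing k H A B) (m : CoinvMod k H M) :
    coact k H M (envAct k A B M (CotensorRing.val k H A B x) (CoinvMod.val k H M m)) =
      envAct k A B M (CotensorRing.val k H A B x) (CoinvMod.val k H M m) ⊗ₜ 1 := by
  have h := coact_envAct_coinv (A := A) (B := B) _ m.coact_val (CotensorRing.val k H A B x)
  rw [envCoact_cotensorAlg _ x.val_mem, LinearMap.rTensor_tmul] at h
  exact h

/-- For `M` in `_A M_B^H`, the coinvariants `M^{co H}` form a left `A □_H B^op`-module: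
`(∑ aᵢ ⊗ bᵢ) m = ∑ aᵢ m bᵢ`. -/
noncomputable instance instModuleCoinv : Module (CotensorRing k H A B) (CoinvMod k H M) where
  smul x m := CoinvMod.mk _ (coact_envAct_cotensor x m)
  one_smul m := CoinvMod.val_injective (by
    change envAct k A B M (CotensorRing.val k H A B 1) (CoinvMod.val k H M m) = _
    rw [map_one, map_one]; rfl)
  mul_smul x y m := CoinvMod.val_injective (by
    change envAct k A B M (CotensorRing.val k H A B (x * y)) (CoinvMod.val k H M m) = _
    rw [map_mul, map_mul]; rfl)
  smul_zero x := CoinvMod.val_injective (map_zero (envAct k A B M (CotensorRing.val k H A B x)))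
  smul_add x m n := CoinvMod.val_injective
    (map_add (envAct k A B M (CotensorRing.val k H A B x)) _ _)
  add_smul x y m := CoinvMod.val_injective (by
    change envAct k A B M (CotensorRing.val k H A B (x + y)) (CoinvMod.val k H M m) = _
    rw [map_add, map_add]; rfl)
  zero_smul m := CoinvMod.val_injective (by
    change envAct k A B M (CotensorRing.val k H A B 0) (CoinvMod.val k H M m) = _
    rw [map_zero, map_zero]; rfl)

theorem val_smul_coinv (x : CotensorRing k H A B) (m : CoinvMod k H M) :
    CoinvMod.val k H M (x • m) =
      envAct k A B M (CotensorRing.val k H A B x) (CoinvMod.val k H M m) := rfl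

instance instTowerCoinv : IsScalarTower k (CotensorRing k H A B) (CoinvMod k H M) where
  smul_assoc c x m := CoinvMod.val_injective (by
    rw [val_smul_coinv, map_smul, map_smul, map_smul]; rfl)

end Module

/-- `A^{co H}` is a left `A □_H A^op`-module: `(∑ aᵢ ⊗ bᵢ) c = ∑ aᵢ c bᵢ`. -/
noncomputable instance instModuleCoinvRing [HasBijectiveAntipode k H] :
    Module (CotensorRing k H A A) (CoinvRing k H A) :=
  inferInstanceAs (Module (CotensorRing k H A A) (CoinvMod k H A))

theorem val_smul_coinvRing [HasBijectiveAntipode k H] (x : CotensorRing k H A A)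
    (c : CoinvRing k H A) : CoinvRing.val k H A (x • c) =
      envAct k A A A (CotensorRing.val k H A A x) (CoinvRing.val k H A c) := rfl

end Coinvariants

/-! ## The functor `(A ⊗ B^op) ⊗_{A □_H B^op} -` on objects -/

section EnvBimod

variable (k : Type*) [CommRing k] (A B : Type*) [Ring A] [Algebra k A] [Ring B] [Algebra k B]

/-- `A ⊗ B^op` as an `(A, B)`-bimodule, `a (a' ⊗ b') b = a a' ⊗ b' b` (product of `B` in the second
factor), and as a right module over its subalgebra `A □_H B^op`. -/
def EnvBimod : Type _ := A ⊗[k] Bᵐᵒᵖ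

namespace EnvBimod

noncomputable instance : Ring (EnvBimod k A B) := inferInstanceAs (Ring (A ⊗[k] Bᵐᵒᵖ))

noncomputable instance : Algebra k (EnvBimod k A B) := inferInstanceAs (Algebra k (A ⊗[k] Bᵐᵒᵖ))

/-- The pure tensors. -/
noncomputable def mk : A →ₗ[k] Bᵐᵒᵖ →ₗ[k] EnvBimod k A B := TensorProduct.mk k A Bᵐᵒᵖ

/-- The identity as an algebra map. -/
noncomputable def ofTensor : A ⊗[k] Bᵐᵒᵖ →ₐ[k] EnvBimod k A B := AlgHom.id k (A ⊗[k] Bᵐᵒᵖ)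

variable {k A B}

@[elab_as_elim]
theorem induction {p : EnvBimod k A B → Prop} (x : EnvBimod k A B) (h0 : p 0)
    (ht : ∀ a b, p (mk k A B a b)) (ha : ∀ x y, p x → p y → p (x + y)) : p x :=
  TensorProduct.induction_on x h0 ht ha

theorem mk_mul_mk (a a' : A) (b b' : Bᵐᵒᵖ) :
    mk k A B a b * mk k A B a' b' = mk k A B (a * a') (b * b') :=
  Algebra.TensorProduct.tmul_mul_tmul a a' b b'

theorem one_def : (1 : EnvBimod k A B) = mk k A B 1 1 := rfl

variable (k A B)

noncomputable instance instModuleLeft : Module A (EnvBimod k A B) :=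
  Module.compHom (EnvBimod k A B)
    ((ofTensor k A B).comp Algebra.TensorProduct.includeLeft : A →ₐ[k] EnvBimod k A B).toRingHom

noncomputable instance instModuleRight : Module Bᵐᵒᵖ (EnvBimod k A B) :=
  Module.compHom (EnvBimod k A B)
    ((ofTensor k A B).comp Algebra.TensorProduct.includeRight :
      Bᵐᵒᵖ →ₐ[k] EnvBimod k A B).toRingHom

variable {k A B}

theorem smul_left_def (a : A) (x : EnvBimod k A B) : a • x = mk k A B a 1 * x := rfl

theorem smul_right_def (b : Bᵐᵒᵖ) (x : EnvBimod k A B) : b • x = mk k A B 1 b * x := rfl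

instance : IsScalarTower k A (EnvBimod k A B) where
  smul_assoc c a x := by
    rw [smul_left_def, smul_left_def, map_smul, LinearMap.smul_apply, smul_mul_assoc]

instance : IsScalarTower k Bᵐᵒᵖ (EnvBimod k A B) where
  smul_assoc c a x := by
    rw [smul_right_def, smul_right_def, map_smul, smul_mul_assoc]

instance : SMulCommClass A Bᵐᵒᵖ (EnvBimod k A B) where
  smul_comm a b x := by
    simp only [smul_left_def, smul_right_def, ← mul_assoc, mk_mul_mk, one_mul, mul_one]

theorem envAct_eq (y : A ⊗[k] Bᵐᵒᵖ) (x : EnvBimod k A B) :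
    envAct k A B (EnvBimod k A B) y x = ofTensor k A B y * x := by
  induction y with
  | zero => simp only [map_zero, LinearMap.zero_apply, zero_mul]
  | add x₁ x₂ h₁ h₂ => simp only [map_add, LinearMap.add_apply, h₁, h₂, add_mul]
  | tmul a b =>
    rw [envAct_tmul, smul_left_def, smul_right_def, ← mul_assoc, mk_mul_mk, one_mul, mul_one]
    rfl

section Coaction

variable {H : Type*} [Ring H] [HopfAlgebra k H] [ComoduleAlgebra k H A] [ComoduleAlgebra k H B]

variable (k A B H) in
/-- The coaction `ρ(a ⊗ b) = (a₍₀₎ ⊗ b₍₀₎) ⊗ a₍₁₎ b₍₁₎`. -/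
noncomputable def coaction : EnvBimod k A B →ₗ[k] EnvBimod k A B ⊗[k] H := envCoact k H A B

theorem coaction_mk (a : A) (b : Bᵐᵒᵖ) : coaction k A B H (mk k A B a b) =
    diagMul H (mk k A B) (coact k H A a) (coact k H Bᵐᵒᵖ b) := envCoact_tmul k H A B a b

/-- `A ⊗ B^op` with the coaction `ρ(a ⊗ b) = (a₍₀₎ ⊗ b₍₀₎) ⊗ a₍₁₎ b₍₁₎`. -/
noncomputable instance instComodule : RightComodule k H (EnvBimod k A B) where
  coact := coaction k A B H
  coassoc x := by
    induction x using EnvBimod.induction with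
    | h0 => simp only [map_zero]
    | ha x y hx hy => simp only [map_add, hx, hy]
    | ht m n =>
      rw [coaction_mk]
      rw [comul_diagMul, coassoc_diagMul (mk k A B) (coact k H A) (coact k H Bᵐᵒᵖ) (coaction k A B H)
          coaction_mk,
        RightComodule.coassoc, RightComodule.coassoc]
  counit x := by
    induction x using EnvBimod.induction with
    | h0 => simp only [map_zero]
    | ha x y hx hy => simp only [map_add, hx, hy]
    | ht m n =>
      rw [coaction_mk]
      rw [counit_diagMul, RightComodule.counit, RightComodule.counit]

theorem coact_mk (a : A) (b : Bᵐᵒᵖ) : coact k H (EnvBimod k A B) (mk k A B a b) =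
    diagMul H (mk k A B) (coact k H A a) (coact k H Bᵐᵒᵖ b) := envCoact_tmul k H A B a b

theorem coact_one : coact k H (EnvBimod k A B) 1 = 1 ⊗ₜ 1 := by
  have h₁ : coact k H A 1 = 1 := ComoduleAlgebra.coact_one
  have h₂ : coact k H B 1 = 1 := ComoduleAlgebra.coact_one
  rw [one_def, coact_mk, coact_op, unop_one, h₁, h₂]
  simp [Algebra.TensorProduct.one_def]

instance instLeftHopf : LeftHopfModule k H A (EnvBimod k A B) where
  coact_smul a x := by
    induction x using EnvBimod.induction with
    | h0 => simp only [map_zero, smul_zero]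
    | ha x y hx hy => simp only [map_add, smul_add, hx, hy]
    | ht p b =>
      have h : coact k H A (a * p) = diagMul H (lact k A A) (coact k H A a) (coact k H A p) :=
        LeftHopfModule.coact_smul a p
      rw [smul_left_def, mk_mul_mk, one_mul, coact_mk, coact_mk, h]
      apply diagMul_assoc
      intro p q r
      rw [lact_apply, lact_apply, smul_left_def, mk_mul_mk, one_mul]
      rfl

instance instRightHopf : RightHopfModule k H B (EnvBimod k A B) where
  coact_smul b x := by
    induction x using EnvBimod.induction with
    | h0 => simp only [map_zero, smul_zero, LinearMap.zero_apply]
    | ha x y hx hy => simp only [map_add, smul_add, LinearMap.add_apply, hx, hy]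
    | ht p c =>
      have h : coact k H B (unop c * b) =
          diagMul H (ract k B B) (coact k H B (unop c)) (coact k H B b) :=
        RightHopfModule.coact_smul b (unop c)
      let s : Bᵐᵒᵖ →ₗ[k] B →ₗ[k] Bᵐᵒᵖ :=
        ((LinearMap.mul k Bᵐᵒᵖ) ∘ₗ (opLinearEquiv k : B ≃ₗ[k] Bᵐᵒᵖ).toLinearMap).flip
      have h' : coact k H Bᵐᵒᵖ (op b * c) =
          diagMul H s (coact k H Bᵐᵒᵖ c) (coact k H B b) := by
        rw [coact_op, coact_op, unop_mul, unop_op, h,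
          rTensor_diagMul _ (opLinearEquiv k : B ≃ₗ[k] Bᵐᵒᵖ).toLinearMap LinearMap.id _ s]
        · rw [LinearMap.rTensor_id, LinearMap.id_apply]
        · intro p q
          simp [s]
      rw [smul_right_def, mk_mul_mk, one_mul, coact_mk, coact_mk, h']
      symm
      apply diagMul_assoc
      intro p q r
      rw [ract_apply, smul_right_def, mk_mul_mk, one_mul]
      rfl

variable [HasBijectiveAntipode k H]

noncomputable instance instModuleCotensor : Module (CotensorRing k H A B)ᵐᵒᵖ (EnvBimod k A B) :=
  Module.compHom (EnvBimod k A B)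
    (RingHom.op ((ofTensor k A B).comp (CotensorRing.val k H A B)).toRingHom)

theorem smul_cotensor_def (x : CotensorRing k H A B) (y : EnvBimod k A B) :
    op x • y = y * ofTensor k A B (CotensorRing.val k H A B x) := rfl

instance : SMulCommClass A (CotensorRing k H A B)ᵐᵒᵖ (EnvBimod k A B) where
  smul_comm a x y := by
    rw [← op_unop x, smul_cotensor_def, smul_cotensor_def, smul_left_def, smul_left_def, mul_assoc]

instance : SMulCommClass Bᵐᵒᵖ (CotensorRing k H A B)ᵐᵒᵖ (EnvBimod k A B) where
  smul_comm a x y := by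
    rw [← op_unop x, smul_cotensor_def, smul_cotensor_def, smul_right_def, smul_right_def,
      mul_assoc]

instance : IsScalarTower k (CotensorRing k H A B)ᵐᵒᵖ (EnvBimod k A B) where
  smul_assoc c x y := by
    rw [← op_unop x, ← op_smul, smul_cotensor_def, smul_cotensor_def, map_smul, map_smul,
      mul_smul_comm]

theorem coact_mul_cotensor (y : EnvBimod k A B) (x : CotensorRing k H A B) :
    coact k H (EnvBimod k A B) (op x • y) =
      ((LinearMap.mul k (EnvBimod k A B)).flip
        (ofTensor k A B (CotensorRing.val k H A B x))).rTensor H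
        (coact k H (EnvBimod k A B) y) := by
  suffices h : ∀ y : A ⊗[k] Bᵐᵒᵖ, coact k H (EnvBimod k A B) (op x • ofTensor k A B y) =
      ((LinearMap.mul k (EnvBimod k A B)).flip
        (ofTensor k A B (CotensorRing.val k H A B x))).rTensor H
        (coact k H (EnvBimod k A B) (ofTensor k A B y)) from h y
  intro y
  have h := coact_envAct_coinv (k := k) (H := H) (A := A) (B := B) (M := EnvBimod k A B)
    (ofTensor k A B (CotensorRing.val k H A B x))
    (envCoact_cotensorAlg _ x.val_mem) y
  have h' : (envAct k A B (EnvBimod k A B)).toLinearMap.flip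
      (ofTensor k A B (CotensorRing.val k H A B x)) =
      (LinearMap.mul k (EnvBimod k A B)).flip
        (ofTensor k A B (CotensorRing.val k H A B x)) ∘ₗ (ofTensor k A B).toLinearMap := by
    apply LinearMap.ext
    intro z
    exact envAct_eq z _
  rw [envAct_eq, h', LinearMap.rTensor_comp, LinearMap.comp_apply] at h
  rw [smul_cotensor_def, h]
  congr 1
  exact LinearMap.congr_fun (LinearMap.rTensor_id H _) (envCoact k H A B y)

end Coaction

end EnvBimod

end EnvBimod

section Induction

variable (k : Type*) [CommRing k] (H : Type*) [Ring H] [HopfAlgebra k H] [HasBijectiveAntipode k H]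
  (A B : Type*) [Ring A] [Algebra k A] [ComoduleAlgebra k H A]
  [Ring B] [Algebra k B] [ComoduleAlgebra k H B]
  (M : Type*) [AddCommGroup M] [Module k M] [Module (CotensorRing k H A B) M]

/-- The induced two-sided relative Hopf module `(A ⊗ B^op) ⊗_{A □_H B^op} M` of a left
`A □_H B^op`-module `M`. -/
def Ind : Type _ := BalTensor k (CotensorRing k H A B) (EnvBimod k A B) M

namespace Ind

noncomputable instance : AddCommGroup (Ind k H A B M) :=
  inferInstanceAs (AddCommGroup (BalTensor k (CotensorRing k H A B) (EnvBimod k A B) M))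

noncomputable instance instModuleBase : Module k (Ind k H A B M) :=
  inferInstanceAs (Module k (BalTensor k (CotensorRing k H A B) (EnvBimod k A B) M))

noncomputable instance instModuleLeft : Module A (Ind k H A B M) :=
  inferInstanceAs (Module A (BalTensor k (CotensorRing k H A B) (EnvBimod k A B) M))

noncomputable instance instModuleRight : Module Bᵐᵒᵖ (Ind k H A B M) :=
  BalTensor.instModuleLeft (k := k) (R := CotensorRing k H A B) (L := Bᵐᵒᵖ) (EnvBimod k A B) M

instance : IsScalarTower k A (Ind k H A B M) :=
  BalTensor.instTowerLeft (k := k) (R := CotensorRing k H A B) (L := A) (EnvBimod k A B) M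

instance : IsScalarTower k Bᵐᵒᵖ (Ind k H A B M) :=
  BalTensor.instTowerLeft (k := k) (R := CotensorRing k H A B) (L := Bᵐᵒᵖ) (EnvBimod k A B) M

/-- The bilinear map `(y, m) ↦ y ⊗ m`. -/
noncomputable def mk : EnvBimod k A B →ₗ[k] M →ₗ[k] Ind k H A B M :=
  BalTensor.mk k (CotensorRing k H A B) (EnvBimod k A B) M

variable {k H A B M}

@[elab_as_elim]
theorem induction {p : Ind k H A B M → Prop} (x : Ind k H A B M) (h0 : p 0)
    (ht : ∀ y m, p (mk k H A B M y m)) (ha : ∀ x y, p x → p y → p (x + y)) : p x :=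
  BalTensor.induction x h0 ht ha

theorem smul_left_mk (a : A) (y : EnvBimod k A B) (m : M) :
    a • mk k H A B M y m = mk k H A B M (a • y) m :=
  BalTensor.smul_tmul_left (k := k) (R := CotensorRing k H A B) a y m

theorem smul_right_mk (b : Bᵐᵒᵖ) (y : EnvBimod k A B) (m : M) :
    b • mk k H A B M y m = mk k H A B M (b • y) m :=
  BalTensor.smul_tmul_left (k := k) (R := CotensorRing k H A B) b y m

theorem mk_balanced (x : CotensorRing k H A B) (y : EnvBimod k A B) (m : M) :
    mk k H A B M (op x • y) m = mk k H A B M y (x • m) :=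
  BalTensor.tmul_balanced x y m

instance : SMulCommClass A Bᵐᵒᵖ (Ind k H A B M) where
  smul_comm a b x := by
    induction x using Ind.induction with
    | h0 => simp only [smul_zero]
    | ha x y hx hy => simp only [smul_add, hx, hy]
    | ht y m => simp only [smul_left_mk, smul_right_mk, smul_comm a b y]

variable (k H A B M)

/-- The coaction `ρ((a ⊗ b) ⊗ m) = ((a₍₀₎ ⊗ b₍₀₎) ⊗ m) ⊗ a₍₁₎ b₍₁₎`. -/
noncomputable def coaction : Ind k H A B M →ₗ[k] Ind k H A B M ⊗[k] H :=
  BalTensor.lift (R := CotensorRing k H A B)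
    ((LinearMap.rTensorHom H ∘ₗ (mk k H A B M).flip).flip ∘ₗ coact k H (EnvBimod k A B)) (by
      intro x y m
      simp only [LinearMap.comp_apply, LinearMap.flip_apply, EnvBimod.coact_mul_cotensor,
        LinearMap.coe_rTensorHom]
      rw [← LinearMap.comp_apply, ← LinearMap.rTensor_comp]
      congr 2
      ext1 z
      exact mk_balanced x z m)

variable {k H A B M}

theorem coaction_mk (y : EnvBimod k A B) (m : M) : coaction k H A B M (mk k H A B M y m) =
    ((mk k H A B M).flip m).rTensor H (coact k H (EnvBimod k A B) y) :=
  BalTensor.lift_tmul (R := CotensorRing k H A B) _ _ y m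

noncomputable instance instComodule : RightComodule k H (Ind k H A B M) where
  coact := coaction k H A B M
  coassoc x := by
    induction x using Ind.induction with
    | h0 => simp only [map_zero]
    | ha x y hx hy => simp only [map_add, hx, hy]
    | ht y m =>
      have h := RightComodule.coassoc (k := k) (H := H) y
      have h₁ : ∀ z : EnvBimod k A B ⊗[k] H, TensorProduct.assoc k (Ind k H A B M) H H
          ((coaction k H A B M).rTensor H (((mk k H A B M).flip m).rTensor H z)) =
          ((mk k H A B M).flip m).rTensor (H ⊗[k] H)
            (TensorProduct.assoc k (EnvBimod k A B) H H
              ((coact k H (EnvBimod k A B)).rTensor H z)) := by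
        intro z
        induction z with
        | zero => simp only [map_zero]
        | add x₁ x₂ h₁ h₂ => simp only [map_add, h₁, h₂]
        | tmul p g =>
          simp only [LinearMap.rTensor_tmul, LinearMap.flip_apply, coaction_mk]
          generalize coact k H (EnvBimod k A B) p = w
          induction w with
          | zero => simp only [map_zero, TensorProduct.zero_tmul]
          | add x₁ x₂ h₁ h₂ => simp only [map_add, TensorProduct.add_tmul, h₁, h₂]
          | tmul q g' => simp
      have h₂ : ∀ z : EnvBimod k A B ⊗[k] H,
          (Coalgebra.comul (R := k) (A := H)).lTensor (Ind k H A B M)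
            (((mk k H A B M).flip m).rTensor H z) =
          ((mk k H A B M).flip m).rTensor (H ⊗[k] H)
            ((Coalgebra.comul (R := k) (A := H)).lTensor (EnvBimod k A B) z) := by
        intro z
        induction z with
        | zero => simp only [map_zero]
        | add x₁ x₂ h₁ h₂ => simp only [map_add, h₁, h₂]
        | tmul p g => simp
      rw [coaction_mk, h₁, h₂, ← h]
  counit x := by
    induction x using Ind.induction with
    | h0 => simp only [map_zero]
    | ha x y hx hy => simp only [map_add, hx, hy]
    | ht y m =>
      have h := RightComodule.counit (k := k) (H := H) y
      have h₁ : ∀ z : EnvBimod k A B ⊗[k] H, TensorProduct.rid k (Ind k H A B M)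
          ((Coalgebra.counit (R := k) (A := H)).lTensor (Ind k H A B M)
            (((mk k H A B M).flip m).rTensor H z)) =
          (mk k H A B M).flip m (TensorProduct.rid k (EnvBimod k A B)
            ((Coalgebra.counit (R := k) (A := H)).lTensor (EnvBimod k A B) z)) := by
        intro z
        induction z with
        | zero => simp only [map_zero]
        | add x₁ x₂ h₁ h₂ => simp only [map_add, h₁, h₂]
        | tmul p g => simp
      rw [coaction_mk, h₁, h]
      rfl

theorem coact_mk (y : EnvBimod k A B) (m : M) :
    coact k H (Ind k H A B M) (mk k H A B M y m) =
      ((mk k H A B M).flip m).rTensor H (coact k H (EnvBimod k A B) y) := coaction_mk y m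

instance instLeftHopf : LeftHopfModule k H A (Ind k H A B M) where
  coact_smul a x := by
    induction x using Ind.induction with
    | h0 => simp only [map_zero, smul_zero]
    | ha x y hx hy => simp only [map_add, smul_add, hx, hy]
    | ht y m =>
      rw [smul_left_mk, coact_mk, coact_mk, LeftHopfModule.coact_smul,
        rTensor_diagMul ((mk k H A B M).flip m) LinearMap.id ((mk k H A B M).flip m) _
          (lact k A (Ind k H A B M))]
      · rw [LinearMap.rTensor_id, LinearMap.id_apply]
      · intro p q
        exact (smul_left_mk p q m).symm

instance instRightHopf : RightHopfModule k H B (Ind k H A B M) where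
  coact_smul b x := by
    induction x using Ind.induction with
    | h0 => simp only [map_zero, smul_zero, LinearMap.zero_apply]
    | ha x y hx hy => simp only [map_add, smul_add, LinearMap.add_apply, hx, hy]
    | ht y m =>
      rw [smul_right_mk, coact_mk, coact_mk, RightHopfModule.coact_smul,
        rTensor_diagMul ((mk k H A B M).flip m) ((mk k H A B M).flip m) LinearMap.id _
          (ract k B (Ind k H A B M))]
      · rw [LinearMap.rTensor_id, LinearMap.id_apply]
      · intro p q
        exact (smul_right_mk (op q) p m).symm

variable (k H A B)

/-- The unit `m ↦ 1 ⊗ m`. -/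
noncomputable def unit : M →ₗ[k] Ind k H A B M := mk k H A B M 1

variable {k H A B}

theorem coact_unit (m : M) : coact k H (Ind k H A B M) (unit k H A B m) =
    unit k H A B m ⊗ₜ 1 := by
  rw [unit, coact_mk, EnvBimod.coact_one, LinearMap.rTensor_tmul]
  rfl

end Ind

end Induction

/-! ## Restriction to `A^{co H}` and `B^{co H}`, and tensor products of `□_H`-modules -/

section Restriction

/-- A left `A □_H B^op`-module viewed as an `(A^{co H}, B^{co H})`-bimodule by restriction of scalars
along `a ↦ a ⊗ 1` and `b ↦ 1 ⊗ b` (the underlying type is `M`). -/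
@[nolint unusedArguments]
def Restr (_k _H _A _B M : Type*) : Type _ := M

variable (k : Type*) [CommRing k] (H : Type*) [Ring H] [HopfAlgebra k H] [HasBijectiveAntipode k H]
  (A B : Type*) [Ring A] [Algebra k A] [ComoduleAlgebra k H A]
  [Ring B] [Algebra k B] [ComoduleAlgebra k H B]

variable (M : Type*) [AddCommGroup M] [Module k M] [Module (CotensorRing k H A B) M]

namespace Restr

instance : AddCommGroup (Restr k H A B M) := inferInstanceAs (AddCommGroup M)

instance : Module k (Restr k H A B M) := inferInstanceAs (Module k M)

/-- The identity map `M → M`. -/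
def of : M ≃ₗ[k] Restr k H A B M := LinearEquiv.refl k M

noncomputable instance instModuleLeft : Module (CoinvRing k H A) (Restr k H A B M) :=
  Module.compHom M (inclLeft k H A B).toRingHom

noncomputable instance instModuleRight : Module (CoinvRing k H B)ᵐᵒᵖ (Restr k H A B M) :=
  Module.compHom M (inclRight k H A B).toRingHom

variable {k H A B M}

theorem smul_left_def (a : CoinvRing k H A) (m : M) :
    a • of k H A B M m = of k H A B M (inclLeft k H A B a • m) := rfl

theorem smul_right_def (b : (CoinvRing k H B)ᵐᵒᵖ) (m : M) :
    b • of k H A B M m = of k H A B M (inclRight k H A B b • m) := rfl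

instance [IsScalarTower k (CotensorRing k H A B) M] :
    IsScalarTower k (CoinvRing k H A) (Restr k H A B M) where
  smul_assoc c a m := by
    obtain ⟨m, rfl⟩ := (of k H A B M).surjective m
    rw [smul_left_def, smul_left_def, ← map_smul (of k H A B M), map_smul (inclLeft k H A B), smul_assoc]

instance [IsScalarTower k (CotensorRing k H A B) M] :
    IsScalarTower k (CoinvRing k H B)ᵐᵒᵖ (Restr k H A B M) where
  smul_assoc c a m := by
    obtain ⟨m, rfl⟩ := (of k H A B M).surjective m
    rw [smul_right_def, smul_right_def, ← map_smul (of k H A B M), map_smul (inclRight k H A B), smul_assoc]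

theorem incl_comm (a : CoinvRing k H A) (b : (CoinvRing k H B)ᵐᵒᵖ) :
    inclLeft k H A B a * inclRight k H A B b = inclRight k H A B b * inclLeft k H A B a := by
  have hinj : Function.Injective (CotensorRing.val k H A B) := Subtype.val_injective
  apply hinj
  rw [map_mul, map_mul, val_inclLeft, val_inclRight, Algebra.TensorProduct.tmul_mul_tmul,
    Algebra.TensorProduct.tmul_mul_tmul, one_mul, mul_one, one_mul, mul_one]

instance : SMulCommClass (CoinvRing k H A) (CoinvRing k H B)ᵐᵒᵖ (Restr k H A B M) where
  smul_comm a b m := by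
    obtain ⟨m, rfl⟩ := (of k H A B M).surjective m
    rw [smul_right_def, smul_left_def, smul_left_def, smul_right_def, ← mul_smul, ← mul_smul,
      incl_comm]

end Restr

theorem Ind.smul_left_unit (a : CoinvRing k H A) (m : M) :
    CoinvRing.val k H A a • Ind.unit k H A B m =
      Ind.unit k H A B (inclLeft k H A B a • m) := by
  rw [Ind.unit, ← Ind.mk_balanced, Ind.smul_left_mk, EnvBimod.smul_left_def,
    EnvBimod.smul_cotensor_def, one_mul, mul_one]
  rfl

theorem Ind.smul_right_unit (b : (CoinvRing k H B)ᵐᵒᵖ) (m : M) :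
    op (CoinvRing.val k H B (unop b)) • Ind.unit k H A B m =
      Ind.unit k H A B (inclRight k H A B b • m) := by
  rw [Ind.unit, ← Ind.mk_balanced, Ind.smul_right_mk, EnvBimod.smul_right_def,
    EnvBimod.smul_cotensor_def, one_mul, mul_one]
  rfl

variable (C : Type*) [Ring C] [Algebra k C] [ComoduleAlgebra k H C]
  (N : Type*) [AddCommGroup N] [Module k N] [Module (CotensorRing k H B C) N]

/-- The map `m ⊗ n ↦ (1 ⊗ m) ⊗ (1 ⊗ n)` before restriction of the codomain. -/
noncomputable def unitTensorAux :
    BalTensor k (CoinvRing k H B) (Restr k H A B M) (Restr k H B C N) →ₗ[k]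
      BalTensor k B (Ind k H A B M) (Ind k H B C N) :=
  BalTensor.lift
    ((BalTensor.mk k B (Ind k H A B M) (Ind k H B C N)).compl₁₂
      (Ind.unit k H A B ∘ₗ (Restr.of k H A B M).symm.toLinearMap)
      (Ind.unit k H B C ∘ₗ (Restr.of k H B C N).symm.toLinearMap)) (by
    intro b m n
    obtain ⟨m, rfl⟩ := (Restr.of k H A B M).surjective m
    obtain ⟨n, rfl⟩ := (Restr.of k H B C N).surjective n
    rw [Restr.smul_right_def, Restr.smul_left_def]
    simp only [LinearMap.compl₁₂_apply, LinearMap.comp_apply, LinearEquiv.coe_coe,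
      LinearEquiv.symm_apply_apply]
    rw [← Ind.smul_left_unit, ← Ind.smul_right_unit, unop_op]
    exact BalTensor.tmul_balanced _ _ _)

theorem unitTensorAux_tmul (m : M) (n : N) :
    unitTensorAux k H A B M C N (.tmul k (CoinvRing k H B) (Restr.of k H A B M m)
      (Restr.of k H B C N n)) =
    .tmul k B (Ind.unit k H A B m) (Ind.unit k H B C n) :=
  BalTensor.lift_tmul _ _ _ _

theorem coact_unitTensorAux
    (t : BalTensor k (CoinvRing k H B) (Restr k H A B M) (Restr k H B C N)) :
    coact k H (BalTensor k B (Ind k H A B M) (Ind k H B C N)) (unitTensorAux k H A B M C N t) =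
      unitTensorAux k H A B M C N t ⊗ₜ 1 := by
  induction t using BalTensor.induction with
  | h0 => simp only [map_zero, TensorProduct.zero_tmul]
  | ha x y hx hy => simp only [map_add, TensorProduct.add_tmul, hx, hy]
  | ht m n =>
    obtain ⟨m, rfl⟩ := (Restr.of k H A B M).surjective m
    obtain ⟨n, rfl⟩ := (Restr.of k H B C N).surjective n
    rw [unitTensorAux_tmul, coact_balTensor_tmul, Ind.coact_unit, Ind.coact_unit,
      diagMul_tmul, mul_one]
    rfl

/-- The canonical map `M ⊗_{B^{co H}} N → (F(M) ⊗_B F(N))^{co H}`, `m ⊗ n ↦ (1 ⊗ m) ⊗ (1 ⊗ n)`, where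
`F(M) = (A ⊗ B^op) ⊗_{A □_H B^op} M` and `F(N) = (B ⊗ C^op) ⊗_{B □_H C^op} N`. -/
noncomputable def unitTensor :
    BalTensor k (CoinvRing k H B) (Restr k H A B M) (Restr k H B C N) →ₗ[k]
      CoinvMod k H (BalTensor k B (Ind k H A B M) (Ind k H B C N)) :=
  (unitTensorAux k H A B M C N).codRestrict
    (coinv k H (BalTensor k B (Ind k H A B M) (Ind k H B C N)))
    (coact_unitTensorAux k H A B M C N)

theorem val_unitTensor
    (t : BalTensor k (CoinvRing k H B) (Restr k H A B M) (Restr k H B C N)) :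
    CoinvMod.val k H _ (unitTensor k H A B M C N t) = unitTensorAux k H A B M C N t := rfl

/-- Left `A □_H A^op`-linearity of a map `f : M ⊗_{B^{co H}} N → A^{co H}`, for a left
`A □_H B^op`-module `M` and a left `B □_H A^op`-module `N`. The `A □_H A^op`-module structure on
`M ⊗_{B^{co H}} N` is the one transported from `(F(M) ⊗_B F(N))^{co H}` along the canonical map
`unitTensor`, which is bijective when `A` and `B` are right faithfully flat `H`-Galois extensions:
`t' = x t` means that `unitTensor t' = x (unitTensor t)`. -/
def IsCotensorLinear {k H A B} [CommRing k] [Ring H] [HopfAlgebra k H] [HasBijectiveAntipode k H]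
    [Ring A] [Algebra k A] [ComoduleAlgebra k H A] [Ring B] [Algebra k B] [ComoduleAlgebra k H B]
    {M N : Type*} [AddCommGroup M] [Module k M] [Module (CotensorRing k H A B) M]
    [AddCommGroup N] [Module k N] [Module (CotensorRing k H B A) N]
    (f : BalTensor k (CoinvRing k H B) (Restr k H A B M) (Restr k H B A N) →ₗ[k]
      CoinvRing k H A) : Prop :=
  ∀ (x : CotensorRing k H A A)
    (t t' : BalTensor k (CoinvRing k H B) (Restr k H A B M) (Restr k H B A N)),
    unitTensor k H A B M A N t' = x • unitTensor k H A B M A N t → f t' = x • f t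

end Restriction

/-! ## Right faithfully flat Hopf-Galois extensions -/

section Galois

/-- The map `P ⊗_R f`. -/
noncomputable def BalTensor.lTensor (k : Type*) [CommRing k] (R : Type*) [Ring R] [Algebra k R]
    (P : Type*) [AddCommGroup P] [Module k P] [Module Rᵐᵒᵖ P]
    {N N' : Type*} [AddCommGroup N] [Module k N] [Module R N] [IsScalarTower k R N]
    [AddCommGroup N'] [Module k N'] [Module R N'] [IsScalarTower k R N'] (f : N →ₗ[R] N') :
    BalTensor k R P N →ₗ[k] BalTensor k R P N' :=
  BalTensor.map LinearMap.id (fun _ _ => rfl) (f.restrictScalars k) (fun r n => f.map_smul r n)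

/-- A right `R`-module `P` is faithfully flat: `P ⊗_R -` preserves and reflects exact sequences of
left `R`-modules. -/
def IsRightFaithfullyFlat (k : Type v) [CommRing k] (R P : Type u) [Ring R] [Algebra k R]
    [AddCommGroup P] [Module k P] [Module Rᵐᵒᵖ P] : Prop :=
  ∀ (N₁ N₂ N₃ : Type u) [AddCommGroup N₁] [Module k N₁] [Module R N₁] [IsScalarTower k R N₁]
    [AddCommGroup N₂] [Module k N₂] [Module R N₂] [IsScalarTower k R N₂]
    [AddCommGroup N₃] [Module k N₃] [Module R N₃] [IsScalarTower k R N₃]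
    (f : N₁ →ₗ[R] N₂) (g : N₂ →ₗ[R] N₃),
    Function.Exact (BalTensor.lTensor k R P f) (BalTensor.lTensor k R P g) ↔ Function.Exact f g

section

variable (k : Type*) [CommRing k] (H : Type*) [Ring H] [HopfAlgebra k H]
  (A : Type*) [Ring A] [Algebra k A] [ComoduleAlgebra k H A]

/-- `A` as a left `A^{co H}`-module. -/
instance instModuleCoinvRingLeft : Module (CoinvRing k H A) A :=
  Module.compHom A (CoinvRing.val k H A).toRingHom

/-- `A` as a right `A^{co H}`-module. -/
instance instModuleCoinvRingRight : Module (CoinvRing k H A)ᵐᵒᵖ A :=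
  Module.compHom A (RingHom.op (CoinvRing.val k H A).toRingHom)

/-- The canonical map `canMap : A ⊗_{A^{co H}} A → A ⊗ H`, `a ⊗ b ↦ a₍₀₎ b ⊗ a₍₁₎`. -/
noncomputable def canMap : BalTensor k (CoinvRing k H A) A A →ₗ[k] A ⊗[k] H :=
  BalTensor.lift
    ((LinearMap.mul k (A ⊗[k] H)).compl₁₂ (coact k H A)
      (Algebra.TensorProduct.includeLeft : A →ₐ[k] A ⊗[k] H).toLinearMap) (by
    intro c a b
    have h : coact k H A (a * CoinvRing.val k H A c) =
        coact k H A a * coact k H A (CoinvRing.val k H A c) :=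
      ComoduleAlgebra.coact_mul _ _
    change coact k H A (a * CoinvRing.val k H A c) * b ⊗ₜ 1 =
      coact k H A a * (CoinvRing.val k H A c * b) ⊗ₜ 1
    rw [h, CoinvRing.coact_val, mul_assoc, Algebra.TensorProduct.tmul_mul_tmul, mul_one])

theorem canMap_tmul (a b : A) : canMap k H A (.tmul k _ a b) = coact k H A a * b ⊗ₜ 1 :=
  BalTensor.lift_tmul _ _ _ _

end

/-- `A` is a right faithfully flat `H`-Galois extension of `A^{co H}`: the canonical map `canMap` is
bijective and `A` is faithfully flat as a right `A^{co H}`-module. -/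
structure IsRightFaithfullyFlatGalois (k : Type v) [CommRing k] (H : Type*) [Ring H]
    [HopfAlgebra k H] (A : Type u) [Ring A] [Algebra k A] [ComoduleAlgebra k H A] : Prop where
  bijective_can : Function.Bijective (canMap k H A)
  faithfullyFlat : IsRightFaithfullyFlat k (CoinvRing k H A) A

end Galois

/-! ## The category of `H`-Morita contexts connecting `A` and `B` -/

section HMorita

variable (k : Type v) [CommRing k] (H A B : Type u) [Ring H] [HopfAlgebra k H]
  [Ring A] [Algebra k A] [ComoduleAlgebra k H A]
  [Ring B] [Algebra k B] [ComoduleAlgebra k H B]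

/-- An `H`-Morita context `(A, B, M, N, α, β)`: a Morita context with `M` in `_A M_B^H`, `N` in
`_B M_A^H`, and `H`-colinear `α` and `β`. -/
structure HMoritaContext where
  M : Type u
  N : Type u
  [addCommGroupM : AddCommGroup M]
  [moduleM : Module k M]
  [leftM : Module A M]
  [rightM : Module Bᵐᵒᵖ M]
  [towerLeftM : IsScalarTower k A M]
  [towerRightM : IsScalarTower k Bᵐᵒᵖ M]
  [commM : SMulCommClass A Bᵐᵒᵖ M]
  [comoduleM : RightComodule k H M]
  [leftHopfM : LeftHopfModule k H A M]
  [rightHopfM : RightHopfModule k H B M]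
  [addCommGroupN : AddCommGroup N]
  [moduleN : Module k N]
  [leftN : Module B N]
  [rightN : Module Aᵐᵒᵖ N]
  [towerLeftN : IsScalarTower k B N]
  [towerRightN : IsScalarTower k Aᵐᵒᵖ N]
  [commN : SMulCommClass B Aᵐᵒᵖ N]
  [comoduleN : RightComodule k H N]
  [leftHopfN : LeftHopfModule k H B N]
  [rightHopfN : RightHopfModule k H A N]
  ctx : MoritaContext k A B M N
  α_colinear : ∀ t, coact k H A (ctx.α t) = ctx.α.toLinearMap.rTensor H (coact k H _ t)
  β_colinear : ∀ t, coact k H B (ctx.β t) = ctx.β.toLinearMap.rTensor H (coact k H _ t)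

namespace HMoritaContext

attribute [instance] addCommGroupM moduleM leftM rightM towerLeftM towerRightM commM comoduleM
  leftHopfM rightHopfM addCommGroupN moduleN leftN rightN towerLeftN towerRightN commN comoduleN
  leftHopfN rightHopfN

variable {k H A B}

/-- Morphisms of `H`-Morita contexts that are the identity on `A` and `B`. -/
@[ext]
structure Hom (X Y : HMoritaContext k H A B) where
  μ : HopfBimodHom k H A B X.M Y.M
  ν : HopfBimodHom k H B A X.N Y.N
  α_comp : ∀ m n, Y.ctx.α (.tmul k B (μ m) (ν n)) = X.ctx.α (.tmul k B m n)
  β_comp : ∀ n m, Y.ctx.β (.tmul k A (ν n) (μ m)) = X.ctx.β (.tmul k A n m)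

instance : Category (HMoritaContext k H A B) where
  Hom := Hom
  id X :=
    { μ := HopfBimodHom.id k H A B X.M
      ν := HopfBimodHom.id k H B A X.N
      α_comp := fun _ _ => rfl
      β_comp := fun _ _ => rfl }
  comp f g :=
    { μ := HopfBimodHom.comp g.μ f.μ
      ν := HopfBimodHom.comp g.ν f.ν
      α_comp := fun m n => (g.α_comp _ _).trans (f.α_comp m n)
      β_comp := fun n m => (g.β_comp _ _).trans (f.β_comp n m) }

/-- The context is strict: `α` and `β` are bijective. -/
def IsStrict (X : HMoritaContext k H A B) : Prop := X.ctx.IsStrict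

end HMoritaContext

end HMorita

/-! ## The category of `□_H`-Morita contexts connecting `A^{co H}` and `B^{co H}` -/

section CotensorMorita

variable (k : Type v) [CommRing k] (H A B : Type u) [Ring H] [HopfAlgebra k H]
  [HasBijectiveAntipode k H]
  [Ring A] [Algebra k A] [ComoduleAlgebra k H A]
  [Ring B] [Algebra k B] [ComoduleAlgebra k H B]

/-- A `□_H`-Morita context: a Morita context `(A^{co H}, B^{co H}, M, N, α, β)` where `M` is a left
`A □_H B^op`-module, `N` is a left `B □_H A^op`-module, `α` is left `A □_H A^op`-linear and `β` is left
`B □_H B^op`-linear. -/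
structure CotensorMoritaContext where
  M : Type u
  N : Type u
  [addCommGroupM : AddCommGroup M]
  [moduleM : Module k M]
  [cotensorM : Module (CotensorRing k H A B) M]
  [towerM : IsScalarTower k (CotensorRing k H A B) M]
  [addCommGroupN : AddCommGroup N]
  [moduleN : Module k N]
  [cotensorN : Module (CotensorRing k H B A) N]
  [towerN : IsScalarTower k (CotensorRing k H B A) N]
  ctx : MoritaContext k (CoinvRing k H A) (CoinvRing k H B) (Restr k H A B M) (Restr k H B A N)
  α_linear : IsCotensorLinear ctx.α.toLinearMap
  β_linear : IsCotensorLinear ctx.β.toLinearMap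

namespace CotensorMoritaContext

attribute [instance] addCommGroupM moduleM cotensorM towerM addCommGroupN moduleN cotensorN towerN

variable {k H A B}

/-- The element `α(m ⊗ n)` of `A^{co H}`. -/
noncomputable def pairα (X : CotensorMoritaContext k H A B) (m : X.M) (n : X.N) : CoinvRing k H A :=
  X.ctx.α (.tmul k _ (Restr.of k H A B X.M m) (Restr.of k H B A X.N n))

/-- The element `β(n ⊗ m)` of `B^{co H}`. -/
noncomputable def pairβ (X : CotensorMoritaContext k H A B) (n : X.N) (m : X.M) : CoinvRing k H B :=
  X.ctx.β (.tmul k _ (Restr.of k H B A X.N n) (Restr.of k H A B X.M m))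

/-- Morphisms of `□_H`-Morita contexts that are the identity on `A^{co H}` and `B^{co H}`. -/
@[ext]
structure Hom (X Y : CotensorMoritaContext k H A B) where
  μ : X.M →ₗ[CotensorRing k H A B] Y.M
  ν : X.N →ₗ[CotensorRing k H B A] Y.N
  α_comp : ∀ m n, Y.pairα (μ m) (ν n) = X.pairα m n
  β_comp : ∀ n m, Y.pairβ (ν n) (μ m) = X.pairβ n m

noncomputable instance : Category (CotensorMoritaContext k H A B) where
  Hom := Hom
  id X :=
    { μ := LinearMap.id
      ν := LinearMap.id
      α_comp := fun _ _ => rfl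
      β_comp := fun _ _ => rfl }
  comp f g :=
    { μ := g.μ ∘ₗ f.μ
      ν := g.ν ∘ₗ f.ν
      α_comp := fun m n => (g.α_comp _ _).trans (f.α_comp m n)
      β_comp := fun n m => (g.β_comp _ _).trans (f.β_comp n m) }

/-- The context is strict: `α` and `β` are bijective. -/
def IsStrict (X : CotensorMoritaContext k H A B) : Prop := X.ctx.IsStrict

end CotensorMoritaContext

end CotensorMorita

/-! ## Taking coinvariants -/

section CoinvFunctor

section Aux

variable {k : Type*} [CommRing k] {H : Type*} [Ring H] [HopfAlgebra k H] [HasBijectiveAntipode k H]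
  {A B C : Type*} [Ring A] [Algebra k A] [ComoduleAlgebra k H A]
  [Ring B] [Algebra k B] [ComoduleAlgebra k H B] [Ring C] [Algebra k C] [ComoduleAlgebra k H C]

theorem HopfBimodHom.map_envAct {X Y : Type*}
    [AddCommGroup X] [Module k X] [Module A X] [Module Bᵐᵒᵖ X] [IsScalarTower k A X]
    [IsScalarTower k Bᵐᵒᵖ X] [SMulCommClass A Bᵐᵒᵖ X]
    [AddCommGroup Y] [Module k Y] [Module A Y] [Module Bᵐᵒᵖ Y] [IsScalarTower k A Y]
    [IsScalarTower k Bᵐᵒᵖ Y] [SMulCommClass A Bᵐᵒᵖ Y]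
    (f : X →ₗ[k] Y) (hf : ∀ (a : A) x, f (a • x) = a • f x)
    (hf' : ∀ (b : Bᵐᵒᵖ) x, f (b • x) = b • f x)
    (y : A ⊗[k] Bᵐᵒᵖ) (x : X) : f (envAct k A B X y x) = envAct k A B Y y (f x) := by
  induction y with
  | zero => simp only [map_zero, LinearMap.zero_apply]
  | add x₁ x₂ h₁ h₂ => simp only [map_add, LinearMap.add_apply, h₁, h₂]
  | tmul a b => simp only [envAct_tmul, hf, hf']

section Bimod

variable {M : Type*} [AddCommGroup M] [Module k M] [Module A M] [Module Bᵐᵒᵖ M]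
    [IsScalarTower k A M] [IsScalarTower k Bᵐᵒᵖ M] [SMulCommClass A Bᵐᵒᵖ M]
    [RightComodule k H M] [LeftHopfModule k H A M] [RightHopfModule k H B M]
  {M' : Type*} [AddCommGroup M'] [Module k M'] [Module A M'] [Module Bᵐᵒᵖ M']
    [IsScalarTower k A M'] [IsScalarTower k Bᵐᵒᵖ M'] [SMulCommClass A Bᵐᵒᵖ M']
    [RightComodule k H M'] [LeftHopfModule k H A M'] [RightHopfModule k H B M']

/-- The `A □_H B^op`-linear map `f^{co H} : M^{co H} → M'^{co H}` of a morphism `f` in `_A M_B^H`. -/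
noncomputable def HopfBimodHom.coinvMap (f : HopfBimodHom k H A B M M') :
    CoinvMod k H M →ₗ[CotensorRing k H A B] CoinvMod k H M' where
  toFun m := CoinvMod.mk (f (CoinvMod.val k H M m)) (by
    rw [f.map_coact, m.coact_val, LinearMap.rTensor_tmul])
  map_add' m n := CoinvMod.val_injective (map_add f.toLinearMap _ _)
  map_smul' x m := CoinvMod.val_injective
    (HopfBimodHom.map_envAct f.toLinearMap f.map_left f.map_right _ _)

@[simp] theorem HopfBimodHom.val_coinvMap (f : HopfBimodHom k H A B M M') (m : CoinvMod k H M) :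
    CoinvMod.val k H M' (f.coinvMap m) = f (CoinvMod.val k H M m) := rfl

variable (k A B) in
/-- The identity map. -/
noncomputable def EnvBimod.toTensor : EnvBimod k A B →ₐ[k] A ⊗[k] Bᵐᵒᵖ := AlgHom.id k (A ⊗[k] Bᵐᵒᵖ)

variable (k H A B M) in
/-- The map `(A ⊗ B^op) ⊗_{A □_H B^op} M^{co H} → M`, `(a ⊗ b) ⊗ m ↦ a m b`. -/
noncomputable def Ind.counit : Ind k H A B (CoinvMod k H M) →ₗ[k] M :=
  BalTensor.lift (R := CotensorRing k H A B)
    (((envAct k A B M).comp (EnvBimod.toTensor k A B)).toLinearMap.compl₂ (CoinvMod.val k H M)) (by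
      intro x y m
      change envAct k A B M (EnvBimod.toTensor k A B (op x • y)) (CoinvMod.val k H M m) =
        envAct k A B M (EnvBimod.toTensor k A B y) (CoinvMod.val k H M (x • m))
      rw [val_smul_coinv, EnvBimod.smul_cotensor_def, map_mul, map_mul]
      rfl)

theorem Ind.counit_mk (y : EnvBimod k A B) (m : CoinvMod k H M) :
    Ind.counit k H A B M (Ind.mk k H A B _ y m) =
      envAct k A B M (EnvBimod.toTensor k A B y) (CoinvMod.val k H M m) :=
  BalTensor.lift_tmul (R := CotensorRing k H A B) _ _ _ _

theorem Ind.counit_unit (m : CoinvMod k H M) :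
    Ind.counit k H A B M (Ind.unit k H A B m) = CoinvMod.val k H M m := by
  refine (Ind.counit_mk 1 m).trans ?_
  rw [map_one, map_one]
  rfl

theorem Ind.counit_left (a : A) (x : Ind k H A B (CoinvMod k H M)) :
    Ind.counit k H A B M (a • x) = a • Ind.counit k H A B M x := by
  induction x using Ind.induction with
  | h0 => simp only [map_zero, smul_zero]
  | ha x y hx hy => simp only [map_add, smul_add, hx, hy]
  | ht y m =>
    rw [Ind.smul_left_mk, Ind.counit_mk, Ind.counit_mk, EnvBimod.smul_left_def, map_mul, map_mul,
      Module.End.mul_apply]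
    refine (envAct_tmul a 1 _).trans ?_
    rw [one_smul]

theorem Ind.counit_right (b : Bᵐᵒᵖ) (x : Ind k H A B (CoinvMod k H M)) :
    Ind.counit k H A B M (b • x) = b • Ind.counit k H A B M x := by
  induction x using Ind.induction with
  | h0 => simp only [map_zero, smul_zero]
  | ha x y hx hy => simp only [map_add, smul_add, hx, hy]
  | ht y m =>
    rw [Ind.smul_right_mk, Ind.counit_mk, Ind.counit_mk, EnvBimod.smul_right_def, map_mul, map_mul,
      Module.End.mul_apply]
    refine (envAct_tmul 1 b _).trans ?_
    rw [one_smul]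

theorem val_restr_left (a : CoinvRing k H A) (m : CoinvMod k H M) :
    CoinvMod.val k H M (inclLeft k H A B a • m) = CoinvRing.val k H A a • CoinvMod.val k H M m := by
  rw [val_smul_coinv, val_inclLeft, envAct_tmul, one_smul]

theorem val_restr_right (b : (CoinvRing k H B)ᵐᵒᵖ) (m : CoinvMod k H M) :
    CoinvMod.val k H M (inclRight k H A B b • m) =
      op (CoinvRing.val k H B (unop b)) • CoinvMod.val k H M m := by
  rw [val_smul_coinv, val_inclRight, envAct_tmul, one_smul]

end Bimod

variable (k H A B)
variable (M : Type*) [AddCommGroup M] [Module k M] [Module A M] [Module Bᵐᵒᵖ M]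
    [IsScalarTower k A M] [IsScalarTower k Bᵐᵒᵖ M] [SMulCommClass A Bᵐᵒᵖ M]
    [RightComodule k H M] [LeftHopfModule k H A M] [RightHopfModule k H B M]
  (N : Type*) [AddCommGroup N] [Module k N] [Module B N] [Module Aᵐᵒᵖ N]
    [IsScalarTower k B N] [IsScalarTower k Aᵐᵒᵖ N] [SMulCommClass B Aᵐᵒᵖ N]
    [RightComodule k H N] [LeftHopfModule k H B N] [RightHopfModule k H A N]

/-- The map `M^{co H} ⊗_{B^{co H}} N^{co H} → M ⊗_B N`, `m ⊗ n ↦ m ⊗ n`. -/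
noncomputable def coinvTensor :
    BalTensor k (CoinvRing k H B) (Restr k H A B (CoinvMod k H M)) (Restr k H B A (CoinvMod k H N))
      →ₗ[k] BalTensor k B M N :=
  BalTensor.lift
    ((BalTensor.mk k B M N).compl₁₂
      (CoinvMod.val k H M ∘ₗ (Restr.of k H A B _).symm.toLinearMap)
      (CoinvMod.val k H N ∘ₗ (Restr.of k H B A _).symm.toLinearMap)) (by
    intro b m n
    obtain ⟨m, rfl⟩ := (Restr.of k H A B _).surjective m
    obtain ⟨n, rfl⟩ := (Restr.of k H B A _).surjective n
    rw [Restr.smul_right_def, Restr.smul_left_def]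
    simp only [LinearMap.compl₁₂_apply, LinearMap.comp_apply, LinearEquiv.coe_coe,
      LinearEquiv.symm_apply_apply]
    rw [val_restr_right, val_restr_left, unop_op]
    exact BalTensor.tmul_balanced _ _ _)

variable {k H A B M N}

theorem coinvTensor_tmul (m : CoinvMod k H M) (n : CoinvMod k H N) :
    coinvTensor k H A B M N (.tmul k _ (Restr.of k H A B _ m) (Restr.of k H B A _ n)) =
      .tmul k B (CoinvMod.val k H M m) (CoinvMod.val k H N n) :=
  BalTensor.lift_tmul _ _ _ _

/-- The map `M^{co H} ⊗_{B^{co H}} N^{co H} → A^{co H}`, `m ⊗ n ↦ α(m ⊗ n)`. -/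
noncomputable def coinvPairing (α : BimodHom k A A (BalTensor k B M N) A)
    (hα : ∀ t, coact k H A (α t) = α.toLinearMap.rTensor H (coact k H _ t)) :
    BimodHom k (CoinvRing k H A) (CoinvRing k H A)
      (BalTensor k (CoinvRing k H B) (Restr k H A B (CoinvMod k H M))
        (Restr k H B A (CoinvMod k H N))) (CoinvRing k H A) where
  toLinearMap := (α.toLinearMap ∘ₗ coinvTensor k H A B M N).codRestrict
    (Subalgebra.toSubmodule (coinvAlg k H A)) (by
      intro t
      change coact k H A (α (coinvTensor k H A B M N t)) = α (coinvTensor k H A B M N t) ⊗ₜ 1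
      induction t using BalTensor.induction with
      | h0 => simp only [map_zero, TensorProduct.zero_tmul]
      | ha x y hx hy => simp only [map_add, TensorProduct.add_tmul, hx, hy]
      | ht m n =>
        obtain ⟨m, rfl⟩ := (Restr.of k H A B _).surjective m
        obtain ⟨n, rfl⟩ := (Restr.of k H B A _).surjective n
        rw [coinvTensor_tmul, hα, coact_balTensor_tmul, m.coact_val, n.coact_val,
          diagMul_tmul, mul_one, LinearMap.rTensor_tmul]
        rfl)
  map_left a t := by
    have hinj : Function.Injective (CoinvRing.val k H A) := Subtype.val_injective
    apply hinj
    change α (coinvTensor k H A B M N (a • t)) = CoinvRing.val k H A a * α (coinvTensor k H A B M N t)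
    refine Eq.trans ?_ (α.map_left (CoinvRing.val k H A a) (coinvTensor k H A B M N t))
    refine congrArg α ?_
    induction t using BalTensor.induction with
    | h0 => simp only [map_zero, smul_zero]
    | ha x y hx hy => simp only [map_add, smul_add, hx, hy]
    | ht m n =>
      obtain ⟨m, rfl⟩ := (Restr.of k H A B _).surjective m
      obtain ⟨n, rfl⟩ := (Restr.of k H B A _).surjective n
      rw [BalTensor.smul_tmul_left, Restr.smul_left_def, coinvTensor_tmul, coinvTensor_tmul,
        val_restr_left, BalTensor.smul_tmul_left]
  map_right a t := by
    have hinj : Function.Injective (CoinvRing.val k H A) := Subtype.val_injective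
    apply hinj
    change α (coinvTensor k H A B M N (a • t)) =
      op (CoinvRing.val k H A (unop a)) • α (coinvTensor k H A B M N t)
    refine Eq.trans ?_ (α.map_right (op (CoinvRing.val k H A (unop a))) (coinvTensor k H A B M N t))
    refine congrArg α ?_
    induction t using BalTensor.induction with
    | h0 => simp only [map_zero, smul_zero]
    | ha x y hx hy => simp only [map_add, smul_add, hx, hy]
    | ht m n =>
      obtain ⟨m, rfl⟩ := (Restr.of k H A B _).surjective m
      obtain ⟨n, rfl⟩ := (Restr.of k H B A _).surjective n
      rw [BalTensor.smul_tmul_right, Restr.smul_right_def, coinvTensor_tmul, coinvTensor_tmul,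
        val_restr_right, BalTensor.smul_tmul_right]

theorem val_coinvPairing (α : BimodHom k A A (BalTensor k B M N) A)
    (hα : ∀ t, coact k H A (α t) = α.toLinearMap.rTensor H (coact k H _ t)) (t) :
    CoinvRing.val k H A (coinvPairing α hα t) = α (coinvTensor k H A B M N t) := rfl

/-- The map `F(M^{co H}) ⊗_B F(N^{co H}) → M ⊗_B N`. -/
noncomputable def counitTensor :
    BalTensor k B (Ind k H A B (CoinvMod k H M)) (Ind k H B A (CoinvMod k H N)) →ₗ[k]
      BalTensor k B M N :=
  BalTensor.map (Ind.counit k H A B M)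
    (fun b => Ind.counit_right (op b)) (Ind.counit k H B A N) (Ind.counit_left)

theorem counitTensor_tmul (m : Ind k H A B (CoinvMod k H M)) (n : Ind k H B A (CoinvMod k H N)) :
    counitTensor (.tmul k B m n) =
      .tmul k B (Ind.counit k H A B M m) (Ind.counit k H B A N n) :=
  BalTensor.map_tmul _ _ _ _ _ _

theorem counitTensor_left (a : A)
    (t : BalTensor k B (Ind k H A B (CoinvMod k H M)) (Ind k H B A (CoinvMod k H N))) :
    counitTensor (k := k) (H := H) (M := M) (N := N) (a • t) = a • counitTensor t := by
  induction t using BalTensor.induction with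
  | h0 => simp only [map_zero, smul_zero]
  | ha x y hx hy => simp only [map_add, smul_add, hx, hy]
  | ht m n =>
    rw [BalTensor.smul_tmul_left, counitTensor_tmul, counitTensor_tmul, Ind.counit_left,
      BalTensor.smul_tmul_left]

theorem counitTensor_right (a : Aᵐᵒᵖ)
    (t : BalTensor k B (Ind k H A B (CoinvMod k H M)) (Ind k H B A (CoinvMod k H N))) :
    counitTensor (k := k) (H := H) (M := M) (N := N) (a • t) = a • counitTensor t := by
  induction t using BalTensor.induction with
  | h0 => simp only [map_zero, smul_zero]
  | ha x y hx hy => simp only [map_add, smul_add, hx, hy]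
  | ht m n =>
    rw [BalTensor.smul_tmul_right, counitTensor_tmul, counitTensor_tmul, Ind.counit_right,
      BalTensor.smul_tmul_right]

theorem counitTensor_unitTensorAux
    (t : BalTensor k (CoinvRing k H B) (Restr k H A B (CoinvMod k H M))
      (Restr k H B A (CoinvMod k H N))) :
    counitTensor (unitTensorAux k H A B (CoinvMod k H M) A (CoinvMod k H N) t) =
      coinvTensor k H A B M N t := by
  induction t using BalTensor.induction with
  | h0 => simp only [map_zero]
  | ha x y hx hy => simp only [map_add, hx, hy]
  | ht m n =>
    obtain ⟨m, rfl⟩ := (Restr.of k H A B _).surjective m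
    obtain ⟨n, rfl⟩ := (Restr.of k H B A _).surjective n
    rw [unitTensorAux_tmul, coinvTensor_tmul, counitTensor_tmul, Ind.counit_unit, Ind.counit_unit]

theorem coinvPairing_isCotensorLinear (α : BimodHom k A A (BalTensor k B M N) A)
    (hα : ∀ t, coact k H A (α t) = α.toLinearMap.rTensor H (coact k H _ t)) :
    IsCotensorLinear (coinvPairing α hα).toLinearMap := by
  intro x t t' h
  have hinj : Function.Injective (CoinvRing.val k H A) := Subtype.val_injective
  apply hinj
  rw [val_smul_coinvRing]
  change α (coinvTensor k H A B M N t') =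
    envAct k A A A (CotensorRing.val k H A A x) (α (coinvTensor k H A B M N t))
  have h' : unitTensorAux k H A B (CoinvMod k H M) A (CoinvMod k H N) t' =
      envAct k A A _ (CotensorRing.val k H A A x)
        (unitTensorAux k H A B (CoinvMod k H M) A (CoinvMod k H N) t) := by
    rw [← val_unitTensor, ← val_unitTensor, h, val_smul_coinv]
  rw [← counitTensor_unitTensorAux, ← counitTensor_unitTensorAux, h',
    HopfBimodHom.map_envAct counitTensor counitTensor_left counitTensor_right]
  exact HopfBimodHom.map_envAct α.toLinearMap α.map_left α.map_right _ _

end Aux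

section Functor

variable (k : Type v) [CommRing k] (H A B : Type u) [Ring H] [HopfAlgebra k H]
  [HasBijectiveAntipode k H]
  [Ring A] [Algebra k A] [ComoduleAlgebra k H A]
  [Ring B] [Algebra k B] [ComoduleAlgebra k H B]

variable {k H A B} in
/-- The `□_H`-Morita context `(A^{co H}, B^{co H}, M^{co H}, N^{co H}, α^{co H}, β^{co H})` of coinvariants
of an `H`-Morita context. -/
noncomputable def HMoritaContext.coinvariants (X : HMoritaContext k H A B) :
    CotensorMoritaContext k H A B where
  M := CoinvMod k H X.M
  N := CoinvMod k H X.N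
  ctx :=
    { α := coinvPairing X.ctx.α X.α_colinear
      β := coinvPairing X.ctx.β X.β_colinear
      α_smul := fun m n m' => by
        obtain ⟨m, rfl⟩ := (Restr.of k H A B _).surjective m
        obtain ⟨m', rfl⟩ := (Restr.of k H A B _).surjective m'
        obtain ⟨n, rfl⟩ := (Restr.of k H B A _).surjective n
        rw [Restr.smul_left_def, Restr.smul_right_def]
        refine congrArg (Restr.of k H A B _) (CoinvMod.val_injective ?_)
        rw [val_restr_left, val_restr_right, unop_op, val_coinvPairing, val_coinvPairing,
          coinvTensor_tmul, coinvTensor_tmul]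
        exact X.ctx.α_smul _ _ _
      β_smul := fun n m n' => by
        obtain ⟨m, rfl⟩ := (Restr.of k H A B _).surjective m
        obtain ⟨n', rfl⟩ := (Restr.of k H B A _).surjective n'
        obtain ⟨n, rfl⟩ := (Restr.of k H B A _).surjective n
        rw [Restr.smul_left_def, Restr.smul_right_def]
        refine congrArg (Restr.of k H B A _) (CoinvMod.val_injective ?_)
        rw [val_restr_left, val_restr_right, unop_op, val_coinvPairing, val_coinvPairing,
          coinvTensor_tmul, coinvTensor_tmul]
        exact X.ctx.β_smul _ _ _ }
  α_linear := coinvPairing_isCotensorLinear X.ctx.α X.α_colinear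
  β_linear := coinvPairing_isCotensorLinear X.ctx.β X.β_colinear

theorem HMoritaContext.val_coinvariants_pairα (X : HMoritaContext k H A B)
    (m : CoinvMod k H X.M) (n : CoinvMod k H X.N) :
    CoinvRing.val k H A (X.coinvariants.pairα m n) =
      X.ctx.α (.tmul k B (CoinvMod.val k H X.M m) (CoinvMod.val k H X.N n)) := by
  refine (val_coinvPairing X.ctx.α X.α_colinear _).trans ?_
  exact congrArg X.ctx.α (coinvTensor_tmul m n)

theorem HMoritaContext.val_coinvariants_pairβ (X : HMoritaContext k H A B)
    (n : CoinvMod k H X.N) (m : CoinvMod k H X.M) :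
    CoinvRing.val k H B (X.coinvariants.pairβ n m) =
      X.ctx.β (.tmul k A (CoinvMod.val k H X.N n) (CoinvMod.val k H X.M m)) := by
  refine (val_coinvPairing X.ctx.β X.β_colinear _).trans ?_
  exact congrArg X.ctx.β (coinvTensor_tmul n m)

/-- The functor `(A, B, M, N, α, β) ↦ (A^{co H}, B^{co H}, M^{co H}, N^{co H}, α^{co H}, β^{co H})`. -/
noncomputable def coinvFunctor : HMoritaContext k H A B ⥤ CotensorMoritaContext k H A B where
  obj X := X.coinvariants
  map {X Y} f :=
    { μ := f.μ.coinvMap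
      ν := f.ν.coinvMap
      α_comp := fun m n => by
        have hinj : Function.Injective (CoinvRing.val k H A) := Subtype.val_injective
        apply hinj
        refine (HMoritaContext.val_coinvariants_pairα k H A B Y _ _).trans ?_
        refine Eq.trans ?_ (HMoritaContext.val_coinvariants_pairα k H A B X _ _).symm
        exact f.α_comp _ _
      β_comp := fun n m => by
        have hinj : Function.Injective (CoinvRing.val k H B) := Subtype.val_injective
        apply hinj
        refine (HMoritaContext.val_coinvariants_pairβ k H A B Y _ _).trans ?_
        refine Eq.trans ?_ (HMoritaContext.val_coinvariants_pairβ k H A B X _ _).symm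
        exact f.β_comp _ _ }
  map_id _ := rfl
  map_comp _ _ := rfl

/-- `P` is the induction functor, up to natural isomorphism: it sends a `□_H`-Morita context
`Y = (A^{co H}, B^{co H}, M₁, N₁, α₁, β₁)` to the `H`-Morita context with bimodules
`F(M₁) = (A ⊗ B^op) ⊗_{A □_H B^op} M₁` and `F(N₁) = (B ⊗ A^op) ⊗_{B □_H A^op} N₁` (through the
isomorphisms `i Y` in `_A M_B^H` and `j Y` in `_B M_A^H`, natural in `Y`), and with the connecting maps
determined by `(1 ⊗ m) ⊗ (1 ⊗ n) ↦ α₁(m ⊗ n)` and `(1 ⊗ n) ⊗ (1 ⊗ m) ↦ β₁(n ⊗ m)`. For right faithfully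
flat `H`-Galois extensions, the elements `(1 ⊗ m) ⊗ (1 ⊗ n)` generate the left `A`-module
`F(M₁) ⊗_B F(N₁)`, so these values determine the connecting maps. -/
def IsInduction (P : CotensorMoritaContext k H A B ⥤ HMoritaContext k H A B) : Prop :=
  ∃ (i : ∀ Y : CotensorMoritaContext k H A B, HopfBimodHom k H A B (Ind k H A B Y.M) (P.obj Y).M)
    (j : ∀ Y : CotensorMoritaContext k H A B, HopfBimodHom k H B A (Ind k H B A Y.N) (P.obj Y).N),
    (∀ Y, Function.Bijective (i Y)) ∧ (∀ Y, Function.Bijective (j Y)) ∧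
    (∀ (Y Y' : CotensorMoritaContext k H A B) (f : Y ⟶ Y') (y : EnvBimod k A B) (m : Y.M),
      (P.map f).μ (i Y (Ind.mk k H A B Y.M y m)) = i Y' (Ind.mk k H A B Y'.M y (f.μ m))) ∧
    (∀ (Y Y' : CotensorMoritaContext k H A B) (f : Y ⟶ Y') (y : EnvBimod k B A) (n : Y.N),
      (P.map f).ν (j Y (Ind.mk k H B A Y.N y n)) = j Y' (Ind.mk k H B A Y'.N y (f.ν n))) ∧
    (∀ (Y : CotensorMoritaContext k H A B) (m : Y.M) (n : Y.N),
      (P.obj Y).ctx.α (.tmul k B (i Y (Ind.unit k H A B m)) (j Y (Ind.unit k H B A n))) =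
        CoinvRing.val k H A (Y.pairα m n)) ∧
    (∀ (Y : CotensorMoritaContext k H A B) (n : Y.N) (m : Y.M),
      (P.obj Y).ctx.β (.tmul k A (j Y (Ind.unit k H B A n)) (i Y (Ind.unit k H A B m))) =
        CoinvRing.val k H B (Y.pairβ n m))

end Functor

end CoinvFunctor

end HopfMorita

/-!
Write `R = A^{co H}`, `R' = B^{co H}` and `T = A □_H B^op`. Everything rests on the structure theorem for
one-sided relative Hopf modules (`actMap_bijective`): for `M` in `_A M^H` the map
`A ⊗_R M^{co H} → M` is bijective. Since `A` is flat over `R`, `A ⊗_R M^{co H}` is the kernel of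
`A ⊗ (ρ - (- ⊗ 1))` on `A ⊗_R M`; the Galois condition turns `A ⊗_R M` into `M ⊗ H`
(`galoisMap_bijective`), and bijectivity of the antipode identifies this kernel with the image of `ρ`.
No flatness of `H` over `k` is needed, because the flatness of `A` over `R` is applied only to
`A`-modules. Conversely, by faithfulness, a left `R`-module `V` of coinvariants with `A ⊗_R V ≅ M` is
all of `M^{co H}` (`bijective_coinv_of_actMap_bijective`).

The coinvariants of `A ⊗ B^op` are `T`, so the structure theorem gives `A ⊗_R T ≅ A ⊗ B^op`, and hence
`A ⊗_R M₁ ≅ F(M₁)` for every left `T`-module `M₁` (`actMap_unitLinear_bijective`). Thus the one-sided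
theorem makes the unit `M₁ → F(M₁)^{co H}` and the counit `F(M^{co H}) → M` bijective
(`Ind.unitHom_bijective`, `Ind.counitHom_bijective`), and every `T`-linear map between coinvariants
extends to a morphism in `_A M_B^H` (`extendCoinv`).

For Morita contexts one compares tensor products: if `A ⊗_R V ≅ M` and `B ⊗_{R'} W ≅ N`, then
`A ⊗_R (V ⊗_{R'} W) ≅ M ⊗_B N` (`actMap_tensorLinear_bijective`). So `F(M₁) ⊗_B F(N₁)` has coinvariants
`M₁ ⊗_{R'} N₁`, the connecting maps extend (`inducedPairing`), and every identity between maps on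
`F(M₁) ⊗_B F(N₁)` can be checked on the elements `(1 ⊗ m) ⊗ (1 ⊗ n)` (`eq_of_unit_tmul_unit`,
`pairing_smul_of_unit`). Strictness is transferred in both directions by the same identifications.
-/

namespace HopfMorita

/-! ### The inverse antipode and the coinvariants of `A ⊗ B^op` -/

section Antipode

variable (k : Type*) [CommRing k] (H : Type*) [Ring H] [HopfAlgebra k H]

/-- The map `g ⊗ h ↦ h₍₁₎ g ⊗ h₍₂₎`. -/
noncomputable def comulMulLeft : H ⊗[k] H →ₗ[k] H ⊗[k] H :=
  TensorProduct.lift (((LinearMap.mul k (H ⊗[k] H)).compl₁₂ (Coalgebra.comul (R := k) (A := H))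
    ((TensorProduct.mk k H H).flip 1)).flip)

theorem comulMulLeft_tmul (g h : H) : comulMulLeft k H (g ⊗ₜ h) =
    Coalgebra.comul (R := k) h * g ⊗ₜ 1 := by
  simp [comulMulLeft]

variable [HasBijectiveAntipode k H]

variable {k H} in
/-- `h₍₂₎ S⁻¹(h₍₁₎) = ε(h)`. -/
theorem comul_antipodeInv (h : H) :
    LinearMap.mul' k H (TensorProduct.map LinearMap.id (antipodeInv k H)
      (TensorProduct.comm k H H (Coalgebra.comul (R := k) h))) =
      algebraMap k H (Coalgebra.counit (R := k) h) := by
  apply (HasBijectiveAntipode.bijective (k := k) (H := H)).1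
  have key : ∀ x : H ⊗[k] H, HopfAlgebra.antipode k (LinearMap.mul' k H
      (TensorProduct.map LinearMap.id (antipodeInv k H) (TensorProduct.comm k H H x))) =
      LinearMap.mul' k H ((HopfAlgebra.antipode k).lTensor H x) := by
    intro x
    induction x with
    | zero => simp
    | add x y hx hy => simp only [map_add, hx, hy]
    | tmul g h =>
      simp only [TensorProduct.comm_tmul, TensorProduct.map_tmul, LinearMap.mul'_apply,
        LinearMap.lTensor_tmul, HopfAlgebra.antipode_mul_antidistrib, antipode_antipodeInv,
        LinearMap.id_apply]
  rw [key, HopfAlgebra.mul_antipode_lTensor_comul_apply, Algebra.algebraMap_eq_smul_one, map_smul,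
    HopfAlgebra.antipode_one]

/-- The map `g ⊗ h ↦ S⁻¹(h₍₁₎) g ⊗ h₍₂₎` is a left inverse of `g ⊗ h ↦ h₍₁₎ g ⊗ h₍₂₎`. -/
theorem exists_leftInverse_comulMulLeft :
    ∃ η : H ⊗[k] H →ₗ[k] H ⊗[k] H, η ∘ₗ comulMulLeft k H = LinearMap.id := by
  let S : H ⊗[k] H →ₗ[k] H ⊗[k] H := (antipodeInv k H).rTensor H
  let η : H ⊗[k] H →ₗ[k] H ⊗[k] H :=
    TensorProduct.lift (((LinearMap.mul k (H ⊗[k] H)).compl₁₂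
      (S ∘ₗ Coalgebra.comul (R := k) (A := H)) ((TensorProduct.mk k H H).flip 1)).flip)
  have hη : ∀ g h : H, η (g ⊗ₜ h) = S (Coalgebra.comul (R := k) h) * g ⊗ₜ 1 := by
    intro g h
    simp [η]
  -- `θ (a ⊗ b ⊗ c) = S⁻¹(b) a ⊗ c`
  let θ : H ⊗[k] (H ⊗[k] H) →ₗ[k] H ⊗[k] H :=
    TensorProduct.lift (((LinearMap.mul k (H ⊗[k] H)).compl₁₂ S
      ((TensorProduct.mk k H H).flip 1)).flip)
  have hθ : ∀ (a : H) (x : H ⊗[k] H), θ (a ⊗ₜ x) = S x * a ⊗ₜ 1 := by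
    intro a x
    simp [θ]
  have h₁ : ∀ (x : H ⊗[k] H) (g : H), η (x * g ⊗ₜ 1) =
      θ ((Coalgebra.comul (R := k) (A := H)).lTensor H x) * g ⊗ₜ 1 := by
    intro x g
    induction x with
    | zero => simp
    | add x y hx hy => simp only [add_mul, map_add, hx, hy]
    | tmul a b =>
      rw [Algebra.TensorProduct.tmul_mul_tmul, mul_one, hη, LinearMap.lTensor_tmul, hθ, mul_assoc,
        Algebra.TensorProduct.tmul_mul_tmul, mul_one]
  have h₂ : ∀ x : (H ⊗[k] H) ⊗[k] H, θ (TensorProduct.assoc k H H H x) =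
      (LinearMap.mul' k H ∘ₗ TensorProduct.map (antipodeInv k H) LinearMap.id ∘ₗ
        (TensorProduct.comm k H H).toLinearMap).rTensor H x := by
    intro x
    induction x with
    | zero => simp
    | add x y hx hy => simp only [map_add, hx, hy]
    | tmul z c =>
      induction z with
      | zero => simp
      | add x y hx hy => simp only [TensorProduct.add_tmul, map_add, hx, hy]
      | tmul a b => simp [hθ, S]
  have h₃ : LinearMap.mul' k H ∘ₗ TensorProduct.map (antipodeInv k H) LinearMap.id ∘ₗ
      (TensorProduct.comm k H H).toLinearMap ∘ₗ Coalgebra.comul (R := k) (A := H) =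
      Algebra.linearMap k H ∘ₗ Coalgebra.counit (R := k) (A := H) := by
    ext h
    exact antipodeInv_comul h
  refine ⟨η, TensorProduct.ext' fun g h => ?_⟩
  rw [LinearMap.comp_apply, comulMulLeft_tmul, h₁, ← Coalgebra.coassoc_apply, h₂,
    ← LinearMap.comp_apply, ← LinearMap.rTensor_comp, LinearMap.comp_assoc, LinearMap.comp_assoc,
    h₃, LinearMap.rTensor_comp, LinearMap.comp_apply, Coalgebra.rTensor_counit_comul]
  simp

variable {k H}
variable {A B : Type*} [Ring A] [Algebra k A] [ComoduleAlgebra k H A]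
  [Ring B] [Algebra k B] [ComoduleAlgebra k H B]

/-- Coinvariant elements of `A ⊗ B^op` lie in `A □_H B^op`. -/
theorem mem_cotensorAlg_of_envCoact (x : A ⊗[k] Bᵐᵒᵖ) (hx : envCoact k H A B x = x ⊗ₜ 1) :
    x ∈ cotensorAlg k H A B := by
  -- `Φ ((a ⊗ b) ⊗ h) = a ⊗ (h S⁻¹(b₍₁₎) ⊗ b₍₀₎)`
  let Ψ : Bᵐᵒᵖ ⊗[k] H →ₗ[k] H ⊗[k] Bᵐᵒᵖ :=
    TensorProduct.lift ((((LinearMap.mul k (H ⊗[k] Bᵐᵒᵖ)).compl₁₂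
      ((TensorProduct.mk k H Bᵐᵒᵖ).flip 1) (opLeftCoact k H B)).flip))
  have hΨ : ∀ (b : Bᵐᵒᵖ) (h : H), Ψ (b ⊗ₜ h) = h ⊗ₜ 1 * opLeftCoact k H B b := by
    intro b h
    simp [Ψ]
  let Φ : (A ⊗[k] Bᵐᵒᵖ) ⊗[k] H →ₗ[k] A ⊗[k] (H ⊗[k] Bᵐᵒᵖ) :=
    Ψ.lTensor A ∘ₗ (TensorProduct.assoc k A Bᵐᵒᵖ H).toLinearMap
  have h₁ : ∀ y : A ⊗[k] Bᵐᵒᵖ, Φ (y ⊗ₜ 1) = (opLeftCoact k H B).lTensor A y := by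
    intro y
    induction y with
    | zero => simp
    | add x y hx hy => simp only [TensorProduct.add_tmul, map_add, hx, hy]
    | tmul a b =>
      simp only [Φ, LinearMap.comp_apply, LinearEquiv.coe_coe, TensorProduct.assoc_tmul,
        LinearMap.lTensor_tmul, hΨ, ← Algebra.TensorProduct.one_def, one_mul]
  -- `b₍₁₎ S⁻¹(b₍₀₎₍₁₎) ⊗ b₍₀₎₍₀₎ = 1 ⊗ b`
  have h₂ : ∀ b : Bᵐᵒᵖ, Ψ (coact k H Bᵐᵒᵖ b) = 1 ⊗ₜ b := by
    let μ : H ⊗[k] H →ₗ[k] H := LinearMap.mul' k H ∘ₗ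
      TensorProduct.map LinearMap.id (antipodeInv k H) ∘ₗ (TensorProduct.comm k H H).toLinearMap
    let T : B ⊗[k] (H ⊗[k] H) →ₗ[k] H ⊗[k] Bᵐᵒᵖ := (TensorProduct.comm k Bᵐᵒᵖ H).toLinearMap ∘ₗ
      TensorProduct.map (opLinearEquiv k : B ≃ₗ[k] Bᵐᵒᵖ).toLinearMap μ
    have e₁ : ∀ z : B ⊗[k] H, Ψ ((opLinearEquiv k : B ≃ₗ[k] Bᵐᵒᵖ).toLinearMap.rTensor H z) =
        T (TensorProduct.assoc k B H H ((coact k H B).rTensor H z)) := by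
      intro z
      induction z with
      | zero => simp
      | add x y hx hy => simp only [map_add, hx, hy]
      | tmul b h =>
        simp only [LinearMap.rTensor_tmul, hΨ, opLeftCoact, LinearMap.comp_apply,
          LinearEquiv.coe_coe, coe_opLinearEquiv, coe_opLinearEquiv_symm, unop_op]
        generalize coact k H B b = w
        induction w with
        | zero => simp
        | add x y hx hy => simp only [map_add, TensorProduct.add_tmul, mul_add, hx, hy]
        | tmul c g => simp [T, μ]
    have e₂ : ∀ z : B ⊗[k] H, T ((Coalgebra.comul (R := k) (A := H)).lTensor B z) =
        1 ⊗ₜ (opLinearEquiv k (TensorProduct.rid k B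
          ((Coalgebra.counit (R := k) (A := H)).lTensor B z)) : Bᵐᵒᵖ) := by
      intro z
      induction z with
      | zero => simp
      | add x y hx hy => simp only [map_add, TensorProduct.tmul_add, hx, hy]
      | tmul c g =>
        have h : μ (Coalgebra.comul (R := k) g) =
          algebraMap k H (Coalgebra.counit (R := k) g) := comul_antipodeInv g
        simp [T, h, Algebra.algebraMap_eq_smul_one]
    intro b
    rw [coact_op, e₁, RightComodule.coassoc, e₂, RightComodule.counit]
    simp
  have h₃ : ∀ (p : A) (g : H) (z : Bᵐᵒᵖ ⊗[k] H),
      Φ (diagMul H (TensorProduct.mk k A Bᵐᵒᵖ) (p ⊗ₜ g) z) = p ⊗ₜ (g ⊗ₜ 1 * Ψ z) := by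
    intro p g z
    induction z with
    | zero => simp
    | add x y hx hy => simp only [map_add, mul_add, TensorProduct.tmul_add, hx, hy]
    | tmul b h =>
      rw [diagMul_tmul, TensorProduct.mk_apply, hΨ, ← mul_assoc,
        Algebra.TensorProduct.tmul_mul_tmul, one_mul, ← hΨ]
      rfl
  have h₄ : ∀ (y : A ⊗[k] H) (b : Bᵐᵒᵖ),
      Φ (diagMul H (TensorProduct.mk k A Bᵐᵒᵖ) y (coact k H Bᵐᵒᵖ b)) =
        TensorProduct.assoc k A H Bᵐᵒᵖ (y ⊗ₜ b) := by
    intro y b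
    induction y with
    | zero => simp
    | add x y hx hy => simp only [map_add, LinearMap.add_apply, TensorProduct.add_tmul, hx, hy]
    | tmul p g =>
      rw [h₃, h₂, Algebra.TensorProduct.tmul_mul_tmul, mul_one, one_mul, TensorProduct.assoc_tmul]
  have h₅ : ∀ y : A ⊗[k] Bᵐᵒᵖ, Φ (envCoact k H A B y) =
      TensorProduct.assoc k A H Bᵐᵒᵖ ((coact k H A).rTensor Bᵐᵒᵖ y) := by
    intro y
    induction y with
    | zero => simp
    | add x y hx hy => simp only [map_add, hx, hy]
    | tmul a b => rw [envCoact_tmul, h₄, LinearMap.rTensor_tmul]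
  rw [mem_cotensorAlg, ← h₅, hx, h₁]

end Antipode

/-! ### Consequences of faithful flatness -/

section Flatness

variable {k : Type v} [CommRing k] {R P : Type u} [Ring R] [Algebra k R]
  [AddCommGroup P] [Module k P] [Module Rᵐᵒᵖ P]

theorem BalTensor.lTensor_tmul {k R P N N' : Type*} [CommRing k] [Ring R] [Algebra k R]
    [AddCommGroup P] [Module k P] [Module Rᵐᵒᵖ P]
    [AddCommGroup N] [Module k N] [Module R N] [IsScalarTower k R N]
    [AddCommGroup N'] [Module k N'] [Module R N'] [IsScalarTower k R N'] (f : N →ₗ[R] N')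
    (p : P) (n : N) : lTensor k R P f (tmul k R p n) = tmul k R p (f n) :=
  map_tmul _ _ _ _ p n

theorem BalTensor.lTensor_eq_zero {k R P N N' : Type*} [CommRing k] [Ring R] [Algebra k R]
    [AddCommGroup P] [Module k P] [Module Rᵐᵒᵖ P]
    [AddCommGroup N] [Module k N] [Module R N] [IsScalarTower k R N]
    [AddCommGroup N'] [Module k N'] [Module R N'] [IsScalarTower k R N'] (f : N →ₗ[R] N')
    (hf : ∀ n, f n = 0) (x : BalTensor k R P N) : lTensor k R P f x = 0 := by
  induction x using BalTensor.induction with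
  | h0 => simp
  | ha x y hx hy => rw [map_add, hx, hy, add_zero]
  | ht p n => rw [lTensor_tmul, hf]; exact map_zero _

variable {N N' : Type u} [AddCommGroup N] [Module k N] [Module R N] [IsScalarTower k R N]
    [AddCommGroup N'] [Module k N'] [Module R N'] [IsScalarTower k R N']

theorem exact_zero_left_iff {X Y Z : Type*} [AddCommGroup X] [AddCommGroup Y] [AddCommGroup Z]
    (f : X →+ Y) (g : Y →+ Z) (hf : ∀ x, f x = 0) :
    Function.Exact f g ↔ Function.Injective g := by
  rw [injective_iff_map_eq_zero]
  constructor
  · intro h y hy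
    obtain ⟨x, rfl⟩ := (h y).1 hy
    exact hf x
  · intro h y
    refine ⟨fun hy => ⟨0, by rw [map_zero, h y hy]⟩, ?_⟩
    rintro ⟨x, rfl⟩
    rw [hf, map_zero]

theorem exact_zero_right_iff {X Y Z : Type*} [AddCommGroup X] [AddCommGroup Y] [AddCommGroup Z]
    (f : X →+ Y) (g : Y →+ Z) (hg : ∀ y, g y = 0) :
    Function.Exact f g ↔ Function.Surjective f :=
  ⟨fun h y => (h y).1 (hg y), fun h y => ⟨fun _ => h y, fun _ => hg y⟩⟩

theorem IsRightFaithfullyFlat.injective_iff (h : IsRightFaithfullyFlat k R P) (f : N →ₗ[R] N') :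
    Function.Injective (BalTensor.lTensor k R P f) ↔ Function.Injective f := by
  have e := h PUnit.{u + 1} N N' (0 : PUnit.{u + 1} →ₗ[R] N) f
  exact (exact_zero_left_iff
      (BalTensor.lTensor k R P (0 : PUnit.{u + 1} →ₗ[R] N)).toAddMonoidHom
      (BalTensor.lTensor k R P f).toAddMonoidHom
      (BalTensor.lTensor_eq_zero _ fun _ => rfl)).symm.trans
    (e.trans (exact_zero_left_iff (0 : PUnit.{u + 1} →ₗ[R] N).toAddMonoidHom f.toAddMonoidHom
      (fun _ => rfl)))

theorem IsRightFaithfullyFlat.surjective_iff (h : IsRightFaithfullyFlat k R P) (f : N →ₗ[R] N') :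
    Function.Surjective (BalTensor.lTensor k R P f) ↔ Function.Surjective f := by
  have e := h N N' PUnit.{u + 1} f (0 : N' →ₗ[R] PUnit.{u + 1})
  exact (exact_zero_right_iff (BalTensor.lTensor k R P f).toAddMonoidHom
      (BalTensor.lTensor k R P (0 : N' →ₗ[R] PUnit.{u + 1})).toAddMonoidHom
      (BalTensor.lTensor_eq_zero _ fun _ => rfl)).symm.trans
    (e.trans (exact_zero_right_iff f.toAddMonoidHom
      (0 : N' →ₗ[R] PUnit.{u + 1}).toAddMonoidHom (fun _ => rfl)))

theorem IsRightFaithfullyFlat.bijective_iff (h : IsRightFaithfullyFlat k R P) (f : N →ₗ[R] N') :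
    Function.Bijective (BalTensor.lTensor k R P f) ↔ Function.Bijective f :=
  and_congr (h.injective_iff f) (h.surjective_iff f)

end Flatness

/-! ### The structure theorem for one-sided relative Hopf modules -/

section OneSided

/-- A left `A`-module viewed as a left `A^{co H}`-module by restriction of scalars (the underlying
type is `M`). -/
@[nolint unusedArguments]
def ResLeft (_k _H _A M : Type*) : Type _ := M

variable (k : Type v) [CommRing k] (H A M : Type u) [Ring H] [HopfAlgebra k H]
  [Ring A] [Algebra k A] [ComoduleAlgebra k H A]
  [AddCommGroup M] [Module k M] [Module A M] [IsScalarTower k A M]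

namespace ResLeft

instance : AddCommGroup (ResLeft k H A M) := inferInstanceAs (AddCommGroup M)

instance : Module k (ResLeft k H A M) := inferInstanceAs (Module k M)

/-- The identity map `M → M`. -/
def of : M ≃ₗ[k] ResLeft k H A M := LinearEquiv.refl k M

instance instModuleCoinvRing : Module (CoinvRing k H A) (ResLeft k H A M) :=
  Module.compHom M (CoinvRing.val k H A).toRingHom

variable {k H A M}

theorem smul_of (r : CoinvRing k H A) (m : M) :
    r • of k H A M m = of k H A M (CoinvRing.val k H A r • m) := rfl

instance : IsScalarTower k (CoinvRing k H A) (ResLeft k H A M) where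
  smul_assoc c r m := by
    obtain ⟨m, rfl⟩ := (of k H A M).surjective m
    rw [smul_of, smul_of, map_smul (CoinvRing.val k H A), smul_assoc, map_smul (of k H A M)]

end ResLeft

variable {k H A M}

theorem op_smul_val (r : CoinvRing k H A) (a : A) : op r • a = a * CoinvRing.val k H A r := rfl

variable {V : Type u} [AddCommGroup V] [Module k V] [Module (CoinvRing k H A) V]
  [IsScalarTower k (CoinvRing k H A) V]

/-- The map `A ⊗_{A^{co H}} V → M`, `a ⊗ v ↦ a g(v)`, induced by an `A^{co H}`-linear map
`g : V → M` to an `A`-module. -/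
noncomputable def actMap (g : V →ₗ[CoinvRing k H A] ResLeft k H A M) :
    BalTensor k (CoinvRing k H A) A V →ₗ[k] M :=
  BalTensor.lift ((lact k A M).compl₂ ((ResLeft.of k H A M).symm.toLinearMap ∘ₗ
    g.restrictScalars k)) (by
    intro r a v
    simp only [LinearMap.compl₂_apply, LinearMap.comp_apply, LinearMap.restrictScalars_apply,
      lact_apply, map_smul, op_smul_val, mul_smul]
    rfl)

theorem actMap_tmul (g : V →ₗ[CoinvRing k H A] ResLeft k H A M) (a : A) (v : V) :
    actMap g (.tmul k _ a v) = a • (ResLeft.of k H A M).symm (g v) :=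
  BalTensor.lift_tmul _ _ _ _

theorem actMap_lTensor {V' : Type u} [AddCommGroup V'] [Module k V'] [Module (CoinvRing k H A) V']
    [IsScalarTower k (CoinvRing k H A) V'] (g : V' →ₗ[CoinvRing k H A] ResLeft k H A M)
    (f : V →ₗ[CoinvRing k H A] V') (x : BalTensor k (CoinvRing k H A) A V) :
    actMap g (BalTensor.lTensor k _ A f x) = actMap (g ∘ₗ f) x := by
  induction x using BalTensor.induction with
  | h0 => simp only [map_zero]
  | ha x y hx hy => simp only [map_add, hx, hy]
  | ht a v => rw [BalTensor.lTensor_tmul, actMap_tmul, actMap_tmul]; rfl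

variable (k H A M) in
/-- The map `A ⊗_{A^{co H}} M → M ⊗ H`, `a ⊗ m ↦ a₍₀₎ m ⊗ a₍₁₎`, for a left `A`-module `M`. -/
noncomputable def galoisMap : BalTensor k (CoinvRing k H A) A (ResLeft k H A M) →ₗ[k] M ⊗[k] H :=
  BalTensor.lift ((diagMul H (lact k A M)).compl₁₂ (coact k H A)
    ((TensorProduct.mk k M H).flip 1 ∘ₗ (ResLeft.of k H A M).symm.toLinearMap)) (by
    intro r a m
    obtain ⟨m, rfl⟩ := (ResLeft.of k H A M).surjective m
    have h : coact k H A (a * CoinvRing.val k H A r) =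
        coact k H A a * coact k H A (CoinvRing.val k H A r) :=
      ComoduleAlgebra.coact_mul _ _
    rw [ResLeft.smul_of, op_smul_val]
    simp only [LinearMap.compl₁₂_apply, LinearMap.comp_apply, LinearMap.flip_apply,
      LinearEquiv.coe_coe, LinearEquiv.symm_apply_apply, h, TensorProduct.mk_apply]
    rw [CoinvRing.coact_val, ← diagMul_mul_eq, diagMul_assoc _ _ (lact k A M) (lact k A M),
      diagMul_tmul, lact_apply, one_mul]
    intro p q m
    exact mul_smul p q m)

theorem galoisMap_tmul (a : A) (m : M) :
    galoisMap k H A M (.tmul k _ a (ResLeft.of k H A M m)) =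
      diagMul H (lact k A M) (coact k H A a) (m ⊗ₜ 1) :=
  BalTensor.lift_tmul _ _ _ _

/-- The map `A ⊗_{A^{co H}} A → A ⊗_{A^{co H}} M`, `a ⊗ b ↦ a ⊗ b m`. -/
noncomputable def lTensorSMul (m : M) :
    BalTensor k (CoinvRing k H A) A A →ₗ[k] BalTensor k (CoinvRing k H A) A (ResLeft k H A M) :=
  BalTensor.map LinearMap.id (fun _ _ => rfl)
    ((ResLeft.of k H A M).toLinearMap ∘ₗ (lact k A M).flip m) (by
    intro r b
    exact congrArg (ResLeft.of k H A M) (mul_smul (CoinvRing.val k H A r) b m))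

theorem lTensorSMul_tmul (m : M) (a b : A) : lTensorSMul (k := k) (H := H) m (.tmul k _ a b) =
    .tmul k _ a (ResLeft.of k H A M (b • m)) :=
  BalTensor.map_tmul _ _ _ _ _ _

theorem lTensorSMul_add (m m' : M) (x : BalTensor k (CoinvRing k H A) A A) :
    lTensorSMul (k := k) (H := H) (m + m') x = lTensorSMul m x + lTensorSMul m' x := by
  induction x using BalTensor.induction with
  | h0 => simp only [map_zero, add_zero]
  | ha x y hx hy => simp only [map_add, hx, hy]; abel
  | ht a b => simp only [lTensorSMul_tmul, smul_add, map_add, BalTensor.tmul_add_right]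

theorem lTensorSMul_smul (c : k) (m : M) (x : BalTensor k (CoinvRing k H A) A A) :
    lTensorSMul (k := k) (H := H) (c • m) x = c • lTensorSMul m x := by
  induction x using BalTensor.induction with
  | h0 => simp only [map_zero, smul_zero]
  | ha x y hx hy => simp only [map_add, smul_add, hx, hy]
  | ht a b => simp only [lTensorSMul_tmul, smul_comm b c m, map_smul]; exact map_smul _ _ _

variable (k H) in
/-- The right action `a ⊗ b ↦ a ⊗ b c` of `c` on `A ⊗_{A^{co H}} A`. -/
noncomputable def tensorMulRight (c : A) :
    BalTensor k (CoinvRing k H A) A A →ₗ[k] BalTensor k (CoinvRing k H A) A A :=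
  BalTensor.map LinearMap.id (fun _ _ => rfl) ((LinearMap.mul k A).flip c)
    (fun r b => mul_assoc (CoinvRing.val k H A r) b c)

theorem tensorMulRight_tmul (c a b : A) :
    tensorMulRight k H c (.tmul k _ a b) = .tmul k _ a (b * c) :=
  BalTensor.map_tmul _ _ _ _ _ _

theorem canMap_tensorMulRight (c : A) (x : BalTensor k (CoinvRing k H A) A A) :
    canMap k H A (tensorMulRight k H c x) = canMap k H A x * c ⊗ₜ 1 := by
  induction x using BalTensor.induction with
  | h0 => simp only [map_zero, zero_mul]
  | ha x y hx hy => simp only [map_add, add_mul, hx, hy]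
  | ht a b =>
    rw [tensorMulRight_tmul, canMap_tmul, canMap_tmul, mul_assoc,
      Algebra.TensorProduct.tmul_mul_tmul, mul_one]

theorem lTensorSMul_tensorMulRight (c : A) (m : M) (x : BalTensor k (CoinvRing k H A) A A) :
    lTensorSMul (k := k) (H := H) m (tensorMulRight k H c x) = lTensorSMul (c • m) x := by
  induction x using BalTensor.induction with
  | h0 => simp only [map_zero]
  | ha x y hx hy => simp only [map_add, hx, hy]
  | ht a b => rw [tensorMulRight_tmul, lTensorSMul_tmul, lTensorSMul_tmul, mul_smul]

theorem galoisMap_lTensorSMul (m : M) (x : BalTensor k (CoinvRing k H A) A A) :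
    galoisMap k H A M (lTensorSMul m x) =
      diagMul H (lact k A M) (canMap k H A x) (m ⊗ₜ 1) := by
  induction x using BalTensor.induction with
  | h0 => simp only [map_zero, LinearMap.zero_apply]
  | ha x y hx hy => simp only [map_add, LinearMap.add_apply, hx, hy]
  | ht a b =>
    rw [lTensorSMul_tmul, galoisMap_tmul, canMap_tmul, ← diagMul_mul_eq,
      diagMul_assoc _ _ (lact k A M) (lact k A M), diagMul_tmul, lact_apply, one_mul]
    intro p q m
    exact mul_smul p q m

/-- `a ⊗ m ↦ a₍₀₎ m ⊗ a₍₁₎` is bijective for an `H`-Galois extension: up to the identification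
`A ⊗ H ⊗_A M = M ⊗ H` it is `can ⊗_A M`. -/
theorem galoisMap_bijective (hcan : Function.Bijective (canMap k H A)) :
    Function.Bijective (galoisMap k H A M) := by
  let e := LinearEquiv.ofBijective (canMap k H A) hcan
  have he : ∀ z, canMap k H A (e.symm z) = z := e.apply_symm_apply
  let ψ : M ⊗[k] H →ₗ[k] BalTensor k (CoinvRing k H A) A (ResLeft k H A M) :=
    TensorProduct.lift (LinearMap.mk₂ k (fun m h => lTensorSMul m (e.symm (1 ⊗ₜ h)))
      (fun m m' h => lTensorSMul_add m m' _) (fun c m h => lTensorSMul_smul c m _)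
      (fun m h h' => by simp only [TensorProduct.tmul_add, map_add])
      (fun c m h => by simp only [TensorProduct.tmul_smul, map_smul]))
  have hψ : ∀ m h, ψ (m ⊗ₜ h) = lTensorSMul m (e.symm (1 ⊗ₜ h)) := fun m h => by simp [ψ]
  have hr : ∀ y, galoisMap k H A M (ψ y) = y := by
    intro y
    induction y with
    | zero => simp only [map_zero]
    | add x y hx hy => simp only [map_add, hx, hy]
    | tmul m h =>
      rw [hψ, galoisMap_lTensorSMul, he, diagMul_tmul, lact_apply, one_smul, mul_one]
  have key : ∀ (m : M) (z : A ⊗[k] H),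
      ψ (diagMul H (lact k A M) z (m ⊗ₜ 1)) = lTensorSMul m (e.symm z) := by
    intro m z
    induction z with
    | zero => simp only [map_zero, LinearMap.zero_apply]
    | add x y hx hy => simp only [map_add, LinearMap.add_apply, hx, hy]
    | tmul p h =>
      rw [diagMul_tmul, lact_apply, mul_one, hψ, ← lTensorSMul_tensorMulRight]
      congr 1
      apply hcan.1
      rw [canMap_tensorMulRight, he, he, Algebra.TensorProduct.tmul_mul_tmul, one_mul, mul_one]
  have hl : ∀ x, ψ (galoisMap k H A M x) = x := by
    intro x
    induction x using BalTensor.induction with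
    | h0 => simp only [map_zero]
    | ha x y hx hy => simp only [map_add, hx, hy]
    | ht a m =>
      obtain ⟨m, rfl⟩ := (ResLeft.of k H A M).surjective m
      have h : e.symm (coact k H A a) = .tmul k _ a 1 := by
        apply hcan.1
        rw [he, canMap_tmul, ← Algebra.TensorProduct.one_def, mul_one]
      rw [galoisMap_tmul, key, h, lTensorSMul_tmul, one_smul]
  exact Function.bijective_iff_has_inverse.2 ⟨ψ, hl, hr⟩

end OneSided

section OneSided

variable {k : Type v} [CommRing k] {H A M : Type u} [Ring H] [HopfAlgebra k H]
  [Ring A] [Algebra k A] [ComoduleAlgebra k H A]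
  [AddCommGroup M] [Module k M] [Module A M] [IsScalarTower k A M]
  {V : Type u} [AddCommGroup V] [Module k V] [Module (CoinvRing k H A) V]
  [IsScalarTower k (CoinvRing k H A) V]

variable (k H M) in
/-- The map `(n ⊗ g) ⊗ h ↦ n ⊗ (h₍₁₎ g ⊗ h₍₂₎)`. It is injective, and it turns the two maps that
define coinvariants, transported along `galoisMap`, into `ρ ⊗ H` and `M ⊗ Δ`. -/
noncomputable def twistMap : (M ⊗[k] H) ⊗[k] H →ₗ[k] M ⊗[k] (H ⊗[k] H) :=
  (comulMulLeft k H).lTensor M ∘ₗ (TensorProduct.assoc k M H H).toLinearMap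

theorem twistMap_injective [HasBijectiveAntipode k H] : Function.Injective (twistMap k H M) := by
  obtain ⟨η, hη⟩ := exists_leftInverse_comulMulLeft k H
  refine Function.Injective.comp (g := (comulMulLeft k H).lTensor M) ?_
    (TensorProduct.assoc k M H H).injective
  refine Function.LeftInverse.injective (g := η.lTensor M) fun x => ?_
  rw [← LinearMap.comp_apply, ← LinearMap.lTensor_comp, hη, LinearMap.lTensor_id,
    LinearMap.id_apply]

theorem twistMap_galoisMap (a : A) (y : M ⊗[k] H) :
    twistMap k H M (galoisMap k H A (M ⊗[k] H) (.tmul k _ a (ResLeft.of k H A _ y))) =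
      diagMul (H ⊗[k] H) (lact k A M)
        ((Coalgebra.comul (R := k) (A := H)).lTensor A (coact k H A a))
        (TensorProduct.assoc k M H H (y ⊗ₜ 1)) := by
  rw [galoisMap_tmul]
  generalize coact k H A a = z
  induction z with
  | zero => simp
  | add x y hx hy => simp only [map_add, LinearMap.add_apply, hx, hy]
  | tmul p g =>
    rw [diagMul_tmul, LinearMap.lTensor_tmul, lact_apply, mul_one]
    induction y with
    | zero => simp
    | add x y hx hy => simp only [smul_add, map_add, TensorProduct.add_tmul, hx, hy]
    | tmul n l =>
      simp only [twistMap, LinearMap.comp_apply, LinearEquiv.coe_coe, TensorProduct.smul_tmul',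
        TensorProduct.assoc_tmul, LinearMap.lTensor_tmul, comulMulLeft_tmul, diagMul_tmul,
        lact_apply]

variable [RightComodule k H M]

theorem coact_injective : Function.Injective (coact k H M) := by
  intro m m' h
  rw [← RightComodule.counit (k := k) (H := H) m, ← RightComodule.counit (k := k) (H := H) m']
  exact congrArg _ (congrArg _ h)

variable [LeftHopfModule k H A M]

theorem coact_val_smul (r : CoinvRing k H A) (m : M) :
    coact k H M (CoinvRing.val k H A r • m) = CoinvRing.val k H A r • coact k H M m := by
  rw [LeftHopfModule.coact_smul, CoinvRing.coact_val, diagMul_tmul_one_left]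
  generalize coact k H M m = y
  induction y with
  | zero => simp
  | add x y hx hy => simp only [smul_add, map_add, hx, hy]
  | tmul n l => rfl

variable (k H A M) in
/-- The coaction as an `A^{co H}`-linear map. -/
noncomputable def coactLinear :
    ResLeft k H A M →ₗ[CoinvRing k H A] ResLeft k H A (M ⊗[k] H) where
  toFun m := ResLeft.of k H A _ (coact k H M ((ResLeft.of k H A M).symm m))
  map_add' m m' := by simp only [map_add]
  map_smul' r m := congrArg (ResLeft.of k H A _) (coact_val_smul r _)

variable (k H A M) in
/-- `m ↦ m ⊗ 1` as an `A^{co H}`-linear map. -/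
noncomputable def tmulOneLinear :
    ResLeft k H A M →ₗ[CoinvRing k H A] ResLeft k H A (M ⊗[k] H) where
  toFun m := ResLeft.of k H A _ ((ResLeft.of k H A M).symm m ⊗ₜ 1)
  map_add' m m' := by simp only [map_add, TensorProduct.add_tmul]
  map_smul' r m := rfl

theorem coact_eq_galoisMap (e : V →ₗ[CoinvRing k H A] ResLeft k H A M)
    (he : ∀ v, coact k H M ((ResLeft.of k H A M).symm (e v)) =
      (ResLeft.of k H A M).symm (e v) ⊗ₜ 1) (y : BalTensor k (CoinvRing k H A) A V) :
    coact k H M (actMap e y) = galoisMap k H A M (BalTensor.lTensor k _ A e y) := by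
  induction y using BalTensor.induction with
  | h0 => simp only [map_zero]
  | ha x y hx hy => simp only [map_add, hx, hy]
  | ht a v =>
    rw [actMap_tmul, LeftHopfModule.coact_smul, he, BalTensor.lTensor_tmul]
    exact (galoisMap_tmul a _).symm

/-- Under `A ⊗_{A^{co H}} M ≅ M ⊗ H`, the map `A ⊗ ρ` becomes `ρ ⊗ H`, after `twistMap`. -/
theorem twistMap_galoisMap_coactLinear (x : BalTensor k (CoinvRing k H A) A (ResLeft k H A M)) :
    twistMap k H M (galoisMap k H A _ (BalTensor.lTensor k _ A (coactLinear k H A M) x)) =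
      TensorProduct.assoc k M H H ((coact k H M).rTensor H (galoisMap k H A M x)) := by
  induction x using BalTensor.induction with
  | h0 => simp only [map_zero]
  | ha x y hx hy => simp only [map_add, hx, hy]
  | ht a m =>
    obtain ⟨m, rfl⟩ := (ResLeft.of k H A M).surjective m
    rw [BalTensor.lTensor_tmul, galoisMap_tmul,
      coassoc_diagMul (lact k A M) (coact k H A) (coact k H M) (coact k H M)
        LeftHopfModule.coact_smul, RightComodule.coassoc, LinearMap.rTensor_tmul]
    exact twistMap_galoisMap a _

/-- Under `A ⊗_{A^{co H}} M ≅ M ⊗ H`, the map `a ⊗ m ↦ a ⊗ (m ⊗ 1)` becomes `M ⊗ Δ`, after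
`twistMap`. -/
theorem twistMap_galoisMap_tmulOneLinear (x : BalTensor k (CoinvRing k H A) A (ResLeft k H A M)) :
    twistMap k H M (galoisMap k H A _ (BalTensor.lTensor k _ A (tmulOneLinear k H A M) x)) =
      (Coalgebra.comul (R := k) (A := H)).lTensor M (galoisMap k H A M x) := by
  induction x using BalTensor.induction with
  | h0 => simp only [map_zero]
  | ha x y hx hy => simp only [map_add, hx, hy]
  | ht a m =>
    obtain ⟨m, rfl⟩ := (ResLeft.of k H A M).surjective m
    rw [BalTensor.lTensor_tmul, galoisMap_tmul, comul_diagMul, LinearMap.lTensor_tmul,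
      Bialgebra.comul_one]
    exact twistMap_galoisMap a _

/-- Structure theorem for relative Hopf modules: for an `A^{co H}`-linear identification `e` of `V`
with the coinvariants of `M`, the map `A ⊗_{A^{co H}} V → M` is bijective. Flatness identifies
`A ⊗_{A^{co H}} V` with the kernel of `A ⊗ (ρ - (- ⊗ 1))`, and, under `A ⊗_{A^{co H}} M ≅ M ⊗ H`, this
kernel is the set of the `z` with `(ρ ⊗ H) z = (M ⊗ Δ) z`, that is, the image of `ρ`. -/
theorem actMap_bijective [HasBijectiveAntipode k H] (hA : IsRightFaithfullyFlatGalois k H A)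
    (e : V →ₗ[CoinvRing k H A] ResLeft k H A M) (hinj : Function.Injective e)
    (he : ∀ m, coact k H M ((ResLeft.of k H A M).symm m) = (ResLeft.of k H A M).symm m ⊗ₜ 1 ↔
      m ∈ Set.range e) : Function.Bijective (actMap e) := by
  have hφ := galoisMap_bijective (M := M) hA.bijective_can
  have hφ' := galoisMap_bijective (M := M ⊗[k] H) hA.bijective_can
  have he' := coact_eq_galoisMap e fun v => (he _).2 ⟨v, rfl⟩
  constructor
  · intro y y' h
    have h' := congrArg (coact k H M) h
    rw [he', he'] at h'
    exact (hA.faithfullyFlat.injective_iff e).2 hinj (hφ.1 h')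
  · intro m
    obtain ⟨x, hx⟩ := hφ.2 (coact k H M m)
    have hexact : Function.Exact e (coactLinear k H A M - tmulOneLinear k H A M) := fun m => by
      rw [LinearMap.sub_apply, sub_eq_zero, ← he]
      rfl
    have hx' : BalTensor.lTensor k _ A (coactLinear k H A M - tmulOneLinear k H A M) x = 0 := by
      have hsub : BalTensor.lTensor k _ A (coactLinear k H A M - tmulOneLinear k H A M) x =
          BalTensor.lTensor k _ A (coactLinear k H A M) x -
            BalTensor.lTensor k _ A (tmulOneLinear k H A M) x := by
        generalize x = x
        induction x using BalTensor.induction with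
        | h0 => simp only [map_zero, sub_zero]
        | ha x y hx hy => simp only [map_add, hx, hy]; abel
        | ht a v =>
          simp only [BalTensor.lTensor_tmul, LinearMap.sub_apply]
          exact map_sub (BalTensor.mk k (CoinvRing k H A) A (ResLeft k H A (M ⊗[k] H)) a) _ _
      rw [hsub, sub_eq_zero]
      apply hφ'.1
      apply twistMap_injective
      rw [twistMap_galoisMap_coactLinear, twistMap_galoisMap_tmulOneLinear, hx,
        RightComodule.coassoc]
    obtain ⟨y, hy⟩ := ((hA.faithfullyFlat _ _ _ _ _).2 hexact x).1 hx'
    refine ⟨y, coact_injective (k := k) (H := H) ?_⟩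
    rw [he', hy, hx]

variable (k H A M) in
/-- The coinvariants of a left relative Hopf module as an `A^{co H}`-submodule. -/
def coinvSubmodule : Submodule (CoinvRing k H A) (ResLeft k H A M) where
  carrier := {m | coact k H M ((ResLeft.of k H A M).symm m) =
    (ResLeft.of k H A M).symm m ⊗ₜ (1 : H)}
  add_mem' {a b} ha hb := (coinv k H M).add_mem ha hb
  zero_mem' := (coinv k H M).zero_mem
  smul_mem' r m hm := by
    change coact k H M (CoinvRing.val k H A r • (ResLeft.of k H A M).symm m) = _
    rw [coact_val_smul, hm]
    rfl

noncomputable instance : Module k (coinvSubmodule k H A M) :=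
  inferInstanceAs (Module k (coinv k H M))

instance : IsScalarTower k (CoinvRing k H A) (coinvSubmodule k H A M) where
  smul_assoc c r m := Subtype.ext (smul_assoc c r (m : ResLeft k H A M))

/-- If `V` maps to coinvariants of `M` and `A ⊗_{A^{co H}} V → M` is bijective, then `V` is the module of
coinvariants of `M`: after `A ⊗_{A^{co H}} -` the map `V → M^{co H}` becomes bijective by the structure
theorem, so it is bijective by faithful flatness. -/
theorem bijective_coinv_of_actMap_bijective [HasBijectiveAntipode k H]
    (hA : IsRightFaithfullyFlatGalois k H A)
    (g : V →ₗ[CoinvRing k H A] ResLeft k H A M)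
    (hg : ∀ v, coact k H M ((ResLeft.of k H A M).symm (g v)) =
      (ResLeft.of k H A M).symm (g v) ⊗ₜ 1) (hbij : Function.Bijective (actMap g)) :
    Function.Injective g ∧ ∀ m, coact k H M m = m ⊗ₜ 1 →
      ∃ v, (ResLeft.of k H A M).symm (g v) = m := by
  let e := (coinvSubmodule k H A M).subtype
  let g' : V →ₗ[CoinvRing k H A] coinvSubmodule k H A M := g.codRestrict _ hg
  have he : Function.Bijective (actMap e) := by
    refine actMap_bijective hA e Subtype.val_injective fun m => ?_
    exact ⟨fun h => ⟨⟨m, h⟩, rfl⟩, by rintro ⟨m, rfl⟩; exact m.2⟩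
  have hg' : Function.Bijective g' := by
    rw [← hA.faithfullyFlat.bijective_iff]
    refine (Function.Bijective.of_comp_iff' he _).1 ?_
    convert hbij using 1
    funext x
    exact actMap_lTensor e g' x
  constructor
  · intro v w h
    exact hg'.1 (Subtype.ext h)
  · intro m hm
    obtain ⟨v, hv⟩ := hg'.2 ⟨ResLeft.of k H A M m, hm⟩
    exact ⟨v, congrArg (fun x => (ResLeft.of k H A M).symm x.1) hv⟩

/-- `A`-linear maps that agree on generators agree. -/
theorem eq_of_comp_actMap {Q : Type*} [AddCommGroup Q] [Module k Q] [Module A Q]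
    (g : V →ₗ[CoinvRing k H A] ResLeft k H A M) (hg : Function.Surjective (actMap g))
    (f f' : M →ₗ[k] Q) (hf : ∀ (a : A) m, f (a • m) = a • f m)
    (hf' : ∀ (a : A) m, f' (a • m) = a • f' m)
    (h : ∀ v, f ((ResLeft.of k H A M).symm (g v)) = f' ((ResLeft.of k H A M).symm (g v))) :
    f = f' := by
  ext m
  obtain ⟨x, rfl⟩ := hg m
  induction x using BalTensor.induction with
  | h0 => simp only [map_zero]
  | ha x y hx hy => simp only [map_add, hx, hy]
  | ht a v => rw [actMap_tmul, hf, hf', h]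

end OneSided

/-! ### Generators of tensor products -/

section Tensor

variable {k : Type v} [CommRing k] {H A B : Type u} [Ring H] [HopfAlgebra k H]
  [Ring A] [Algebra k A] [ComoduleAlgebra k H A] [Ring B] [Algebra k B] [ComoduleAlgebra k H B]

instance instSMulCommCoinvRing : SMulCommClass A (CoinvRing k H A)ᵐᵒᵖ A where
  smul_comm a r b := (mul_assoc a b (CoinvRing.val k H A (unop r))).symm

variable {V : Type u} [AddCommGroup V] [Module k V] [Module (CoinvRing k H A) V]
    [IsScalarTower k (CoinvRing k H A) V]
  {M : Type u} [AddCommGroup M] [Module k M] [Module A M] [IsScalarTower k A M]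

theorem actMap_smul (g : V →ₗ[CoinvRing k H A] ResLeft k H A M) (a : A)
    (x : BalTensor k (CoinvRing k H A) A V) : actMap g (a • x) = a • actMap g x := by
  induction x using BalTensor.induction with
  | h0 => simp only [map_zero, smul_zero]
  | ha x y hx hy => simp only [map_add, smul_add, hx, hy]
  | ht b v => rw [BalTensor.smul_tmul_left, actMap_tmul, actMap_tmul, smul_eq_mul, mul_smul]

variable [Module (CoinvRing k H B)ᵐᵒᵖ V] [IsScalarTower k (CoinvRing k H B)ᵐᵒᵖ V]
    [SMulCommClass (CoinvRing k H A) (CoinvRing k H B)ᵐᵒᵖ V]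
  [Module Bᵐᵒᵖ M] [IsScalarTower k Bᵐᵒᵖ M] [SMulCommClass A Bᵐᵒᵖ M]
  {W : Type u} [AddCommGroup W] [Module k W] [Module (CoinvRing k H B) W]
    [IsScalarTower k (CoinvRing k H B) W]
  {N : Type u} [AddCommGroup N] [Module k N] [Module B N] [IsScalarTower k B N]

/-- The map `V ⊗_{B^{co H}} W → M ⊗_B N`, `v ⊗ w ↦ f(v) ⊗ g(w)`. -/
noncomputable def tensorMap (f : V →ₗ[CoinvRing k H A] ResLeft k H A M)
    (hf : ∀ (b : (CoinvRing k H B)ᵐᵒᵖ) v, (ResLeft.of k H A M).symm (f (b • v)) =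
      op (CoinvRing.val k H B (unop b)) • (ResLeft.of k H A M).symm (f v))
    (g : W →ₗ[CoinvRing k H B] ResLeft k H B N) :
    BalTensor k (CoinvRing k H B) V W →ₗ[k] BalTensor k B M N :=
  BalTensor.lift
    ((BalTensor.mk k B M N).compl₁₂ ((ResLeft.of k H A M).symm.toLinearMap ∘ₗ f.restrictScalars k)
      ((ResLeft.of k H B N).symm.toLinearMap ∘ₗ g.restrictScalars k)) (by
        intro r v w
        simp only [LinearMap.compl₁₂_apply, LinearMap.comp_apply, LinearEquiv.coe_coe,
          LinearMap.coe_restrictScalars, hf, map_smul g]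
        exact BalTensor.tmul_balanced _ _ _)

theorem tensorMap_tmul (f : V →ₗ[CoinvRing k H A] ResLeft k H A M) (hf)
    (g : W →ₗ[CoinvRing k H B] ResLeft k H B N) (v : V) (w : W) :
    tensorMap f hf g (.tmul k _ v w) =
      .tmul k B ((ResLeft.of k H A M).symm (f v)) ((ResLeft.of k H B N).symm (g w)) :=
  BalTensor.lift_tmul _ _ _ _

theorem tensorMap_smul (f : V →ₗ[CoinvRing k H A] ResLeft k H A M) (hf)
    (g : W →ₗ[CoinvRing k H B] ResLeft k H B N) (r : CoinvRing k H A)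
    (x : BalTensor k (CoinvRing k H B) V W) :
    tensorMap f hf g (r • x) = CoinvRing.val k H A r • tensorMap f hf g x := by
  induction x using BalTensor.induction with
  | h0 => simp only [map_zero, smul_zero]
  | ha x y hx hy => simp only [map_add, smul_add, hx, hy]
  | ht v w =>
    rw [BalTensor.smul_tmul_left, tensorMap_tmul, tensorMap_tmul, map_smul f,
      BalTensor.smul_tmul_left]
    rfl

/-- The map `V ⊗_{B^{co H}} W → M ⊗_B N`, `v ⊗ w ↦ f(v) ⊗ g(w)`, as an `A^{co H}`-linear map. -/
noncomputable def tensorLinear (f : V →ₗ[CoinvRing k H A] ResLeft k H A M)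
    (hf : ∀ (b : (CoinvRing k H B)ᵐᵒᵖ) v, (ResLeft.of k H A M).symm (f (b • v)) =
      op (CoinvRing.val k H B (unop b)) • (ResLeft.of k H A M).symm (f v))
    (g : W →ₗ[CoinvRing k H B] ResLeft k H B N) :
    BalTensor k (CoinvRing k H B) V W →ₗ[CoinvRing k H A] ResLeft k H A (BalTensor k B M N) where
  toFun x := ResLeft.of k H A _ (tensorMap f hf g x)
  map_add' x y := by simp only [map_add]
  map_smul' r x := congrArg (ResLeft.of k H A _) (tensorMap_smul f hf g r x)

theorem tensorLinear_tmul (f : V →ₗ[CoinvRing k H A] ResLeft k H A M) (hf)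
    (g : W →ₗ[CoinvRing k H B] ResLeft k H B N) (v : V) (w : W) :
    (ResLeft.of k H A _).symm (tensorLinear f hf g (.tmul k _ v w)) =
      .tmul k B ((ResLeft.of k H A M).symm (f v)) ((ResLeft.of k H B N).symm (g w)) :=
  tensorMap_tmul f hf g v w

variable (k H A B V) in
/-- The map `v ↦ v ⊗ w`. -/
noncomputable def tmulRight (w : W) :
    V →ₗ[CoinvRing k H A] BalTensor k (CoinvRing k H B) V W where
  toFun v := .tmul k _ v w
  map_add' _ _ := BalTensor.tmul_add_left _ _ _
  map_smul' r v := (BalTensor.smul_tmul_left r v w).symm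

/-- If `A ⊗_{A^{co H}} V → M` and `B ⊗_{B^{co H}} W → N` are bijective, then so is
`A ⊗_{A^{co H}} (V ⊗_{B^{co H}} W) → M ⊗_B N`. -/
theorem actMap_tensorLinear_bijective (f : V →ₗ[CoinvRing k H A] ResLeft k H A M)
    (hf : ∀ (b : (CoinvRing k H B)ᵐᵒᵖ) v, (ResLeft.of k H A M).symm (f (b • v)) =
      op (CoinvRing.val k H B (unop b)) • (ResLeft.of k H A M).symm (f v))
    (g : W →ₗ[CoinvRing k H B] ResLeft k H B N)
    (hf' : Function.Bijective (actMap f)) (hg : Function.Bijective (actMap g)) :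
    Function.Bijective (actMap (tensorLinear f hf g)) := by
  let F := LinearEquiv.ofBijective (actMap f) hf'
  let G := LinearEquiv.ofBijective (actMap g) hg
  have hFs : ∀ a v, F.symm (a • (ResLeft.of k H A M).symm (f v)) = .tmul k _ a v := by
    intro a v
    rw [LinearEquiv.symm_apply_eq]
    exact (actMap_tmul f a v).symm
  have hGs : ∀ w, G.symm ((ResLeft.of k H B N).symm (g w)) = .tmul k _ 1 w := by
    intro w
    rw [LinearEquiv.symm_apply_eq]
    exact ((actMap_tmul g 1 w).trans (one_smul _ _)).symm
  have hGsmul : ∀ (b : B) n, G.symm (b • n) = b • G.symm n := by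
    intro b n
    rw [LinearEquiv.symm_apply_eq]
    refine ((actMap_smul g b _).trans ?_).symm
    exact congrArg (b • ·) (G.apply_symm_apply n)
  -- The inverse of the map is built in steps: first `κ (a f(v)) w = a ⊗ (v ⊗ w)`.
  let κ : M →ₗ[k] W →ₗ[k] BalTensor k (CoinvRing k H A) A (BalTensor k (CoinvRing k H B) V W) :=
    LinearMap.mk₂ k (fun m w => BalTensor.lTensor k _ A (tmulRight k H A B V w) (F.symm m))
      (fun m m' w => by simp only [map_add]) (fun c m w => by simp only [map_smul])
      (fun m w w' => by
        generalize F.symm m = x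
        induction x using BalTensor.induction with
        | h0 => simp only [map_zero, add_zero]
        | ha x y hx hy => simp only [map_add, hx, hy]; abel
        | ht a v =>
          simp only [BalTensor.lTensor_tmul, ← BalTensor.tmul_add_right]
          exact congrArg (BalTensor.tmul k _ a) (BalTensor.tmul_add_right v w w'))
      (fun c m w => by
        generalize F.symm m = x
        induction x using BalTensor.induction with
        | h0 => simp only [map_zero, smul_zero]
        | ha x y hx hy => simp only [map_add, smul_add, hx, hy]
        | ht a v =>
          simp only [BalTensor.lTensor_tmul]
          exact (congrArg (BalTensor.tmul k _ a)
            (map_smul (BalTensor.mk k (CoinvRing k H B) V W v) c w)).trans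
              (map_smul (BalTensor.mk k (CoinvRing k H A) A _ a) c _))
  have hκ : ∀ m w, κ m w = BalTensor.lTensor k _ A (tmulRight k H A B V w) (F.symm m) :=
    fun _ _ => rfl
  have hκb : ∀ (r : CoinvRing k H B) m w, κ (op (CoinvRing.val k H B r) • m) w = κ m (r • w) := by
    intro r m w
    obtain ⟨x, rfl⟩ := F.surjective m
    induction x using BalTensor.induction with
    | h0 => simp only [map_zero, smul_zero, LinearMap.zero_apply]
    | ha x y hx hy => simp only [map_add, smul_add, LinearMap.add_apply, hx, hy]
    | ht a v =>
      have h : F (.tmul k _ a v) = a • (ResLeft.of k H A M).symm (f v) := actMap_tmul f a v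
      have h' : op (CoinvRing.val k H B r) • (ResLeft.of k H A M).symm (f v) =
        (ResLeft.of k H A M).symm (f (op r • v)) := (hf (op r) v).symm
      rw [h, ← smul_comm, h', hκ, hκ, hFs, hFs, BalTensor.lTensor_tmul, BalTensor.lTensor_tmul]
      exact congrArg (BalTensor.tmul k _ a) (BalTensor.tmul_balanced r v w)
  -- Next, `L m (b ⊗ w) = κ (m b) w`, so that `m ⊗ n ↦ L m (g⁻¹ n)` is balanced over `B`.
  let L : M → BalTensor k (CoinvRing k H B) B W →ₗ[k]
      BalTensor k (CoinvRing k H A) A (BalTensor k (CoinvRing k H B) V W) := fun m =>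
    BalTensor.lift (κ ∘ₗ ract k B M m) (by
      intro r b w
      simp only [LinearMap.comp_apply, ract_apply, op_smul_val, op_mul, mul_smul]
      exact hκb _ _ _)
  have hL : ∀ m b w, L m (.tmul k _ b w) = κ (op b • m) w :=
    fun m b w => BalTensor.lift_tmul _ _ _ _
  have hLadd : ∀ m m' y, L (m + m') y = L m y + L m' y := by
    intro m m' y
    induction y using BalTensor.induction with
    | h0 => simp only [map_zero, add_zero]
    | ha x y hx hy => simp only [map_add, hx, hy]; abel
    | ht b w => simp only [hL, smul_add, map_add, LinearMap.add_apply]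
  have hLsmul : ∀ (c : k) m y, L (c • m) y = c • L m y := by
    intro c m y
    induction y using BalTensor.induction with
    | h0 => simp only [map_zero, smul_zero]
    | ha x y hx hy => simp only [map_add, smul_add, hx, hy]
    | ht b w => simp only [hL, smul_comm (op b) c m, map_smul, LinearMap.smul_apply]
  have hLb : ∀ (b : B) m y, L (op b • m) y = L m (b • y) := by
    intro b m y
    induction y using BalTensor.induction with
    | h0 => simp only [map_zero, smul_zero]
    | ha x y hx hy => simp only [map_add, smul_add, hx, hy]
    | ht b' w => rw [BalTensor.smul_tmul_left, hL, hL, smul_eq_mul, op_mul, mul_smul]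
  let Ψ : BalTensor k B M N →ₗ[k]
      BalTensor k (CoinvRing k H A) A (BalTensor k (CoinvRing k H B) V W) :=
    BalTensor.lift (LinearMap.mk₂ k (fun m n => L m (G.symm n)) (fun m m' n => hLadd _ _ _)
      (fun c m n => hLsmul _ _ _) (fun m n n' => by simp only [map_add])
      (fun c m n => by simp only [map_smul])) (fun b m n => by
        simp only [LinearMap.mk₂_apply, hGsmul, hLb])
  have hΨ : ∀ x, Ψ (actMap (tensorLinear f hf g) x) = x := by
    intro x
    induction x using BalTensor.induction with
    | h0 => simp only [map_zero]
    | ha x y hx hy => simp only [map_add, hx, hy]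
    | ht a y =>
      induction y using BalTensor.induction with
      | h0 =>
        have h : BalTensor.tmul k (CoinvRing k H A) a
            (0 : BalTensor k (CoinvRing k H B) V W) = 0 := map_zero _
        rw [h, map_zero, map_zero]
      | ha x y hx hy => simp only [BalTensor.tmul_add_right, map_add, hx, hy]
      | ht v w =>
        rw [actMap_tmul, tensorLinear_tmul, BalTensor.smul_tmul_left]
        refine (BalTensor.lift_tmul _ _ _ _).trans ?_
        rw [LinearMap.mk₂_apply, hGs, hL, op_one, one_smul, hκ, hFs, BalTensor.lTensor_tmul]
        rfl
  refine ⟨Function.LeftInverse.injective hΨ, fun z => ?_⟩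
  induction z using BalTensor.induction with
  | h0 => exact ⟨0, map_zero _⟩
  | ha x y hx hy =>
    obtain ⟨x, rfl⟩ := hx
    obtain ⟨y, rfl⟩ := hy
    exact ⟨x + y, map_add _ _ _⟩
  | ht m n =>
    obtain ⟨y, rfl⟩ := hg.2 n
    induction y using BalTensor.induction generalizing m with
    | h0 =>
      refine ⟨0, ?_⟩
      rw [map_zero, map_zero]
      exact (map_zero (BalTensor.mk k B M N m)).symm
    | ha x y hx hy =>
      obtain ⟨x', hx⟩ := hx m
      obtain ⟨y', hy⟩ := hy m
      exact ⟨x' + y', by rw [map_add, map_add, BalTensor.tmul_add_right, hx, hy]⟩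
    | ht b w =>
      rw [actMap_tmul, ← BalTensor.tmul_balanced]
      obtain ⟨x, hx⟩ := hf'.2 (op b • m)
      refine ⟨BalTensor.lTensor k _ A (tmulRight k H A B V w) x, ?_⟩
      rw [← hx]
      clear hx
      induction x using BalTensor.induction with
      | h0 =>
        simp only [map_zero]
        exact (LinearMap.map_zero₂ (BalTensor.mk k B M N) _).symm
      | ha x y hx hy => simp only [map_add, BalTensor.tmul_add_left, hx, hy]
      | ht a v =>
        rw [BalTensor.lTensor_tmul, actMap_tmul, actMap_tmul, ← BalTensor.smul_tmul_left]
        exact congrArg (a • ·) (tensorLinear_tmul f hf g v w)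

end Tensor

/-! ### Induced modules -/

section Induced

variable {k : Type v} [CommRing k] {H A B : Type u} [Ring H] [HopfAlgebra k H]
  [HasBijectiveAntipode k H]
  [Ring A] [Algebra k A] [ComoduleAlgebra k H A] [Ring B] [Algebra k B] [ComoduleAlgebra k H B]

variable (k H A B) in
/-- The inclusion `A □_H B^op ⊆ A ⊗ B^op` as an `A^{co H}`-linear map. -/
noncomputable def cotensorIncl :
    Restr k H A B (CotensorRing k H A B) →ₗ[CoinvRing k H A] ResLeft k H A (EnvBimod k A B) where
  toFun t := ResLeft.of k H A _
    (EnvBimod.ofTensor k A B (CotensorRing.val k H A B ((Restr.of k H A B _).symm t)))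
  map_add' s t := by simp only [map_add]
  map_smul' r t := by
    obtain ⟨t, rfl⟩ := (Restr.of k H A B _).surjective t
    rw [Restr.smul_left_def, LinearEquiv.symm_apply_apply, smul_eq_mul, map_mul, map_mul]
    rfl

theorem actMap_cotensorIncl_bijective (hA : IsRightFaithfullyFlatGalois k H A) :
    Function.Bijective (actMap (cotensorIncl k H A B)) := by
  refine actMap_bijective hA _ Subtype.val_injective fun m => ⟨fun h => ?_, ?_⟩
  · exact ⟨⟨m, mem_cotensorAlg_of_envCoact (k := k) (H := H) (A := A) (B := B) m h⟩, rfl⟩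
  · rintro ⟨t, rfl⟩
    exact envCoact_cotensorAlg (k := k) (H := H) (A := A) (B := B) _ t.2

variable {M : Type u} [AddCommGroup M] [Module k M] [Module (CotensorRing k H A B) M]
  [IsScalarTower k (CotensorRing k H A B) M]

variable (k H A B M) in
/-- The unit `M → (A ⊗ B^op) ⊗_{A □_H B^op} M`, `m ↦ 1 ⊗ m`, as an `A^{co H}`-linear map. -/
noncomputable def unitLinear :
    Restr k H A B M →ₗ[CoinvRing k H A] ResLeft k H A (Ind k H A B M) where
  toFun m := ResLeft.of k H A _ (Ind.unit k H A B ((Restr.of k H A B _).symm m))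
  map_add' s t := by simp only [map_add]
  map_smul' r m := by
    obtain ⟨m, rfl⟩ := (Restr.of k H A B _).surjective m
    rw [Restr.smul_left_def, LinearEquiv.symm_apply_apply, ← Ind.smul_left_unit]
    rfl

theorem unitLinear_of (m : M) : (ResLeft.of k H A _).symm
    (unitLinear k H A B M (Restr.of k H A B M m)) = Ind.unit k H A B m := rfl

/-- The map `t ↦ t m`. -/
noncomputable def cotensorSMul (m : M) :
    Restr k H A B (CotensorRing k H A B) →ₗ[CoinvRing k H A] Restr k H A B M where
  toFun t := Restr.of k H A B M ((Restr.of k H A B _).symm t • m)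
  map_add' s t := by simp only [map_add, add_smul]
  map_smul' r t := by
    obtain ⟨t, rfl⟩ := (Restr.of k H A B _).surjective t
    rw [Restr.smul_left_def, LinearEquiv.symm_apply_apply, LinearEquiv.symm_apply_apply,
      smul_eq_mul, mul_smul]
    rfl

theorem Ind.smul_unit (x : CotensorRing k H A B) (m : M) :
    Ind.unit k H A B (x • m) =
      Ind.mk k H A B M (EnvBimod.ofTensor k A B (CotensorRing.val k H A B x)) m := by
  rw [Ind.unit, ← Ind.mk_balanced, EnvBimod.smul_cotensor_def, one_mul]

/-- `A ⊗_{A^{co H}} M ≅ (A ⊗ B^op) ⊗_{A □_H B^op} M`, because the structure theorem gives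
`A ⊗_{A^{co H}} (A □_H B^op) ≅ A ⊗ B^op`. -/
theorem actMap_unitLinear_bijective (hA : IsRightFaithfullyFlatGalois k H A) :
    Function.Bijective (actMap (unitLinear k H A B M)) := by
  have hE := actMap_cotensorIncl_bijective (B := B) hA
  let E := LinearEquiv.ofBijective _ hE
  have hEs : ∀ a t, E.symm (a • EnvBimod.ofTensor k A B (CotensorRing.val k H A B t)) =
      .tmul k _ a (Restr.of k H A B _ t) := by
    intro a t
    rw [LinearEquiv.symm_apply_eq]
    exact (actMap_tmul (cotensorIncl k H A B) a _).symm
  have hgen : ∀ (y : EnvBimod k A B) (p : EnvBimod k A B → Prop), p 0 →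
      (∀ x y, p x → p y → p (x + y)) →
      (∀ (a : A) t, p (a • EnvBimod.ofTensor k A B (CotensorRing.val k H A B t))) → p y := by
    intro y p h0 ha ht
    obtain ⟨x, rfl⟩ := hE.2 y
    induction x using BalTensor.induction with
    | h0 => rw [map_zero]; exact h0
    | ha x y hx hy => rw [map_add]; exact ha _ _ hx hy
    | ht a t => rw [actMap_tmul]; exact ht a _
  -- The inverse of the map is `y ⊗ m ↦ κ y m`, where `κ (a t) m = a ⊗ t m` for `t ∈ A □_H B^op`.
  let κ : EnvBimod k A B →ₗ[k] M →ₗ[k] BalTensor k (CoinvRing k H A) A (Restr k H A B M) :=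
    LinearMap.mk₂ k (fun y m => BalTensor.lTensor k _ A (cotensorSMul m) (E.symm y))
      (fun y y' m => by simp only [map_add]) (fun c y m => by simp only [map_smul])
      (fun y m m' => by
        generalize E.symm y = x
        induction x using BalTensor.induction with
        | h0 => simp only [map_zero, add_zero]
        | ha x y hx hy => simp only [map_add, hx, hy]; abel
        | ht a t =>
          simp only [BalTensor.lTensor_tmul, ← BalTensor.tmul_add_right]
          exact congrArg (BalTensor.tmul k _ a) (congrArg (Restr.of k H A B M) (smul_add _ _ _)))
      (fun c y m => by
        generalize E.symm y = x
        induction x using BalTensor.induction with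
        | h0 => simp only [map_zero, smul_zero]
        | ha x y hx hy => simp only [map_add, smul_add, hx, hy]
        | ht a t =>
          simp only [BalTensor.lTensor_tmul]
          refine Eq.trans ?_ (map_smul (BalTensor.mk k (CoinvRing k H A) A _ a) c _)
          exact congrArg (BalTensor.tmul k _ a) (congrArg (Restr.of k H A B M)
            (smul_comm _ _ _)))
  have hκ : ∀ a t m, κ (a • EnvBimod.ofTensor k A B (CotensorRing.val k H A B t)) m =
      .tmul k _ a (Restr.of k H A B M (t • m)) := by
    intro a t m
    refine (congrArg (BalTensor.lTensor k _ A (cotensorSMul m)) (hEs a t)).trans ?_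
    exact BalTensor.lTensor_tmul _ _ _
  have hmul : ∀ (a : A) (t x : CotensorRing k H A B),
      op x • (a • EnvBimod.ofTensor k A B (CotensorRing.val k H A B t)) =
        a • EnvBimod.ofTensor k A B (CotensorRing.val k H A B (t * x)) := by
    intro a t x
    rw [← smul_comm, EnvBimod.smul_cotensor_def, map_mul, map_mul]
  let Ψ : Ind k H A B M →ₗ[k] BalTensor k (CoinvRing k H A) A (Restr k H A B M) :=
    BalTensor.lift (R := CotensorRing k H A B) κ (by
      intro x y m
      refine hgen y (fun y => κ (op x • y) m = κ y (x • m)) ?_ ?_ ?_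
      · simp only [smul_zero, map_zero, LinearMap.zero_apply]
      · intro y y' h h'
        simp only [smul_add, map_add, LinearMap.add_apply, h, h']
      · intro a t
        rw [hmul, hκ, hκ, mul_smul])
  have hΨ : ∀ x, Ψ (actMap (unitLinear k H A B M) x) = x := by
    intro x
    induction x using BalTensor.induction with
    | h0 => simp only [map_zero]
    | ha x y hx hy => simp only [map_add, hx, hy]
    | ht a m =>
      obtain ⟨m, rfl⟩ := (Restr.of k H A B M).surjective m
      rw [actMap_tmul, unitLinear_of, Ind.unit, Ind.smul_left_mk]
      refine (BalTensor.lift_tmul (R := CotensorRing k H A B) _ _ _ _).trans ?_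
      have h : (1 : EnvBimod k A B) =
        EnvBimod.ofTensor k A B (CotensorRing.val k H A B 1) := by rw [map_one, map_one]
      rw [h, hκ, one_smul]
  refine ⟨Function.LeftInverse.injective hΨ, fun z => ?_⟩
  induction z using Ind.induction with
  | h0 => exact ⟨0, map_zero _⟩
  | ha x y hx hy =>
    obtain ⟨x, rfl⟩ := hx
    obtain ⟨y, rfl⟩ := hy
    exact ⟨x + y, map_add _ _ _⟩
  | ht y m =>
    refine hgen y (fun y => ∃ x, actMap (unitLinear k H A B M) x = Ind.mk k H A B M y m) ?_ ?_ ?_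
    · exact ⟨0, by rw [map_zero, map_zero, LinearMap.zero_apply]⟩
    · rintro y y' ⟨x, hx⟩ ⟨x', hx'⟩
      exact ⟨x + x', by rw [map_add, map_add, LinearMap.add_apply, hx, hx']⟩
    · intro a t
      refine ⟨.tmul k _ a (Restr.of k H A B M (t • m)), ?_⟩
      rw [actMap_tmul, unitLinear_of, Ind.smul_unit, Ind.smul_left_mk]

end Induced

/-! ### Two-sided relative Hopf modules and their coinvariants -/

section TwoSided

variable {k : Type v} [CommRing k] {H A B : Type u} [Ring H] [HopfAlgebra k H]
  [HasBijectiveAntipode k H]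
  [Ring A] [Algebra k A] [ComoduleAlgebra k H A] [Ring B] [Algebra k B] [ComoduleAlgebra k H B]

section Inverse

variable {X : Type u} [AddCommGroup X] [Module k X] [Module A X] [Module Bᵐᵒᵖ X]
    [RightComodule k H X]
  {Y : Type u} [AddCommGroup Y] [Module k Y] [Module A Y] [Module Bᵐᵒᵖ Y]
    [RightComodule k H Y]

/-- The inverse of a bijective morphism in `_A M_B^H`. -/
noncomputable def HopfBimodHom.symm (f : HopfBimodHom k H A B X Y) (hf : Function.Bijective f) :
    HopfBimodHom k H A B Y X where
  toLinearMap := (LinearEquiv.ofBijective f.toLinearMap hf).symm.toLinearMap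
  map_left a y := by
    obtain ⟨x, rfl⟩ := hf.2 y
    refine (congrArg (LinearEquiv.ofBijective f.toLinearMap hf).symm (f.map_left a x).symm).trans ?_
    refine ((LinearEquiv.ofBijective f.toLinearMap hf).symm_apply_apply _).trans ?_
    exact congrArg (a • ·) ((LinearEquiv.ofBijective f.toLinearMap hf).symm_apply_apply x).symm
  map_right a y := by
    obtain ⟨x, rfl⟩ := hf.2 y
    refine (congrArg (LinearEquiv.ofBijective f.toLinearMap hf).symm
      (f.map_right a x).symm).trans ?_
    refine ((LinearEquiv.ofBijective f.toLinearMap hf).symm_apply_apply _).trans ?_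
    exact congrArg (a • ·) ((LinearEquiv.ofBijective f.toLinearMap hf).symm_apply_apply x).symm
  map_coact y := by
    obtain ⟨x, rfl⟩ := hf.2 y
    have h : (LinearEquiv.ofBijective f.toLinearMap hf).symm.toLinearMap ∘ₗ f.toLinearMap =
        LinearMap.id :=
      LinearMap.ext fun x => (LinearEquiv.ofBijective f.toLinearMap hf).symm_apply_apply x
    rw [f.map_coact, ← LinearMap.rTensor_comp_apply, h, LinearMap.rTensor_id]
    exact congrArg (coact k H X) (LinearMap.congr_fun h x)

theorem HopfBimodHom.apply_symm (f : HopfBimodHom k H A B X Y) (hf : Function.Bijective f)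
    (y : Y) : f (f.symm hf y) = y :=
  (LinearEquiv.ofBijective f.toLinearMap hf).apply_symm_apply y

theorem HopfBimodHom.symm_apply (f : HopfBimodHom k H A B X Y) (hf : Function.Bijective f)
    (x : X) : f.symm hf (f x) = x :=
  (LinearEquiv.ofBijective f.toLinearMap hf).symm_apply_apply x

theorem HopfBimodHom.ext' {f g : HopfBimodHom k H A B X Y} (h : ∀ x, f x = g x) : f = g := by
  obtain ⟨⟨f, _, _⟩, _⟩ := f
  obtain ⟨⟨g, _, _⟩, _⟩ := g
  obtain rfl : f = g := LinearMap.ext h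
  rfl

end Inverse

variable (M : Type u) [AddCommGroup M] [Module k M] [Module A M] [Module Bᵐᵒᵖ M]
    [IsScalarTower k A M] [IsScalarTower k Bᵐᵒᵖ M] [SMulCommClass A Bᵐᵒᵖ M]
    [RightComodule k H M] [LeftHopfModule k H A M] [RightHopfModule k H B M]

variable (k H A B) in
/-- The inclusion `M^{co H} ⊆ M` as an `A^{co H}`-linear map. -/
noncomputable def coinvIncl :
    Restr k H A B (CoinvMod k H M) →ₗ[CoinvRing k H A] ResLeft k H A M where
  toFun m := ResLeft.of k H A _ (CoinvMod.val k H M ((Restr.of k H A B _).symm m))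
  map_add' _ _ := by simp only [map_add]
  map_smul' r m := by
    obtain ⟨m, rfl⟩ := (Restr.of k H A B _).surjective m
    rw [Restr.smul_left_def, LinearEquiv.symm_apply_apply, LinearEquiv.symm_apply_apply,
      val_restr_left]
    rfl

variable {M}

theorem coinvIncl_of (m : CoinvMod k H M) : (ResLeft.of k H A M).symm
    (coinvIncl k H A B M (Restr.of k H A B (CoinvMod k H M) m)) = CoinvMod.val k H M m := rfl

theorem actMap_coinvIncl_bijective (hA : IsRightFaithfullyFlatGalois k H A) :
    Function.Bijective (actMap (coinvIncl k H A B M)) := by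
  refine actMap_bijective hA _ (Subtype.val_injective (p := (· ∈ coinv k H M))) fun m => ⟨fun h => ?_, ?_⟩
  · exact ⟨Restr.of k H A B _ (CoinvMod.mk m h), rfl⟩
  · rintro ⟨t, rfl⟩
    exact CoinvMod.coact_val ((Restr.of k H A B _).symm t)

variable (k H A B M) in
/-- The morphism `(A ⊗ B^op) ⊗_{A □_H B^op} M^{co H} → M`, `(a ⊗ b) ⊗ m ↦ a m b`, in `_A M_B^H`. -/
noncomputable def Ind.counitHom : HopfBimodHom k H A B (Ind k H A B (CoinvMod k H M)) M where
  toLinearMap := Ind.counit k H A B M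
  map_left := Ind.counit_left
  map_right := Ind.counit_right
  map_coact x := by
    induction x using Ind.induction with
    | h0 => simp only [map_zero]
    | ha x y hx hy => simp only [map_add, hx, hy]
    | ht y m =>
      rw [Ind.counit_mk, coact_envAct_coinv _ m.coact_val, Ind.coact_mk,
        ← LinearMap.rTensor_comp_apply]
      have h : Ind.counit k H A B M ∘ₗ (Ind.mk k H A B (CoinvMod k H M)).flip m =
          (envAct k A B M).toLinearMap.flip (CoinvMod.val k H M m) ∘ₗ
            (EnvBimod.toTensor k A B).toLinearMap :=
        LinearMap.ext fun z => Ind.counit_mk z m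
      rw [h, LinearMap.rTensor_comp, LinearMap.comp_apply]
      refine congrArg _ ?_
      exact (LinearMap.congr_fun (LinearMap.rTensor_id H (A ⊗[k] Bᵐᵒᵖ))
        (envCoact k H A B (EnvBimod.toTensor k A B y))).symm

theorem Ind.counitHom_bijective (hA : IsRightFaithfullyFlatGalois k H A) :
    Function.Bijective (Ind.counitHom k H A B M) := by
  refine (Function.Bijective.of_comp_iff _ (actMap_unitLinear_bijective hA)).1 ?_
  convert actMap_coinvIncl_bijective (B := B) (M := M) hA using 1
  funext x
  change Ind.counit k H A B M (actMap (unitLinear k H A B _) x) = _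
  induction x using BalTensor.induction with
  | h0 => simp only [map_zero]
  | ha x y hx hy => simp only [map_add, hx, hy]
  | ht a m =>
    obtain ⟨m, rfl⟩ := (Restr.of k H A B _).surjective m
    rw [actMap_tmul, actMap_tmul, unitLinear_of, Ind.counit_left, Ind.counit_unit, coinvIncl_of]

section Map

variable {M₁ : Type u} [AddCommGroup M₁] [Module k M₁] [Module (CotensorRing k H A B) M₁]
    [IsScalarTower k (CotensorRing k H A B) M₁]
  {M₂ : Type u} [AddCommGroup M₂] [Module k M₂] [Module (CotensorRing k H A B) M₂]
    [IsScalarTower k (CotensorRing k H A B) M₂]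

/-- The linear map underlying `F(f)` for an `A □_H B^op`-linear map `f`. -/
noncomputable def Ind.mapLinear (f : M₁ →ₗ[CotensorRing k H A B] M₂) :
    Ind k H A B M₁ →ₗ[k] Ind k H A B M₂ :=
  BalTensor.map (R := CotensorRing k H A B) LinearMap.id (fun _ _ => rfl) (f.restrictScalars k)
    (fun x m => f.map_smul x m)

theorem Ind.mapLinear_mk (f : M₁ →ₗ[CotensorRing k H A B] M₂) (y : EnvBimod k A B) (m : M₁) :
    Ind.mapLinear f (Ind.mk k H A B M₁ y m) = Ind.mk k H A B M₂ y (f m) :=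
  BalTensor.map_tmul (R := CotensorRing k H A B) _ _ _ _ y m

/-- The morphism `F(f) = (A ⊗ B^op) ⊗_{A □_H B^op} f`. -/
noncomputable def Ind.map (f : M₁ →ₗ[CotensorRing k H A B] M₂) :
    HopfBimodHom k H A B (Ind k H A B M₁) (Ind k H A B M₂) where
  toLinearMap := Ind.mapLinear f
  map_left a x := by
    change Ind.mapLinear f (a • x) = a • Ind.mapLinear f x
    induction x using Ind.induction with
    | h0 => simp only [map_zero, smul_zero]
    | ha x y hx hy => simp only [map_add, smul_add, hx, hy]
    | ht y m =>
      rw [Ind.smul_left_mk, Ind.mapLinear_mk, Ind.mapLinear_mk, Ind.smul_left_mk]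
  map_right a x := by
    change Ind.mapLinear f (a • x) = a • Ind.mapLinear f x
    induction x using Ind.induction with
    | h0 => simp only [map_zero, smul_zero]
    | ha x y hx hy => simp only [map_add, smul_add, hx, hy]
    | ht y m =>
      rw [Ind.smul_right_mk, Ind.mapLinear_mk, Ind.mapLinear_mk, Ind.smul_right_mk]
  map_coact x := by
    induction x using Ind.induction with
    | h0 => simp only [map_zero]
    | ha x y hx hy => simp only [map_add, hx, hy]
    | ht y m =>
      rw [Ind.mapLinear_mk, Ind.coact_mk, Ind.coact_mk,
        ← LinearMap.rTensor_comp_apply]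
      congr 2

theorem Ind.map_mk (f : M₁ →ₗ[CotensorRing k H A B] M₂) (y : EnvBimod k A B) (m : M₁) :
    Ind.map f (Ind.mk k H A B M₁ y m) = Ind.mk k H A B M₂ y (f m) :=
  Ind.mapLinear_mk f y m

theorem Ind.map_unit (f : M₁ →ₗ[CotensorRing k H A B] M₂) (m : M₁) :
    Ind.map f (Ind.unit k H A B m) = Ind.unit k H A B (f m) :=
  Ind.mapLinear_mk f 1 m

theorem Ind.hom_ext {X : Type u} [AddCommGroup X] [Module k X] [Module A X] [Module Bᵐᵒᵖ X]
    [RightComodule k H X] {f g : HopfBimodHom k H A B (Ind k H A B M₁) X}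
    (h : ∀ y m, f (Ind.mk k H A B M₁ y m) = g (Ind.mk k H A B M₁ y m)) : f = g := by
  refine HopfBimodHom.ext' fun x => ?_
  induction x using Ind.induction with
  | h0 => simp only [map_zero]
  | ha x y hx hy => simp only [map_add, hx, hy]
  | ht y m => exact h y m

theorem Ind.map_id :
    Ind.map (LinearMap.id : M₁ →ₗ[CotensorRing k H A B] M₁) = HopfBimodHom.id k H A B _ :=
  Ind.hom_ext fun y m => Ind.map_mk _ y m

theorem Ind.map_comp {M₃ : Type u} [AddCommGroup M₃] [Module k M₃]
    [Module (CotensorRing k H A B) M₃] [IsScalarTower k (CotensorRing k H A B) M₃]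
    (g : M₂ →ₗ[CotensorRing k H A B] M₃) (f : M₁ →ₗ[CotensorRing k H A B] M₂) :
    Ind.map (g ∘ₗ f) = (Ind.map g).comp (Ind.map f) :=
  Ind.hom_ext fun y m => (Ind.map_mk _ y m).trans
    ((congrArg (Ind.map g) (Ind.map_mk f y m)).trans (Ind.map_mk g y _)).symm

/-- The unit `M₁ → F(M₁)^{co H}` as an `A □_H B^op`-linear map. -/
noncomputable def Ind.unitHom : M₁ →ₗ[CotensorRing k H A B] CoinvMod k H (Ind k H A B M₁) where
  toFun m := CoinvMod.mk (Ind.unit k H A B m) (Ind.coact_unit m)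
  map_add' m m' := CoinvMod.val_injective (map_add (Ind.unit k H A B) m m')
  map_smul' x m := CoinvMod.val_injective (by
    rw [RingHom.id_apply, val_smul_coinv, CoinvMod.val_mk, CoinvMod.val_mk, Ind.smul_unit]
    generalize CotensorRing.val k H A B x = y
    induction y with
    | zero => simp only [map_zero, LinearMap.zero_apply]
    | add x y hx hy => simp only [map_add, LinearMap.add_apply, hx, hy]
    | tmul a b =>
      rw [envAct_tmul, Ind.unit, Ind.smul_right_mk, Ind.smul_left_mk, EnvBimod.smul_right_def,
        EnvBimod.smul_left_def, mul_one, EnvBimod.mk_mul_mk, mul_one, one_mul]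
      rfl)

theorem Ind.unitHom_bijective (hA : IsRightFaithfullyFlatGalois k H A) :
    Function.Bijective (Ind.unitHom (k := k) (H := H) (A := A) (B := B) (M₁ := M₁)) := by
  obtain ⟨hinj, hsurj⟩ := bijective_coinv_of_actMap_bijective hA (unitLinear k H A B M₁)
    (fun v => Ind.coact_unit ((Restr.of k H A B M₁).symm v)) (actMap_unitLinear_bijective hA)
  constructor
  · intro m m' h
    exact hinj (congrArg (CoinvMod.val k H (Ind k H A B M₁)) h)
  · intro m
    obtain ⟨v, hv⟩ := hsurj _ m.coact_val
    exact ⟨(Restr.of k H A B M₁).symm v, CoinvMod.val_injective hv⟩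

end Map

variable {M' : Type u} [AddCommGroup M'] [Module k M'] [Module A M'] [Module Bᵐᵒᵖ M']
    [IsScalarTower k A M'] [IsScalarTower k Bᵐᵒᵖ M'] [SMulCommClass A Bᵐᵒᵖ M']
    [RightComodule k H M'] [LeftHopfModule k H A M'] [RightHopfModule k H B M']

/-- The morphism `M → M'` in `_A M_B^H` that extends an `A □_H B^op`-linear map `M^{co H} → M'^{co H}`. -/
noncomputable def extendCoinv (hA : IsRightFaithfullyFlatGalois k H A)
    (f : CoinvMod k H M →ₗ[CotensorRing k H A B] CoinvMod k H M') : HopfBimodHom k H A B M M' :=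
  (Ind.counitHom k H A B M').comp ((Ind.map f).comp
    ((Ind.counitHom k H A B M).symm (Ind.counitHom_bijective hA)))

theorem extendCoinv_val (hA : IsRightFaithfullyFlatGalois k H A)
    (f : CoinvMod k H M →ₗ[CotensorRing k H A B] CoinvMod k H M') (m : CoinvMod k H M) :
    extendCoinv hA f (CoinvMod.val k H M m) = CoinvMod.val k H M' (f m) := by
  have h : Ind.counitHom k H A B M (Ind.unit k H A B m) = CoinvMod.val k H M m :=
    Ind.counit_unit m
  change Ind.counitHom k H A B M' (Ind.map f ((Ind.counitHom k H A B M).symm _ _)) = _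
  rw [← h, HopfBimodHom.symm_apply, Ind.map_unit]
  exact Ind.counit_unit (f m)

end TwoSided

/-! ### Tensor products of coinvariants and of induced modules -/

section Pairing

variable {k : Type v} [CommRing k] {H A B C : Type u} [Ring H] [HopfAlgebra k H]
  [HasBijectiveAntipode k H]
  [Ring A] [Algebra k A] [ComoduleAlgebra k H A] [Ring B] [Algebra k B] [ComoduleAlgebra k H B]
  [Ring C] [Algebra k C] [ComoduleAlgebra k H C]

section Coinv

variable {M : Type u} [AddCommGroup M] [Module k M] [Module A M] [Module Bᵐᵒᵖ M]
    [IsScalarTower k A M] [IsScalarTower k Bᵐᵒᵖ M] [SMulCommClass A Bᵐᵒᵖ M]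
    [RightComodule k H M] [LeftHopfModule k H A M] [RightHopfModule k H B M]
  {N : Type u} [AddCommGroup N] [Module k N] [Module B N] [Module Aᵐᵒᵖ N]
    [IsScalarTower k B N] [IsScalarTower k Aᵐᵒᵖ N] [SMulCommClass B Aᵐᵒᵖ N]
    [RightComodule k H N] [LeftHopfModule k H B N] [RightHopfModule k H A N]

theorem coinvIncl_smul_right (b : (CoinvRing k H B)ᵐᵒᵖ) (m : Restr k H A B (CoinvMod k H M)) :
    (ResLeft.of k H A M).symm (coinvIncl k H A B M (b • m)) =
      op (CoinvRing.val k H B (unop b)) • (ResLeft.of k H A M).symm (coinvIncl k H A B M m) :=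
  val_restr_right b ((Restr.of k H A B _).symm m)

/-- `M^{co H} ⊗_{B^{co H}} N^{co H}` is identified with the coinvariants of `M ⊗_B N`. -/
theorem bijective_coinvTensor (hA : IsRightFaithfullyFlatGalois k H A)
    (hB : IsRightFaithfullyFlatGalois k H B) :
    Function.Injective (coinvTensor k H A B M N) ∧
      ∀ t, coact k H _ t = t ⊗ₜ 1 → ∃ x, coinvTensor k H A B M N x = t := by
  let g := tensorLinear (coinvIncl k H A B M) coinvIncl_smul_right
    (coinvIncl k H B A N)
  have hg : ∀ x, (ResLeft.of k H A _).symm (g x) = coinvTensor k H A B M N x := fun _ => rfl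
  have hbij : Function.Bijective (actMap g) :=
    actMap_tensorLinear_bijective _ _ _ (actMap_coinvIncl_bijective hA)
      (actMap_coinvIncl_bijective hB)
  have hco : ∀ x, coact k H _ ((ResLeft.of k H A _).symm (g x)) =
      (ResLeft.of k H A _).symm (g x) ⊗ₜ 1 := by
    intro x
    rw [hg]
    induction x using BalTensor.induction with
    | h0 => simp only [map_zero, TensorProduct.zero_tmul]
    | ha x y hx hy => simp only [map_add, TensorProduct.add_tmul, hx, hy]
    | ht m n =>
      obtain ⟨m, rfl⟩ := (Restr.of k H A B _).surjective m
      obtain ⟨n, rfl⟩ := (Restr.of k H B A _).surjective n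
      rw [coinvTensor_tmul, coact_balTensor_tmul, m.coact_val, n.coact_val, diagMul_tmul, mul_one]
      rfl
  exact bijective_coinv_of_actMap_bijective hA g hco hbij

end Coinv

variable {M : Type u} [AddCommGroup M] [Module k M] [Module (CotensorRing k H A B) M]
    [IsScalarTower k (CotensorRing k H A B) M]
  {N : Type u} [AddCommGroup N] [Module k N] [Module (CotensorRing k H B C) N]
    [IsScalarTower k (CotensorRing k H B C) N]

variable (k H A B C M N) in
/-- The map `M ⊗_{B^{co H}} N → F(M) ⊗_B F(N)`, `m ⊗ n ↦ (1 ⊗ m) ⊗ (1 ⊗ n)`, as an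
`A^{co H}`-linear map. -/
noncomputable def unitTensorLinear :
    BalTensor k (CoinvRing k H B) (Restr k H A B M) (Restr k H B C N) →ₗ[CoinvRing k H A]
      ResLeft k H A (BalTensor k B (Ind k H A B M) (Ind k H B C N)) :=
  tensorLinear (unitLinear k H A B M) (fun b m => (Ind.smul_right_unit k H A B M b m).symm)
    (unitLinear k H B C N)

theorem unitTensorLinear_eq
    (t : BalTensor k (CoinvRing k H B) (Restr k H A B M) (Restr k H B C N)) :
    (ResLeft.of k H A (BalTensor k B (Ind k H A B M) (Ind k H B C N))).symm
      (unitTensorLinear k H A B C M N t) = unitTensorAux k H A B M C N t := rfl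

theorem actMap_unitTensorLinear_bijective (hA : IsRightFaithfullyFlatGalois k H A)
    (hB : IsRightFaithfullyFlatGalois k H B) :
    Function.Bijective (actMap (unitTensorLinear k H A B C M N)) :=
  actMap_tensorLinear_bijective _ _ _ (actMap_unitLinear_bijective hA)
    (actMap_unitLinear_bijective hB)

theorem unitTensor_bijective (hA : IsRightFaithfullyFlatGalois k H A)
    (hB : IsRightFaithfullyFlatGalois k H B) :
    Function.Bijective (unitTensor k H A B M C N) := by
  obtain ⟨hinj, hsurj⟩ := bijective_coinv_of_actMap_bijective hA (unitTensorLinear k H A B C M N)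
    (coact_unitTensorAux k H A B M C N) (actMap_unitTensorLinear_bijective hA hB)
  constructor
  · intro x y h
    exact hinj (congrArg (CoinvMod.val k H _) h)
  · intro t
    obtain ⟨x, hx⟩ := hsurj _ t.coact_val
    exact ⟨x, CoinvMod.val_injective hx⟩

/-- `A`-linear maps on `F(M) ⊗_B F(N)` are determined by the elements `(1 ⊗ m) ⊗ (1 ⊗ n)`. -/
theorem eq_of_unit_tmul_unit (hA : IsRightFaithfullyFlatGalois k H A)
    (hB : IsRightFaithfullyFlatGalois k H B)
    {Q : Type*} [AddCommGroup Q] [Module k Q] [Module A Q]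
    (f f' : BalTensor k B (Ind k H A B M) (Ind k H B C N) →ₗ[k] Q)
    (hf : ∀ (a : A) t, f (a • t) = a • f t) (hf' : ∀ (a : A) t, f' (a • t) = a • f' t)
    (h : ∀ m n, f (.tmul k B (Ind.unit k H A B m) (Ind.unit k H B C n)) =
      f' (.tmul k B (Ind.unit k H A B m) (Ind.unit k H B C n))) : f = f' := by
  refine eq_of_comp_actMap _ (actMap_unitTensorLinear_bijective hA hB).2 f f' hf hf' fun t => ?_
  rw [unitTensorLinear_eq]
  induction t using BalTensor.induction with
  | h0 => simp only [map_zero]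
  | ha x y hx hy => simp only [map_add, hx, hy]
  | ht m n =>
    obtain ⟨m, rfl⟩ := (Restr.of k H A B M).surjective m
    obtain ⟨n, rfl⟩ := (Restr.of k H B C N).surjective n
    rw [unitTensorAux_tmul, h]

end Pairing

/-! ### The connecting maps of an induced context -/

section Connecting

variable {k : Type v} [CommRing k] {H A B : Type u} [Ring H] [HopfAlgebra k H]
  [HasBijectiveAntipode k H]
  [Ring A] [Algebra k A] [ComoduleAlgebra k H A] [Ring B] [Algebra k B] [ComoduleAlgebra k H B]
  {M : Type u} [AddCommGroup M] [Module k M] [Module (CotensorRing k H A B) M]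
    [IsScalarTower k (CotensorRing k H A B) M]
  {N : Type u} [AddCommGroup N] [Module k N] [Module (CotensorRing k H B A) N]
    [IsScalarTower k (CotensorRing k H B A) N]

/-- The `A □_H A^op`-linear map `(F(M) ⊗_B F(N))^{co H} ≅ M ⊗_{B^{co H}} N → A^{co H}`. -/
noncomputable def pairingCoinv (hA : IsRightFaithfullyFlatGalois k H A)
    (hB : IsRightFaithfullyFlatGalois k H B)
    (f : BalTensor k (CoinvRing k H B) (Restr k H A B M) (Restr k H B A N) →ₗ[k] CoinvRing k H A)
    (hf : IsCotensorLinear f) :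
    CoinvMod k H (BalTensor k B (Ind k H A B M) (Ind k H B A N)) →ₗ[CotensorRing k H A A]
      CoinvMod k H A where
  toFun t := CoinvMod.mk (CoinvRing.val k H A
    (f ((LinearEquiv.ofBijective _ (unitTensor_bijective hA hB)).symm t))) (CoinvRing.coact_val _)
  map_add' s t := CoinvMod.val_injective (by
    rw [map_add]
    simp only [map_add]
    rfl)
  map_smul' x t := by
    let e := LinearEquiv.ofBijective _ (unitTensor_bijective (C := A) (M := M) (N := N) hA hB)
    have h : f (e.symm (x • t)) = x • f (e.symm t) := by
      refine hf x _ _ ?_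
      exact (e.apply_symm_apply (x • t)).trans (congrArg (x • ·) (e.apply_symm_apply t).symm)
    exact CoinvMod.val_injective (congrArg (CoinvRing.val k H A) h)

/-- The morphism `F(M) ⊗_B F(N) → A` in `_A M_A^H` with `(1 ⊗ m) ⊗ (1 ⊗ n) ↦ f(m ⊗ n)`, for an
`A □_H A^op`-linear map `f : M ⊗_{B^{co H}} N → A^{co H}`. -/
noncomputable def inducedPairing (hA : IsRightFaithfullyFlatGalois k H A)
    (hB : IsRightFaithfullyFlatGalois k H B)
    (f : BalTensor k (CoinvRing k H B) (Restr k H A B M) (Restr k H B A N) →ₗ[k] CoinvRing k H A)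
    (hf : IsCotensorLinear f) :
    HopfBimodHom k H A A (BalTensor k B (Ind k H A B M) (Ind k H B A N)) A :=
  extendCoinv hA (pairingCoinv hA hB f hf)

theorem inducedPairing_unitTensorAux (hA : IsRightFaithfullyFlatGalois k H A)
    (hB : IsRightFaithfullyFlatGalois k H B)
    (f : BalTensor k (CoinvRing k H B) (Restr k H A B M) (Restr k H B A N) →ₗ[k] CoinvRing k H A)
    (hf : IsCotensorLinear f) (t) :
    inducedPairing hA hB f hf (unitTensorAux k H A B M A N t) = CoinvRing.val k H A (f t) := by
  rw [← val_unitTensor, inducedPairing, extendCoinv_val]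
  exact congrArg (fun x => CoinvRing.val k H A (f x)) (LinearEquiv.symm_apply_apply
    (LinearEquiv.ofBijective _ (unitTensor_bijective (C := A) (M := M) (N := N) hA hB)) t)

theorem inducedPairing_unit (hA : IsRightFaithfullyFlatGalois k H A)
    (hB : IsRightFaithfullyFlatGalois k H B)
    (f : BalTensor k (CoinvRing k H B) (Restr k H A B M) (Restr k H B A N) →ₗ[k] CoinvRing k H A)
    (hf : IsCotensorLinear f) (m : M) (n : N) :
    inducedPairing hA hB f hf (.tmul k B (Ind.unit k H A B m) (Ind.unit k H B A n)) =
      CoinvRing.val k H A (f (.tmul k _ (Restr.of k H A B M m) (Restr.of k H B A N n))) := by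
  rw [← inducedPairing_unitTensorAux, unitTensorAux_tmul]

theorem inducedPairing_bijective (hA : IsRightFaithfullyFlatGalois k H A)
    (hB : IsRightFaithfullyFlatGalois k H B)
    (f : BimodHom k (CoinvRing k H A) (CoinvRing k H A)
      (BalTensor k (CoinvRing k H B) (Restr k H A B M) (Restr k H B A N)) (CoinvRing k H A))
    (hf : IsCotensorLinear f.toLinearMap) (hbij : Function.Bijective f) :
    Function.Bijective (inducedPairing hA hB f.toLinearMap hf) := by
  let f' : BalTensor k (CoinvRing k H B) (Restr k H A B M) (Restr k H B A N) →ₗ[CoinvRing k H A]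
      CoinvRing k H A := { f.toLinearMap with map_smul' := f.map_left }
  let e : CoinvRing k H A →ₗ[CoinvRing k H A] ResLeft k H A A :=
    { toFun := fun r => ResLeft.of k H A A (CoinvRing.val k H A r)
      map_add' := fun r s => by simp only [map_add]
      map_smul' := fun r s => by
        rw [smul_eq_mul, map_mul]
        rfl }
  have he : Function.Bijective (actMap e) := by
    refine actMap_bijective hA e (Subtype.val_injective (p := (· ∈ coinvAlg k H A))) fun m =>
      ⟨fun h => ⟨⟨m, h⟩, rfl⟩, ?_⟩
    rintro ⟨r, rfl⟩
    exact CoinvRing.coact_val r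
  have hf' : Function.Bijective (BalTensor.lTensor k (CoinvRing k H A) A f') :=
    (hA.faithfullyFlat.bijective_iff f').2 hbij
  refine (Function.Bijective.of_comp_iff _ (actMap_unitTensorLinear_bijective hA hB)).1 ?_
  convert he.comp hf' using 1
  funext x
  change inducedPairing hA hB f.toLinearMap hf (actMap (unitTensorLinear k H A B A M N) x) =
    actMap e (BalTensor.lTensor k (CoinvRing k H A) A f' x)
  induction x using BalTensor.induction with
  | h0 => simp only [map_zero]
  | ha x y hx hy => simp only [map_add, hx, hy]
  | ht a t =>
    rw [actMap_tmul, BalTensor.lTensor_tmul, actMap_tmul, unitTensorLinear_eq]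
    refine ((inducedPairing hA hB f.toLinearMap hf).map_left a _).trans ?_
    exact congrArg (a • ·) (inducedPairing_unitTensorAux hA hB f.toLinearMap hf t)

theorem Ind.induction_unit (hA : IsRightFaithfullyFlatGalois k H A)
    {p : Ind k H A B M → Prop} (x : Ind k H A B M) (h0 : p 0)
    (ht : ∀ (a : A) m, p (a • Ind.unit k H A B m)) (ha : ∀ x y, p x → p y → p (x + y)) : p x := by
  obtain ⟨y, rfl⟩ := (actMap_unitLinear_bijective hA).2 x
  induction y using BalTensor.induction with
  | h0 => rw [map_zero]; exact h0
  | ha x y hx hy => rw [map_add]; exact ha _ _ hx hy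
  | ht a m => rw [actMap_tmul]; exact ht a _

/-- The associativity `α(m ⊗ n) m' = m β(n ⊗ m')` on induced modules follows from the case of the
generators `1 ⊗ m`, `1 ⊗ n`, `1 ⊗ m'`. -/
theorem pairing_smul_of_unit (hA : IsRightFaithfullyFlatGalois k H A)
    (hB : IsRightFaithfullyFlatGalois k H B)
    (α : BimodHom k A A (BalTensor k B (Ind k H A B M) (Ind k H B A N)) A)
    (β : BimodHom k B B (BalTensor k A (Ind k H B A N) (Ind k H A B M)) B)
    (h : ∀ (m : M) (n : N) (m' : M),
      α (.tmul k B (Ind.unit k H A B m) (Ind.unit k H B A n)) • Ind.unit k H A B m' =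
        op (β (.tmul k A (Ind.unit k H B A n) (Ind.unit k H A B m'))) • Ind.unit k H A B m)
    (m : Ind k H A B M) (n : Ind k H B A N) (m' : Ind k H A B M) :
    α (.tmul k B m n) • m' = op (β (.tmul k A n m')) • m := by
  have zl : ∀ n : Ind k H B A N, BalTensor.tmul k B (0 : Ind k H A B M) n = 0 :=
    fun n => LinearMap.map_zero₂ (BalTensor.mk k B _ _) n
  have zr : ∀ m : Ind k H A B M, BalTensor.tmul k B m (0 : Ind k H B A N) = 0 :=
    fun m => map_zero (BalTensor.mk k B _ _ m)
  have zl' : ∀ m : Ind k H A B M, BalTensor.tmul k A (0 : Ind k H B A N) m = 0 :=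
    fun m => LinearMap.map_zero₂ (BalTensor.mk k A _ _) m
  have zr' : ∀ n : Ind k H B A N, BalTensor.tmul k A n (0 : Ind k H A B M) = 0 :=
    fun n => map_zero (BalTensor.mk k A _ _ n)
  induction m' using Ind.induction_unit (B := B) (M := M) hA generalizing n with
  | h0 => rw [smul_zero, zr', map_zero, op_zero, zero_smul]
  | ha x y hx hy => rw [smul_add, BalTensor.tmul_add_right, map_add, MulOpposite.op_add, add_smul, hx, hy]
  | ht a m' =>
    have h₁ : α (.tmul k B m n) * a = α (.tmul k B m (op a • n)) := by
      rw [← BalTensor.smul_tmul_right]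
      exact (α.map_right (op a) _).symm
    rw [← mul_smul, h₁, ← BalTensor.tmul_balanced]
    clear h₁
    -- `m` may be any element of `F(M)` from here on, as `m ⊗ b n` is rewritten as `m b ⊗ n`.
    generalize op a • n = n
    induction n using Ind.induction_unit (B := A) (M := N) hB generalizing m with
    | h0 => rw [zr, zl', map_zero, map_zero, zero_smul, op_zero, zero_smul]
    | ha x y hx hy =>
      rw [BalTensor.tmul_add_right, BalTensor.tmul_add_left, map_add, map_add, MulOpposite.op_add, add_smul,
        add_smul, hx, hy]
    | ht b n =>
      have h₂ : β (.tmul k A (b • Ind.unit k H B A n) (Ind.unit k H A B m')) =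
          b * β (.tmul k A (Ind.unit k H B A n) (Ind.unit k H A B m')) := by
        rw [← BalTensor.smul_tmul_left]
        exact β.map_left b _
      rw [h₂, op_mul, mul_smul, ← BalTensor.tmul_balanced]
      generalize op b • m = m
      induction m using Ind.induction_unit (B := B) (M := M) hA with
      | h0 => rw [zl, map_zero, zero_smul, smul_zero]
      | ha x y hx hy =>
        rw [BalTensor.tmul_add_left, map_add, add_smul, smul_add, hx, hy]
      | ht c m =>
        have h₃ : α (.tmul k B (c • Ind.unit k H A B m) (Ind.unit k H B A n)) =
            c * α (.tmul k B (Ind.unit k H A B m) (Ind.unit k H B A n)) := by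
          rw [← BalTensor.smul_tmul_left]
          exact α.map_left c _
        rw [h₃, mul_smul, h, smul_comm]

end Connecting

/-! ### The equivalence of categories -/

section Equivalence

variable {k : Type v} [CommRing k] {H A B : Type u} [Ring H] [HopfAlgebra k H]
  [HasBijectiveAntipode k H]
  [Ring A] [Algebra k A] [ComoduleAlgebra k H A] [Ring B] [Algebra k B] [ComoduleAlgebra k H B]

/-- A morphism of `H`-Morita contexts with bijective components is an isomorphism. -/
noncomputable def HMoritaContext.isoOfBijective {X Y : HMoritaContext k H A B} (f : X ⟶ Y)
    (hμ : Function.Bijective f.μ) (hν : Function.Bijective f.ν) : X ≅ Y where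
  hom := f
  inv :=
    { μ := f.μ.symm hμ
      ν := f.ν.symm hν
      α_comp := fun m n => by
        rw [← f.α_comp, HopfBimodHom.apply_symm, HopfBimodHom.apply_symm]
      β_comp := fun n m => by
        rw [← f.β_comp, HopfBimodHom.apply_symm, HopfBimodHom.apply_symm] }
  hom_inv_id := HMoritaContext.Hom.ext (HopfBimodHom.ext' fun m => f.μ.symm_apply hμ m)
    (HopfBimodHom.ext' fun n => f.ν.symm_apply hν n)
  inv_hom_id := HMoritaContext.Hom.ext (HopfBimodHom.ext' fun m => f.μ.apply_symm hμ m)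
    (HopfBimodHom.ext' fun n => f.ν.apply_symm hν n)

/-- A morphism of `□_H`-Morita contexts with bijective components is an isomorphism. -/
noncomputable def CotensorMoritaContext.isoOfBijective {X Y : CotensorMoritaContext k H A B}
    (f : X ⟶ Y) (hμ : Function.Bijective f.μ) (hν : Function.Bijective f.ν) : X ≅ Y where
  hom := f
  inv :=
    { μ := (LinearEquiv.ofBijective f.μ hμ).symm.toLinearMap
      ν := (LinearEquiv.ofBijective f.ν hν).symm.toLinearMap
      α_comp := fun m n => by
        rw [← f.α_comp]
        exact congrArg₂ Y.pairα ((LinearEquiv.ofBijective f.μ hμ).apply_symm_apply m)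
          ((LinearEquiv.ofBijective f.ν hν).apply_symm_apply n)
      β_comp := fun n m => by
        rw [← f.β_comp]
        exact congrArg₂ Y.pairβ ((LinearEquiv.ofBijective f.ν hν).apply_symm_apply n)
          ((LinearEquiv.ofBijective f.μ hμ).apply_symm_apply m) }
  hom_inv_id := CotensorMoritaContext.Hom.ext
    (LinearMap.ext fun m => (LinearEquiv.ofBijective f.μ hμ).symm_apply_apply m)
    (LinearMap.ext fun n => (LinearEquiv.ofBijective f.ν hν).symm_apply_apply n)
  inv_hom_id := CotensorMoritaContext.Hom.ext
    (LinearMap.ext fun m => (LinearEquiv.ofBijective f.μ hμ).apply_symm_apply m)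
    (LinearMap.ext fun n => (LinearEquiv.ofBijective f.ν hν).apply_symm_apply n)

variable (hA : IsRightFaithfullyFlatGalois k H A) (hB : IsRightFaithfullyFlatGalois k H B)

/-- The `H`-Morita context `(A, B, F(M₁), F(N₁), α, β)` induced by a `□_H`-Morita context. -/
noncomputable def CotensorMoritaContext.induced (Y : CotensorMoritaContext k H A B) :
    HMoritaContext k H A B where
  M := Ind k H A B Y.M
  N := Ind k H B A Y.N
  ctx :=
    { α := (inducedPairing hA hB Y.ctx.α.toLinearMap Y.α_linear).toBimodHom
      β := (inducedPairing hB hA Y.ctx.β.toLinearMap Y.β_linear).toBimodHom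
      α_smul := pairing_smul_of_unit hA hB _ _ fun m n m' => by
        rw [inducedPairing_unit, inducedPairing_unit, Ind.smul_left_unit]
        refine Eq.trans ?_ (Ind.smul_right_unit k H A B Y.M (op (Y.pairβ n m')) m).symm
        exact congrArg (Ind.unit k H A B) (Y.ctx.α_smul _ _ _)
      β_smul := pairing_smul_of_unit hB hA _ _ fun n m n' => by
        rw [inducedPairing_unit, inducedPairing_unit, Ind.smul_left_unit]
        refine Eq.trans ?_ (Ind.smul_right_unit k H B A Y.N (op (Y.pairα m n')) n).symm
        exact congrArg (Ind.unit k H B A) (Y.ctx.β_smul _ _ _) }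
  α_colinear := (inducedPairing hA hB Y.ctx.α.toLinearMap Y.α_linear).map_coact
  β_colinear := (inducedPairing hB hA Y.ctx.β.toLinearMap Y.β_linear).map_coact

theorem CotensorMoritaContext.induced_α (Y : CotensorMoritaContext k H A B) (m : Y.M) (n : Y.N) :
    (Y.induced hA hB).ctx.α (.tmul k B (Ind.unit k H A B m) (Ind.unit k H B A n)) =
      CoinvRing.val k H A (Y.pairα m n) :=
  inducedPairing_unit hA hB _ Y.α_linear m n

theorem CotensorMoritaContext.induced_β (Y : CotensorMoritaContext k H A B) (n : Y.N) (m : Y.M) :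
    (Y.induced hA hB).ctx.β (.tmul k A (Ind.unit k H B A n) (Ind.unit k H A B m)) =
      CoinvRing.val k H B (Y.pairβ n m) :=
  inducedPairing_unit hB hA _ Y.β_linear n m

/-- Compatibility of bimodule maps out of induced modules with pairings can be checked on the
generators `1 ⊗ m` and `1 ⊗ n`. -/
theorem pairing_comp_of_unit (hA : IsRightFaithfullyFlatGalois k H A)
    (hB : IsRightFaithfullyFlatGalois k H B) {M N : Type u} [AddCommGroup M] [Module k M]
    [Module (CotensorRing k H A B) M] [IsScalarTower k (CotensorRing k H A B) M]
    [AddCommGroup N] [Module k N] [Module (CotensorRing k H B A) N]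
    [IsScalarTower k (CotensorRing k H B A) N]
    {X Y : Type u} [AddCommGroup X] [Module k X] [Module A X] [Module Bᵐᵒᵖ X]
    [IsScalarTower k A X] [IsScalarTower k Bᵐᵒᵖ X] [SMulCommClass A Bᵐᵒᵖ X] [RightComodule k H X]
    [AddCommGroup Y] [Module k Y] [Module B Y] [Module Aᵐᵒᵖ Y]
    [IsScalarTower k B Y] [IsScalarTower k Aᵐᵒᵖ Y] [SMulCommClass B Aᵐᵒᵖ Y] [RightComodule k H Y]
    (f : HopfBimodHom k H A B (Ind k H A B M) X) (g : HopfBimodHom k H B A (Ind k H B A N) Y)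
    (α : BimodHom k A A (BalTensor k B X Y) A)
    (α' : BimodHom k A A (BalTensor k B (Ind k H A B M) (Ind k H B A N)) A)
    (h : ∀ m n, α (.tmul k B (f (Ind.unit k H A B m)) (g (Ind.unit k H B A n))) =
      α' (.tmul k B (Ind.unit k H A B m) (Ind.unit k H B A n)))
    (x : Ind k H A B M) (y : Ind k H B A N) :
    α (.tmul k B (f x) (g y)) = α' (.tmul k B x y) := by
  let φ : BalTensor k B (Ind k H A B M) (Ind k H B A N) →ₗ[k] BalTensor k B X Y :=
    BalTensor.map f.toLinearMap (fun b m => f.map_right (op b) m) g.toLinearMap g.map_left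
  have hφ : ∀ x y, φ (.tmul k B x y) = .tmul k B (f x) (g y) :=
    fun x y => BalTensor.map_tmul _ _ _ _ x y
  have hφs : ∀ (a : A) t, φ (a • t) = a • φ t := by
    intro a t
    induction t using BalTensor.induction with
    | h0 => simp only [map_zero, smul_zero]
    | ha x y hx hy => simp only [map_add, smul_add, hx, hy]
    | ht x y =>
      rw [BalTensor.smul_tmul_left, hφ, hφ, BalTensor.smul_tmul_left]
      exact congrArg (fun z => BalTensor.tmul k B z (g y)) (f.map_left a x)
  have key : α.toLinearMap ∘ₗ φ = α'.toLinearMap := by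
    refine eq_of_unit_tmul_unit hA hB _ _ (fun a t => ?_) α'.map_left fun m n => ?_
    · rw [LinearMap.comp_apply, hφs]
      exact α.map_left a _
    · rw [LinearMap.comp_apply, hφ, h]
  rw [← hφ, ← key]
  rfl

/-- The induction functor `(A^{co H}, B^{co H}, M₁, N₁, α₁, β₁) ↦ (A, B, F(M₁), F(N₁), α, β)`. -/
noncomputable def inductionFunctor : CotensorMoritaContext k H A B ⥤ HMoritaContext k H A B where
  obj Y := Y.induced hA hB
  map {Y Y'} f :=
    { μ := Ind.map f.μ
      ν := Ind.map f.ν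
      α_comp := pairing_comp_of_unit hA hB _ _ _ _ fun m n => by
        refine (congrArg₂ (fun x y => (Y'.induced hA hB).ctx.α (.tmul k B x y))
          (Ind.map_unit f.μ m) (Ind.map_unit f.ν n)).trans ?_
        refine (Y'.induced_α hA hB _ _).trans (Eq.trans ?_ (Y.induced_α hA hB m n).symm)
        exact congrArg (CoinvRing.val k H A) (f.α_comp m n)
      β_comp := pairing_comp_of_unit hB hA _ _ _ _ fun n m => by
        refine (congrArg₂ (fun y x => (Y'.induced hA hB).ctx.β (.tmul k A y x))
          (Ind.map_unit f.ν n) (Ind.map_unit f.μ m)).trans ?_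
        refine (Y'.induced_β hA hB _ _).trans (Eq.trans ?_ (Y.induced_β hA hB n m).symm)
        exact congrArg (CoinvRing.val k H B) (f.β_comp n m) }
  map_id _ := HMoritaContext.Hom.ext Ind.map_id Ind.map_id
  map_comp f g := HMoritaContext.Hom.ext (Ind.map_comp g.μ f.μ) (Ind.map_comp g.ν f.ν)

/-- The isomorphism `(F(M^{co H}), F(N^{co H})) ≅ (M, N)` of `H`-Morita contexts. -/
noncomputable def inducedCoinvariantsIso (X : HMoritaContext k H A B) :
    X.coinvariants.induced hA hB ≅ X :=
  HMoritaContext.isoOfBijective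
    { μ := Ind.counitHom k H A B X.M
      ν := Ind.counitHom k H B A X.N
      α_comp := pairing_comp_of_unit hA hB _ _ _ _ fun m n => by
        refine Eq.trans ?_ (X.coinvariants.induced_α hA hB m n).symm
        refine Eq.trans ?_ (X.val_coinvariants_pairα k H A B m n).symm
        exact congrArg₂ (fun x y => X.ctx.α (.tmul k B x y)) (Ind.counit_unit m) (Ind.counit_unit n)
      β_comp := pairing_comp_of_unit hB hA _ _ _ _ fun n m => by
        refine Eq.trans ?_ (X.coinvariants.induced_β hA hB n m).symm
        refine Eq.trans ?_ (X.val_coinvariants_pairβ k H A B n m).symm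
        exact congrArg₂ (fun x y => X.ctx.β (.tmul k A x y)) (Ind.counit_unit n)
          (Ind.counit_unit m) }
    (Ind.counitHom_bijective hA) (Ind.counitHom_bijective hB)

/-- The isomorphism `(M₁, N₁) ≅ (F(M₁)^{co H}, F(N₁)^{co H})` of `□_H`-Morita contexts. -/
noncomputable def coinvariantsInducedIso (Y : CotensorMoritaContext k H A B) :
    Y ≅ (Y.induced hA hB).coinvariants :=
  CotensorMoritaContext.isoOfBijective
    { μ := Ind.unitHom
      ν := Ind.unitHom
      α_comp := fun m n => by
        have hinj : Function.Injective (CoinvRing.val k H A) := Subtype.val_injective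
        apply hinj
        refine (HMoritaContext.val_coinvariants_pairα k H A B (Y.induced hA hB) _ _).trans ?_
        exact Y.induced_α hA hB m n
      β_comp := fun n m => by
        have hinj : Function.Injective (CoinvRing.val k H B) := Subtype.val_injective
        apply hinj
        refine (HMoritaContext.val_coinvariants_pairβ k H A B (Y.induced hA hB) _ _).trans ?_
        exact Y.induced_β hA hB n m }
    (Ind.unitHom_bijective hA) (Ind.unitHom_bijective hB)

theorem Ind.counitHom_naturality {M M' : Type u}
    [AddCommGroup M] [Module k M] [Module A M] [Module Bᵐᵒᵖ M]
    [IsScalarTower k A M] [IsScalarTower k Bᵐᵒᵖ M] [SMulCommClass A Bᵐᵒᵖ M]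
    [RightComodule k H M] [LeftHopfModule k H A M] [RightHopfModule k H B M]
    [AddCommGroup M'] [Module k M'] [Module A M'] [Module Bᵐᵒᵖ M']
    [IsScalarTower k A M'] [IsScalarTower k Bᵐᵒᵖ M'] [SMulCommClass A Bᵐᵒᵖ M']
    [RightComodule k H M'] [LeftHopfModule k H A M'] [RightHopfModule k H B M']
    (f : HopfBimodHom k H A B M M') :
    (Ind.counitHom k H A B M').comp (Ind.map f.coinvMap) =
      f.comp (Ind.counitHom k H A B M) := by
  refine Ind.hom_ext fun y m => ?_
  refine (congrArg (Ind.counit k H A B M') (Ind.map_mk f.coinvMap y m)).trans ?_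
  refine (Ind.counit_mk y _).trans (Eq.symm ?_)
  refine (congrArg f (Ind.counit_mk y m)).trans ?_
  exact HopfBimodHom.map_envAct f.toLinearMap f.map_left f.map_right _ _

/-- Coinvariants and induction are quasi-inverse equivalences. -/
noncomputable def moritaEquivalence : HMoritaContext k H A B ≌ CotensorMoritaContext k H A B :=
  CategoryTheory.Equivalence.mk (coinvFunctor k H A B) (inductionFunctor hA hB)
    (NatIso.ofComponents (F := coinvFunctor k H A B ⋙ inductionFunctor hA hB) (G := 𝟭 _)
      (fun X => inducedCoinvariantsIso hA hB X) (fun f => HMoritaContext.Hom.ext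
        (Ind.counitHom_naturality f.μ) (Ind.counitHom_naturality f.ν))).symm
    (NatIso.ofComponents (F := 𝟭 _) (G := inductionFunctor hA hB ⋙ coinvFunctor k H A B)
      (fun Y => coinvariantsInducedIso hA hB Y) (fun f => CotensorMoritaContext.Hom.ext
        (LinearMap.ext fun m => CoinvMod.val_injective (Ind.map_unit f.μ m).symm)
        (LinearMap.ext fun n => CoinvMod.val_injective (Ind.map_unit f.ν n).symm))).symm

theorem isInduction_inductionFunctor (hA : IsRightFaithfullyFlatGalois k H A)
    (hB : IsRightFaithfullyFlatGalois k H B) : IsInduction k H A B (inductionFunctor hA hB) :=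
  ⟨fun Y => HopfBimodHom.id k H A B (Ind k H A B Y.M),
    fun Y => HopfBimodHom.id k H B A (Ind k H B A Y.N),
    fun _ => Function.bijective_id, fun _ => Function.bijective_id,
    fun _ _ f y m => Ind.map_mk f.μ y m, fun _ _ f y n => Ind.map_mk f.ν y n,
    fun Y m n => Y.induced_α hA hB m n, fun Y n m => Y.induced_β hA hB n m⟩

/-! ### Strictness -/

/-- If `α : M ⊗_B N → A` is bijective, then so is its restriction to coinvariants. -/
theorem coinvPairing_bijective (hA : IsRightFaithfullyFlatGalois k H A)
    (hB : IsRightFaithfullyFlatGalois k H B) {M N : Type u}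
    [AddCommGroup M] [Module k M] [Module A M] [Module Bᵐᵒᵖ M]
    [IsScalarTower k A M] [IsScalarTower k Bᵐᵒᵖ M] [SMulCommClass A Bᵐᵒᵖ M]
    [RightComodule k H M] [LeftHopfModule k H A M] [RightHopfModule k H B M]
    [AddCommGroup N] [Module k N] [Module B N] [Module Aᵐᵒᵖ N]
    [IsScalarTower k B N] [IsScalarTower k Aᵐᵒᵖ N] [SMulCommClass B Aᵐᵒᵖ N]
    [RightComodule k H N] [LeftHopfModule k H B N] [RightHopfModule k H A N]
    (α : BimodHom k A A (BalTensor k B M N) A)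
    (hα : ∀ t, coact k H A (α t) = α.toLinearMap.rTensor H (coact k H _ t))
    (hbij : Function.Bijective α) : Function.Bijective (coinvPairing α hα) := by
  obtain ⟨hinj, hsurj⟩ := bijective_coinvTensor (M := M) (N := N) hA hB
  constructor
  · intro s t h
    exact hinj (hbij.1 (congrArg (CoinvRing.val k H A) h))
  · intro r
    let α' : HopfBimodHom k H A A (BalTensor k B M N) A := { α with map_coact := hα }
    have ht : coact k H _ (α'.symm hbij (CoinvRing.val k H A r)) =
        α'.symm hbij (CoinvRing.val k H A r) ⊗ₜ 1 := by
      rw [(α'.symm hbij).map_coact, CoinvRing.coact_val, LinearMap.rTensor_tmul]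
    obtain ⟨x, hx⟩ := hsurj _ ht
    have hval : Function.Injective (CoinvRing.val k H A) := Subtype.val_injective
    refine ⟨x, hval ?_⟩
    rw [val_coinvPairing, hx]
    exact α'.apply_symm hbij _

end Equivalence

end HopfMorita

theorem theorem5p7 {k : Type v} [CommRing k] {H A B : Type u}
    [Ring H] [HopfAlgebra k H] [HopfMorita.HasBijectiveAntipode k H]
    [Ring A] [Algebra k A] [HopfMorita.ComoduleAlgebra k H A]
    [Ring B] [Algebra k B] [HopfMorita.ComoduleAlgebra k H B]
    (hA : HopfMorita.IsRightFaithfullyFlatGalois k H A)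
    (hB : HopfMorita.IsRightFaithfullyFlatGalois k H B) :
    ∃ E : HopfMorita.HMoritaContext k H A B ≌ HopfMorita.CotensorMoritaContext k H A B,
      E.functor = HopfMorita.coinvFunctor k H A B ∧
      HopfMorita.IsInduction k H A B E.inverse ∧
      (∀ X : HopfMorita.HMoritaContext k H A B, X.IsStrict → (E.functor.obj X).IsStrict) ∧
      (∀ Y : HopfMorita.CotensorMoritaContext k H A B, Y.IsStrict → (E.inverse.obj Y).IsStrict) := by
  refine ⟨HopfMorita.moritaEquivalence hA hB, rfl,
    HopfMorita.isInduction_inductionFunctor hA hB, fun X hX => ?_, fun Y hY => ?_⟩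
  · exact ⟨HopfMorita.coinvPairing_bijective hA hB X.ctx.α X.α_colinear hX.1,
      HopfMorita.coinvPairing_bijective hB hA X.ctx.β X.β_colinear hX.2⟩
  · exact ⟨HopfMorita.inducedPairing_bijective hA hB Y.ctx.α Y.α_linear hY.1,
      HopfMorita.inducedPairing_bijective hB hA Y.ctx.β Y.β_linear hY.2⟩
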